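/- Let $\mathbb F$ be a non-Archimedean ordered valued field: an ordered field with an absolute value $|\cdot|\colon\mathbb F\to\mathbb R_{\ge 0}$ satisfying $|x+y|\le\max\{|x|,|y|\}$ for all $x,y$, and $|x|\le|y|$ whenever $0\le x\le y$; it carries the order topology. Put $\Lambda=\log|\mathbb F^\times|\subset\mathbb R$ and $\mathcal O=\{x\in\mathbb F : |x|\le 1\}$. Let $d\ge 1$, let $V=\mathbb F^d$, and regard $\mathbb F^{d-1}\subset\mathbb P(V)$ through $(x_1,\dots,x_{d-1})\mapsto[x_1:\dots:x_{d-1}:1]$. Let $P\subset\mathbb F^{d-1}$ be an integral polytope over a subfield $\mathbb K\subset\mathcal O$, that is, the $\mathbb F$-convex hull of finitely many points of $\mathbb K^{d-1}$, and assume that its interior $\Omega\subset\mathbb F^{d-1}\subset\mathbb P(V)$ is non-empty. *Hilbert metric space.* For $x,y\in\Omega$ let $d_\Omega(x,y)=\sup_{\varphi,\psi}\log\left|\frac{\psi(x)\,\varphi(y)}{\psi(y)\,\varphi(x)}\right|$, the supremum over all linear forms $\varphi,\psi$ on $V$ without zeros on $\Omega$, and let $\pi\colon\Omega\to X_\Omega=\Omega/\{d_\Omega=0\}$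 be the quotient metric space. *Model space.* Let $\mathbb A_\Lambda=\Lambda^d/\Lambda(1,\dots,1)$ with the metric $d_{\mathrm H}([\alpha],[\beta])=\max_{i,j}|(\alpha_i-\beta_i)-(\alpha_j-\beta_j)|$, let $\mathbb A^+_\Lambda=\{[\alpha]\in\mathbb A_\Lambda:\alpha_1\ge\dots\ge\alpha_d\}$, and for $D\subset\{1,\dots,d-1\}$ let $\mathbb A^+_{D,\Lambda}=\{[\alpha]\in\mathbb A^+_\Lambda:\alpha_i=\alpha_{i+1}\text{ for }i\in\{1,\dots,d-1\}\setminus D\}$. A flag of $P$ is a non-empty finite chain of non-empty faces of $P$ ($P$ itself being a face). For a flag $F$ containing $P$ put $D(F)=\{\dim\sigma+1:\sigma\in F,\ \sigma\ne P\}$. Let $K(P,\Lambda)$ be the quotient of $\bigsqcup_{F\ni P}\mathbb A^+_{D(F),\Lambda}\times\{F\}$ by the equivalence relation generated by $(x,F)\sim(x,F')$ for $F\subset F'$, with the quotient pseudo-metric, again denoted $d_{\mathrm H}$: the infimum of the lengths of chains that move within the pieces by $d_{\mathrm H}$ and pass between equivalent points. Let $\alpha_F\colon\mathbb A^+_{D(F),\Lambda}\to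 K(P,\Lambda)$ be the natural map, $K_F$ its image, and $o$ the cone point, the class of $(0,F)$ for any $F$. Let $S_F$ be the convex hull of the barycenters of the faces in $F$, the barycenter of a polytope being the mean of its vertices. Then all distances in $K(P,\Lambda)$ are finite, and there is a map $\Psi\colon\Omega\to K(P,\Lambda)$ that induces a bijective isometry $\overline\Psi\colon(X_\Omega,d_\Omega)\to(K(P,\Lambda),d_{\mathrm H})$, $\overline\Psi\circ\pi=\Psi$. The barycenter of $P$ lies in $\Omega$ and $\Psi$ sends it to $o$. For every maximal flag $F$ of $P$, with $\Omega_F=\Omega\cap S_F$: one has $\mathbb A^+_{D(F),\Lambda}=\mathbb A^+_\Lambda$; the map $\alpha_F$ is an isometry of $(\mathbb A^+_\Lambda,d_{\mathrm H})$ onto $K_F$; $\Psi(\Omega_F)=K_F$; and there is a basis $(e_1,\dots,e_d)$ of $V$ such that $\Omega_F=\mathbb P(\{\sum_i x_ie_i : x_1\ge\dots\ge x_d>0\})$ and $\Psi\big(\mathbb P(\sum_i x_ie_i)\big)=\alpha_F([\log|x_1|,\dots,\log|x_d|])$ for all $x_1\ge\dots\ge x_d>0$ in $\mathbb F$. In particular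 $\overline\Psi$ maps $\pi(\Omega_F)$ isometrically onto the copy $K_F$ of $\mathbb A^+_\Lambda$. -/

import Mathlib

open scoped LinearAlgebra.Projectivization

noncomputable section

namespace NAHilbert

/-! ### Hilbert geometry over a valued field -/

section Hilbert

variable {F V : Type*} [Field F] [AddCommGroup V] [Module F V]

/-- The dual set of `Ω ⊆ ℙ V`: the classes of linear forms that vanish at no point of `Ω`
(the condition does not depend on the lifts, so we may use the chosen representatives). -/
def dualSet (Ω : Set (ℙ F V)) : Set (ℙ F (Module.Dual F V)) :=
  {φ | ∀ x ∈ Ω, φ.rep x.rep ≠ 0}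

/-- The cross-ratio of two points `x, y` and two hyperplanes `φ, ψ`
(homogeneous of degree zero in each entry, hence independent of the lifts). It is only used
for `x, y ∈ Ω` and `φ, ψ ∈ dualSet Ω`, where all four values are nonzero. -/
def crossRatio (φ : ℙ F (Module.Dual F V)) (x y : ℙ F V) (ψ : ℙ F (Module.Dual F V)) : F :=
  ψ.rep x.rep / ψ.rep y.rep * (φ.rep y.rep / φ.rep x.rep)

open Classical in
/-- The Hilbert pseudo-distance
`d_Ω(x, y) = sup { log |[φ, x, y, ψ]| : φ, ψ ∈ Ω* }`, with the supremum of the empty set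
equal to `∞`. -/
def hilbertDist (v : AbsoluteValue F ℝ) (Ω : Set (ℙ F V)) (x y : ℙ F V) : EReal :=
  if dualSet Ω = ∅ then ⊤
  else ⨆ (φ : dualSet Ω) (ψ : dualSet Ω), ((Real.log (v (crossRatio φ.1 x y ψ.1)) : ℝ) : EReal)

/-- The points of `Ω`, as a type that carries the Hilbert pseudo-distance. -/
@[ext]
structure HilbertDomain (v : AbsoluteValue F ℝ) (Ω : Set (ℙ F V))
    (hΩ : (dualSet Ω).Nonempty) where
  /-- the underlying point -/
  pt : ℙ F V
  /-- it lies in `Ω` -/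
  mem : pt ∈ Ω

theorem hilbertDist_eq (v : AbsoluteValue F ℝ) {Ω : Set (ℙ F V)} (hΩ : (dualSet Ω).Nonempty)
    (x y : ℙ F V) : hilbertDist v Ω x y =
      ⨆ (φ : dualSet Ω) (ψ : dualSet Ω),
        ((Real.log (v (crossRatio φ.1 x y ψ.1)) : ℝ) : EReal) := by
  rw [hilbertDist, if_neg hΩ.ne_empty]

theorem hilbertDist_self (v : AbsoluteValue F ℝ) {Ω : Set (ℙ F V)}
    (hΩ : (dualSet Ω).Nonempty) {x : ℙ F V} (hx : x ∈ Ω) : hilbertDist v Ω x x = 0 := by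
  rw [hilbertDist_eq v hΩ]
  have : Nonempty (dualSet Ω) := hΩ.to_subtype
  have h : ∀ φ ψ : dualSet Ω, crossRatio φ.1 x x ψ.1 = 1 := fun φ ψ => by
    rw [crossRatio, div_self (ψ.2 x hx), div_self (φ.2 x hx), one_mul]
  simp [h]

theorem hilbertDist_comm (v : AbsoluteValue F ℝ) {Ω : Set (ℙ F V)}
    (hΩ : (dualSet Ω).Nonempty) (x y : ℙ F V) :
    hilbertDist v Ω x y = hilbertDist v Ω y x := by
  rw [hilbertDist_eq v hΩ, hilbertDist_eq v hΩ, iSup_comm]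
  have h : ∀ φ ψ : dualSet Ω, crossRatio φ.1 x y ψ.1 = crossRatio ψ.1 y x φ.1 := fun φ ψ => by
    rw [crossRatio, crossRatio, mul_comm]
  simp only [h]

theorem hilbertDist_nonneg (v : AbsoluteValue F ℝ) {Ω : Set (ℙ F V)}
    (hΩ : (dualSet Ω).Nonempty) {x y : ℙ F V} (hx : x ∈ Ω) (hy : y ∈ Ω) :
    0 ≤ hilbertDist v Ω x y := by
  rw [hilbertDist_eq v hΩ]
  obtain ⟨φ, hφ⟩ := hΩ
  have h : crossRatio φ x y φ = 1 := by
    have h1 := hφ x hx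
    have h2 := hφ y hy
    rw [crossRatio]
    field_simp
  refine le_trans ?_ (le_iSup_of_le ⟨φ, hφ⟩ (le_iSup_of_le ⟨φ, hφ⟩ le_rfl))
  simp [h]

theorem hilbertDist_triangle (v : AbsoluteValue F ℝ) {Ω : Set (ℙ F V)}
    (hΩ : (dualSet Ω).Nonempty) {x y z : ℙ F V} (hx : x ∈ Ω) (hy : y ∈ Ω) (hz : z ∈ Ω) :
    hilbertDist v Ω x z ≤ hilbertDist v Ω x y + hilbertDist v Ω y z := by
  rw [hilbertDist_eq v hΩ x z]
  refine iSup_le fun φ => iSup_le fun ψ => ?_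
  have h1 := φ.2 x hx
  have h2 := φ.2 y hy
  have h3 := φ.2 z hz
  have h4 := ψ.2 x hx
  have h5 := ψ.2 y hy
  have h6 := ψ.2 z hz
  have h : crossRatio φ.1 x z ψ.1 = crossRatio φ.1 x y ψ.1 * crossRatio φ.1 y z ψ.1 := by
    simp only [crossRatio]
    field_simp
  have ha : v (crossRatio φ.1 x y ψ.1) ≠ 0 := by
    rw [v.ne_zero_iff, crossRatio]
    positivity
  have hb : v (crossRatio φ.1 y z ψ.1) ≠ 0 := by
    rw [v.ne_zero_iff, crossRatio]
    positivity
  rw [h, map_mul, Real.log_mul ha hb, EReal.coe_add, hilbertDist_eq v hΩ x y,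
    hilbertDist_eq v hΩ y z]
  exact add_le_add (le_iSup_of_le φ (le_iSup_of_le ψ le_rfl))
    (le_iSup_of_le φ (le_iSup_of_le ψ le_rfl))

/-- `Ω` with its Hilbert pseudo-distance. -/
instance (v : AbsoluteValue F ℝ) (Ω : Set (ℙ F V)) (hΩ : (dualSet Ω).Nonempty) :
    PseudoEMetricSpace (HilbertDomain v Ω hΩ) where
  edist p q := (hilbertDist v Ω p.pt q.pt).toENNReal
  edist_self p := by simp [hilbertDist_self v hΩ p.mem]
  edist_comm p q := by rw [hilbertDist_comm v hΩ]
  edist_triangle p q r := by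
    rw [← EReal.toENNReal_add (hilbertDist_nonneg v hΩ p.mem q.mem)
      (hilbertDist_nonneg v hΩ q.mem r.mem)]
    exact EReal.toENNReal_le_toENNReal (hilbertDist_triangle v hΩ p.mem q.mem r.mem)

/-- The associated Hilbert metric space `X_Ω = Ω / {d_Ω = 0}`, with the distance induced by
`d_Ω`: the separation quotient of the pseudo-metric space `Ω`. The projection `Ω → X_Ω` is
`SeparationQuotient.mk`. -/
abbrev HilbertSpace (v : AbsoluteValue F ℝ) (Ω : Set (ℙ F V)) (hΩ : (dualSet Ω).Nonempty) :
    Type _ :=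
  SeparationQuotient (HilbertDomain v Ω hΩ)

/-- The image `ℙ(C) ⊆ ℙ V` of a subset `C ⊆ V`. -/
def projImage (C : Set V) : Set (ℙ F V) :=
  {p | ∃ w ∈ C, ∃ hw : w ≠ 0, Projectivization.mk F w hw = p}

/-- The value group `Λ = log |F^×|`. -/
def valueGroup (v : AbsoluteValue F ℝ) : AddSubgroup ℝ where
  carrier := {r | ∃ x : F, x ≠ 0 ∧ Real.log (v x) = r}
  zero_mem' := ⟨1, one_ne_zero, by simp⟩
  add_mem' := by
    rintro _ _ ⟨x, hx, rfl⟩ ⟨y, hy, rfl⟩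
    exact ⟨x * y, mul_ne_zero hx hy, by
      rw [map_mul, Real.log_mul (v.ne_zero hx) (v.ne_zero hy)]⟩
  neg_mem' := by
    rintro _ ⟨x, hx, rfl⟩
    exact ⟨x⁻¹, inv_ne_zero hx, by rw [map_inv₀, Real.log_inv]⟩

theorem log_mem_valueGroup (v : AbsoluteValue F ℝ) (x : F) :
    Real.log (v x) ∈ valueGroup v := by
  by_cases hx : x = 0
  · subst hx
    simp
  · exact ⟨x, hx, rfl⟩

end Hilbert

/-! ### The model flat and its Weyl chamber -/

section Flat

/-- The subgroup `Λ (1, …, 1)` of `Λ^d`. -/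
def diagonal (Λ : AddSubgroup ℝ) (d : ℕ) : AddSubgroup (Fin d → Λ) where
  carrier := {α | ∃ c : Λ, α = fun _ => c}
  zero_mem' := ⟨0, rfl⟩
  add_mem' := by
    rintro _ _ ⟨a, rfl⟩ ⟨b, rfl⟩
    exact ⟨a + b, rfl⟩
  neg_mem' := by
    rintro _ ⟨a, rfl⟩
    exact ⟨-a, rfl⟩

/-- The `(d-1)`-dimensional `Λ`-model flat `𝔸_Λ = Λ^d / Λ (1, …, 1)`. -/
def ModelFlat (Λ : AddSubgroup ℝ) (d : ℕ) : Type :=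
  (Fin d → Λ) ⧸ diagonal Λ d

instance (Λ : AddSubgroup ℝ) (d : ℕ) : AddCommGroup (ModelFlat Λ d) :=
  inferInstanceAs (AddCommGroup ((Fin d → Λ) ⧸ diagonal Λ d))

/-- The class `[α] ∈ 𝔸_Λ` of `α ∈ Λ^d`. -/
def ModelFlat.mk {Λ : AddSubgroup ℝ} {d : ℕ} (α : Fin d → Λ) : ModelFlat Λ d :=
  QuotientAddGroup.mk α

/-- The norm `‖[α]‖ = max_{i,j} |α_i - α_j|` on the model flat. -/
def hexNorm {Λ : AddSubgroup ℝ} {d : ℕ} (a : ModelFlat Λ d) : ℝ :=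
  Quotient.lift (s := QuotientAddGroup.leftRel (diagonal Λ d))
    (fun α : Fin d → Λ => ⨆ p : Fin d × Fin d, |(α p.1 : ℝ) - (α p.2 : ℝ)|)
    (by
      intro α β h
      obtain ⟨c, hc⟩ := QuotientAddGroup.leftRel_apply.1 h
      have hβ : ∀ i, (β i : ℝ) = α i + c := fun i => by
        have h2 := congrArg Subtype.val (congrFun hc i)
        simp only [Pi.add_apply, Pi.neg_apply, AddSubgroup.coe_add, AddSubgroup.coe_neg] at h2
        linarith
      simp only [hβ, add_sub_add_right_eq_sub]) a

/-- The metric `d_H` on the model flat. -/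
def hexDist {Λ : AddSubgroup ℝ} {d : ℕ} (a b : ModelFlat Λ d) : ℝ :=
  hexNorm (a - b)

/-- The closed Weyl chamber `𝔸⁺_Λ = {[α] : α₁ ≥ … ≥ α_d}`. -/
def weylChamber (Λ : AddSubgroup ℝ) (d : ℕ) : Set (ModelFlat Λ d) :=
  {a | ∃ α : Fin d → Λ, ModelFlat.mk α = a ∧ Antitone α}

/-- The subset `𝔸_{D,Λ} = {[α] : α_i = α_{i+1} for all i ∈ {1, …, d-1} \ D}`. The coordinates
are numbered from zero here: for `j = i + 1` in `Fin d` the coordinates `α i` and `α j` are the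
ones with the numbers `j` and `j + 1` when one counts from one. -/
def flatFace (Λ : AddSubgroup ℝ) (d : ℕ) (D : Set ℕ) : Set (ModelFlat Λ d) :=
  {a | ∃ α : Fin d → Λ, ModelFlat.mk α = a ∧
    ∀ i j : Fin d, (j : ℕ) = (i : ℕ) + 1 → (j : ℕ) ∉ D → α i = α j}

/-- The face `𝔸⁺_{D,Λ}` of the Weyl chamber. -/
def weylFace (Λ : AddSubgroup ℝ) (d : ℕ) (D : Set ℕ) : Set (ModelFlat Λ d) :=
  flatFace Λ d D ∩ weylChamber Λ d

theorem zero_mem_weylFace (Λ : AddSubgroup ℝ) (d : ℕ) (D : Set ℕ) :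
    (0 : ModelFlat Λ d) ∈ weylFace Λ d D :=
  ⟨⟨0, rfl, fun _ _ _ _ => rfl⟩, ⟨0, rfl, fun _ _ _ => le_rfl⟩⟩

/-- The class `[log |x₁|, …, log |x_d|] ∈ 𝔸_Λ` of a vector `x` of nonzero coordinates. -/
def logClass {F : Type*} [Field F] (v : AbsoluteValue F ℝ) {d : ℕ} (x : Fin d → F) :
    ModelFlat (valueGroup v) d :=
  ModelFlat.mk fun i => ⟨Real.log (v (x i)), log_mem_valueGroup v (x i)⟩

end Flat

/-! ### Polytopes and flags -/

section Polytope

variable {F : Type*} [Field F] [LinearOrder F] {n : ℕ}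

/-- `P` is an integral polytope over the subfield `K`: the `F`-convex hull of finitely many
points with coordinates in `K`. -/
def IsIntegralPolytope (K : Subfield F) (P : Set (Fin n → F)) : Prop :=
  ∃ S : Set (Fin n → F), S.Finite ∧ (∀ s ∈ S, ∀ i, s i ∈ K) ∧ P = convexHull F S

/-- `σ` is a (closed, nonempty) face of `P`: either `P` itself or the nonempty intersection of
`P` with an affine hyperplane that has `P` on one side. -/
def IsFace (P σ : Set (Fin n → F)) : Prop :=
  σ.Nonempty ∧ (σ = P ∨ ∃ (l : (Fin n → F) →ₗ[F] F) (c : F), l ≠ 0 ∧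
    (∀ y ∈ P, l y ≤ c) ∧ σ = {x ∈ P | l x = c})

/-- The dimension of (the affine, or equivalently projective, span of) `σ`. -/
def faceDim (σ : Set (Fin n → F)) : ℕ :=
  Module.finrank F (vectorSpan F σ)

/-- The vertices, that is the zero-dimensional faces, of `P`. -/
def vertices (P : Set (Fin n → F)) : Set (Fin n → F) :=
  {x | IsFace P {x}}

/-- The barycenter of a polytope: the mean of its vertices. -/
def barycenter (P : Set (Fin n → F)) : Fin n → F :=
  ((vertices P).ncard : F)⁻¹ • ∑ᶠ x ∈ vertices P, x

/-- The flags of `P`: nonempty finite chains of faces, ordered by inclusion. -/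
def flags (P : Set (Fin n → F)) : Set (Set (Set (Fin n → F))) :=
  {f | f.Nonempty ∧ f.Finite ∧ (∀ σ ∈ f, IsFace P σ) ∧ IsChain (· ⊆ ·) f}

/-- The flags of `P` that contain the face `P`. -/
def starFlags (P : Set (Fin n → F)) : Set (Set (Set (Fin n → F))) :=
  {f ∈ flags P | P ∈ f}

/-- The type `D(f) = {dim σ + 1 : σ ∈ f, σ ≠ P}` of a flag `f`. -/
def flagType (P : Set (Fin n → F)) (f : Set (Set (Fin n → F))) : Set ℕ :=
  {k | ∃ σ ∈ f, σ ≠ P ∧ k = faceDim σ + 1}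

/-- The simplex of the barycentric subdivision that belongs to a flag: the convex hull of the
barycenters of the faces in the flag. -/
def barycentricSimplex (f : Set (Set (Fin n → F))) : Set (Fin n → F) :=
  convexHull F (barycenter '' f)

theorem singleton_mem_starFlags {P : Set (Fin n → F)} (hP : P.Nonempty) :
    ({P} : Set (Set (Fin n → F))) ∈ starFlags P := by
  refine ⟨⟨Set.singleton_nonempty P, Set.finite_singleton P, ?_, Set.subsingleton_singleton.isChain⟩,
    rfl⟩
  rintro σ rfl
  exact ⟨hP, Or.inl rfl⟩

end Polytope

/-! ### The affine chart -/

section Chart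

variable {F : Type*} [Field F] {n : ℕ}

/-- The standard affine chart `F^n → ℙ(F^{n+1})`, `x ↦ [x₁ : … : x_n : 1]`. -/
def affineChart (x : Fin n → F) : ℙ F (Fin (n + 1) → F) :=
  Projectivization.mk F (Fin.snoc (α := fun _ => F) x 1) fun h => by
    have h1 := congrFun h (Fin.last n)
    simp at h1

/-- The interior of `P ⊆ F^n`, as a subset of `ℙ(F^{n+1})`. -/
def openPart [TopologicalSpace F] (P : Set (Fin n → F)) : Set (ℙ F (Fin (n + 1) → F)) :=
  affineChart '' interior P

theorem dualSet_openPart_nonempty [TopologicalSpace F] (P : Set (Fin n → F)) :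
    (dualSet (openPart P)).Nonempty := by
  have hl : (LinearMap.proj (Fin.last n) : Module.Dual F (Fin (n + 1) → F)) ≠ 0 := fun h => by
    have h1 := LinearMap.congr_fun h (fun _ => 1)
    simp at h1
  refine ⟨Projectivization.mk F _ hl, ?_⟩
  rintro _ ⟨x, -, rfl⟩
  obtain ⟨a, ha⟩ := Projectivization.exists_smul_eq_mk_rep F _ hl
  have hx : (Fin.snoc (α := fun _ => F) x 1 : Fin (n + 1) → F) ≠ 0 := fun h => by
    have h1 := congrFun h (Fin.last n)
    simp at h1
  obtain ⟨b, hb⟩ := Projectivization.exists_smul_eq_mk_rep F _ hx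
  rw [affineChart, ← ha, ← hb]
  simp [Units.smul_def]

end Chart

/-! ### The geometric realization of the flag complex over the Weyl chamber -/

section Realization

variable {F : Type*} [Field F] [LinearOrder F] {n : ℕ}

/-- The disjoint union of the cells `𝔸⁺_{D(f),Λ} × {f}` over the flags `f` containing `P`. -/
def PreRealization (P : Set (Fin n → F)) (Λ : AddSubgroup ℝ) : Type _ :=
  Σ f : starFlags P, weylFace Λ (n + 1) (flagType P f.1)

/-- The generating relation: `(x, f) ∼ (x, f')` if `f` is a subflag of `f'`. -/
def GlueRel (P : Set (Fin n → F)) (Λ : AddSubgroup ℝ) (p q : PreRealization P Λ) : Prop :=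
  p.1.1 ⊆ q.1.1 ∧ p.2.1 = q.2.1

/-- The geometric realization `K(P, Λ)`: the quotient of the disjoint union of the cells by the
equivalence relation generated by `GlueRel`. -/
def Realization (P : Set (Fin n → F)) (Λ : AddSubgroup ℝ) : Type _ :=
  Quot (GlueRel P Λ)

/-- The projection from the disjoint union of the cells to `K(P, Λ)`. -/
def Realization.mk {P : Set (Fin n → F)} {Λ : AddSubgroup ℝ} (p : PreRealization P Λ) :
    Realization P Λ :=
  Quot.mk _ p

/-- The chart `α_f : 𝔸⁺_{D(f),Λ} → K(P, Λ)`. -/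
def cellMap {P : Set (Fin n → F)} {Λ : AddSubgroup ℝ} (f : starFlags P)
    (a : weylFace Λ (n + 1) (flagType P f.1)) : Realization P Λ :=
  Realization.mk ⟨f, a⟩

/-- The cone point `o` of `K(P, Λ)`. -/
def conePoint {P : Set (Fin n → F)} (hP : P.Nonempty) (Λ : AddSubgroup ℝ) : Realization P Λ :=
  cellMap ⟨{P}, singleton_mem_starFlags hP⟩ ⟨0, zero_mem_weylFace _ _ _⟩

/-- The cone point is the class of `(0, f)` for every flag `f`. -/
theorem conePoint_eq {P : Set (Fin n → F)} (hP : P.Nonempty) (Λ : AddSubgroup ℝ)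
    (f : starFlags P) : conePoint hP Λ = cellMap f ⟨0, zero_mem_weylFace _ _ _⟩ :=
  Quot.sound ⟨Set.singleton_subset_iff.2 f.2.2, rfl⟩

open Classical in
/-- The distance on the disjoint union of the cells: `d_H` on each cell, and `∞` between
different cells. -/
def preDist {P : Set (Fin n → F)} {Λ : AddSubgroup ℝ} (p q : PreRealization P Λ) : ENNReal :=
  if p.1 = q.1 then ENNReal.ofReal (hexDist p.2.1 q.2.1) else ⊤

/-- `(x₀, y₀, …, x_m, y_m)` is a chain from `a` to `b`. -/
def IsGlueChain {P : Set (Fin n → F)} {Λ : AddSubgroup ℝ} (a b : Realization P Λ) (m : ℕ)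
    (x y : ℕ → PreRealization P Λ) : Prop :=
  Realization.mk (x 0) = a ∧ Realization.mk (y m) = b ∧
    ∀ k < m, Realization.mk (y k) = Realization.mk (x (k + 1))

/-- The quotient pseudo-metric on `K(P, Λ)`: the infimum of the lengths `∑ d(x_k, y_k)` of the
chains from `a` to `b`. -/
def glueDist {P : Set (Fin n → F)} {Λ : AddSubgroup ℝ} (a b : Realization P Λ) : ENNReal :=
  ⨅ (m : ℕ) (x : ℕ → PreRealization P Λ) (y : ℕ → PreRealization P Λ)
    (_ : IsGlueChain a b m x y), ∑ k ∈ Finset.range (m + 1), preDist (x k) (y k)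

theorem hexDist_self {Λ : AddSubgroup ℝ} {d : ℕ} (a : ModelFlat Λ d) : hexDist a a = 0 := by
  rw [hexDist, sub_self]
  change (⨆ p : Fin d × Fin d, |((0 : Fin d → Λ) p.1 : ℝ) - ((0 : Fin d → Λ) p.2 : ℝ)|) = 0
  simp

theorem hexNorm_neg {Λ : AddSubgroup ℝ} {d : ℕ} (a : ModelFlat Λ d) :
    hexNorm (-a) = hexNorm a := by
  obtain ⟨α, rfl⟩ := QuotientAddGroup.mk_surjective a
  change (⨆ p : Fin d × Fin d, |((-α) p.1 : ℝ) - ((-α) p.2 : ℝ)|) =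
    ⨆ p : Fin d × Fin d, |(α p.1 : ℝ) - (α p.2 : ℝ)|
  refine iSup_congr fun p => ?_
  rw [← abs_neg]
  simp only [Pi.neg_apply, AddSubgroup.coe_neg]
  congr 1
  ring

theorem preDist_comm {P : Set (Fin n → F)} {Λ : AddSubgroup ℝ} (p q : PreRealization P Λ) :
    preDist p q = preDist q p := by
  unfold preDist
  by_cases h : p.1 = q.1
  · rw [if_pos h, if_pos h.symm, hexDist, hexDist, ← hexNorm_neg, neg_sub]
  · rw [if_neg h, if_neg (Ne.symm h)]

theorem glueDist_le {P : Set (Fin n → F)} {Λ : AddSubgroup ℝ} {a b : Realization P Λ} {m : ℕ}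
    {x y : ℕ → PreRealization P Λ} (h : IsGlueChain a b m x y) :
    glueDist a b ≤ ∑ k ∈ Finset.range (m + 1), preDist (x k) (y k) :=
  iInf_le_of_le m (iInf_le_of_le x (iInf_le_of_le y (iInf_le_of_le h le_rfl)))

theorem glueDist_comm_le {P : Set (Fin n → F)} {Λ : AddSubgroup ℝ} (a b : Realization P Λ) :
    glueDist b a ≤ glueDist a b := by
  refine le_iInf fun m => le_iInf fun x => le_iInf fun y => le_iInf fun h => ?_
  have hc : IsGlueChain b a m (fun k => y (m - k)) (fun k => x (m - k)) := by
    refine ⟨by simpa using h.2.1, by simpa using h.1, fun k hk => ?_⟩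
    have h1 := h.2.2 (m - (k + 1)) (by omega)
    rw [show m - (k + 1) + 1 = m - k by omega] at h1
    exact h1.symm
  refine (glueDist_le hc).trans (le_of_eq ?_)
  rw [← Finset.sum_range_reflect (fun k => preDist (x k) (y k))]
  refine Finset.sum_congr rfl fun k _ => ?_
  rw [preDist_comm]
  simp

theorem glueDist_triangle {P : Set (Fin n → F)} {Λ : AddSubgroup ℝ} (a b c : Realization P Λ) :
    glueDist a c ≤ glueDist a b + glueDist b c := by
  have key : ∀ (m : ℕ) (x y : ℕ → PreRealization P Λ), IsGlueChain a b m x y →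
      ∀ (m' : ℕ) (x' y' : ℕ → PreRealization P Λ), IsGlueChain b c m' x' y' →
      glueDist a c ≤ ∑ k ∈ Finset.range (m + 1), preDist (x k) (y k) +
        ∑ k ∈ Finset.range (m' + 1), preDist (x' k) (y' k) := by
    intro m x y h m' x' y' h'
    have hc : IsGlueChain a c (m + 1 + m')
        (fun k => if k < m + 1 then x k else x' (k - (m + 1)))
        (fun k => if k < m + 1 then y k else y' (k - (m + 1))) := by
      refine ⟨by simpa using h.1, ?_, fun k hk => ?_⟩
      · simpa only [if_neg (show ¬ m + 1 + m' < m + 1 by omega), Nat.add_sub_cancel_left]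
          using h'.2.1
      rcases lt_trichotomy k m with hk' | rfl | hk'
      · simpa [show k < m + 1 by omega, show k + 1 < m + 1 by omega] using h.2.2 k hk'
      · simpa using h.2.1.trans h'.1.symm
      · have h1 := h'.2.2 (k - (m + 1)) (by omega)
        rw [show k - (m + 1) + 1 = k + 1 - (m + 1) by omega] at h1
        simpa [show ¬ k < m + 1 by omega, show ¬ k + 1 < m + 1 by omega] using h1
    refine (glueDist_le hc).trans (le_of_eq ?_)
    rw [show m + 1 + m' + 1 = (m + 1) + (m' + 1) by omega, Finset.sum_range_add]
    congr 1
    · refine Finset.sum_congr rfl fun k hk => ?_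
      simp only [if_pos (Finset.mem_range.1 hk)]
    · refine Finset.sum_congr rfl fun k _ => ?_
      simp only [if_neg (show ¬ m + 1 + k < m + 1 by omega), Nat.add_sub_cancel_left]
  have step : ∀ (m : ℕ) (x y : ℕ → PreRealization P Λ), IsGlueChain a b m x y →
      glueDist a c ≤ ∑ k ∈ Finset.range (m + 1), preDist (x k) (y k) + glueDist b c := by
    intro m x y h
    rw [glueDist.eq_def b c]
    simp only [ENNReal.add_iInf]
    exact le_iInf fun m' => le_iInf fun x' => le_iInf fun y' => le_iInf fun h' =>
      key m x y h m' x' y' h'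
  rw [glueDist.eq_def a b]
  simp only [ENNReal.iInf_add]
  exact le_iInf fun m => le_iInf fun x => le_iInf fun y => le_iInf fun h => step m x y h

/-- `K(P, Λ)` with the quotient pseudo-metric. -/
instance (P : Set (Fin n → F)) (Λ : AddSubgroup ℝ) : PseudoEMetricSpace (Realization P Λ) where
  edist := glueDist
  edist_self a := by
    obtain ⟨p, rfl⟩ := Quot.exists_rep a
    have hc : IsGlueChain (Quot.mk _ p) (Quot.mk _ p) 0 (fun _ => p) (fun _ => p) :=
      ⟨rfl, rfl, fun k hk => absurd hk (Nat.not_lt_zero k)⟩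
    refine le_antisymm ((glueDist_le hc).trans ?_) bot_le
    simp [preDist, hexDist_self]
  edist_comm a b := le_antisymm (glueDist_comm_le b a) (glueDist_comm_le a b)
  edist_triangle := glueDist_triangle

end Realization

end NAHilbert

end

open NAHilbert

/-! The polytope `P` is cut out by finitely many linear forms `L` on `F^(n+1)`, which can be taken
with coefficients in `K` by Fourier–Motzkin elimination (`exists_forms_of_cone`). The vertices of
`P` and the barycenters `b_σ` of its faces have coordinates in `K` as well, so that every `l ∈ L`
is either zero or of absolute value one at `b_σ`. These properties are collected in
`IsFacetSystem`, and the rest of the argument uses nothing else about `P`.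

*Barycentric subdivision.* Every vector of the cone over `P` is a unique combination `∑ t_σ b_σ`
with nonnegative coefficients whose support is a chain of faces
(`IsFacetSystem.exists_barycentric`, `IsFacetSystem.baryVec_inj`). A maximal flag has one face in
each dimension `0, …, n` (`IsFacetSystem.exists_faceDim_eq`). In the basis of the differences
`b_i - b_{i-1}` of its barycenters, the vector `∑ t_σ b_σ` has the coordinates
`x_k = ∑_{dim σ ≥ k} t_σ`, which are decreasing and positive exactly for the points of `Ω` in the
simplex of the flag.

*Distances in one simplex.* The supremum that defines `d_Ω` is attained at forms of `L`, the ones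
that maximize the quotients `l(x) / l(y)` and `l(y) / l(x)` (`IsFacetSystem.edist_eq_of_max`).
On the simplex of a maximal flag, `|l(∑ t_σ b_σ)|` is the absolute value of the sum of the `t_σ`
with `l(b_σ) ≠ 0`, that is, `|x_k|` for some `k`, and every `k` occurs for some `l`. Hence `d_Ω` is
the distance `d_H` of the logarithms of the coordinates (`IsFacetSystem.edist_eq_hexDist`).

*Gluing.* By uniqueness of barycentric coordinates, the logarithms of the coordinates define a map
`Ψ` on all of `Ω` (`IsFacetSystem.exists_logMap`). The cells map back to `X_Ω`, isometrically on
each cell, so the quotient pseudo-metric dominates `d_Ω` (`IsFacetSystem.exists_inverse`).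
Conversely, the same two forms are extremal for all pairs of points on a segment, so `d_Ω` is
additive along segments (`IsFacetSystem.exists_edist_segment_eq`). A segment is cut by the
simplices into finitely many pieces, so a chain in `K(P, Λ)` of length `d_Ω(x, y)` joins `Ψ x` to
`Ψ y` (`IsFacetSystem.edist_logMap_le`). -/

namespace NAHilbert

/-! ### Cones over finite sets and their facets -/

section Cone

variable {F : Type*} [Field F]

/-- A linear form is rational over `K` if it takes values in `K` on vectors with coordinates
in `K`. -/
def IsRationalForm {n : ℕ} (K : Subfield F) (l : Module.Dual F (Fin n → F)) : Prop :=
  ∀ x : Fin n → F, (∀ i, x i ∈ K) → l x ∈ K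

variable [LinearOrder F] [IsStrictOrderedRing F] {n : ℕ}

/-- Elimination of the parameter of a ray: if `T` cuts out the cone `C`, these forms cut out
`C + F_{≥0} s`. -/
theorem exists_sub_smul_nonneg_iff (T : Finset (Module.Dual F (Fin n → F))) (s w : Fin n → F) :
    (∃ t : F, 0 ≤ t ∧ ∀ l ∈ T, 0 ≤ l (w - t • s)) ↔
      (∀ l ∈ T, 0 ≤ l s → 0 ≤ l w) ∧
        ∀ l ∈ T, ∀ m ∈ T, 0 < l s → m s < 0 → 0 ≤ l s * m w - m s * l w := by
  classical
  constructor
  · rintro ⟨t, ht, h⟩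
    simp only [map_sub, map_smul, smul_eq_mul, sub_nonneg] at h
    refine ⟨fun l hl hs => (mul_nonneg ht hs).trans (h l hl), fun l hl m hm hls hms => ?_⟩
    nlinarith [mul_le_mul_of_nonneg_left (h m hm) hls.le,
      mul_le_mul_of_nonneg_left (h l hl) (neg_pos.2 hms).le]
  · rintro ⟨h1, h2⟩
    -- the smallest nonnegative `t` that satisfies the constraints bounding `t` from below
    let A : Finset F := insert 0 ((T.filter fun l => l s < 0).image fun l => l w / l s)
    have hA : A.Nonempty := ⟨0, Finset.mem_insert_self _ _⟩
    refine ⟨A.max' hA, A.le_max' _ (Finset.mem_insert_self _ _), fun l hl => ?_⟩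
    simp only [map_sub, map_smul, smul_eq_mul, sub_nonneg]
    rcases lt_or_ge (l s) 0 with hs | hs
    · have : l w / l s ≤ A.max' hA := A.le_max' _ (Finset.mem_insert_of_mem
        (Finset.mem_image_of_mem _ (Finset.mem_filter.2 ⟨hl, hs⟩)))
      rwa [div_le_iff_of_neg hs] at this
    · have hmax := A.max'_mem hA
      rcases Finset.mem_insert.1 hmax with h0 | hm
      · rw [h0, zero_mul]
        exact h1 l hl hs
      · obtain ⟨m, hm, hmt⟩ := Finset.mem_image.1 hm
        obtain ⟨hmT, hms⟩ := Finset.mem_filter.1 hm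
        rw [← hmt]
        rcases hs.eq_or_lt with h0 | hs
        · rw [← h0, mul_zero]
          exact h1 l hl h0.le
        · have := h2 l hl m hmT hs hms
          rw [div_mul_eq_mul_div, div_le_iff_of_neg hms]
          linarith [mul_comm (l s) (m w), mul_comm (m s) (l w)]

/-- A finitely generated cone is cut out by finitely many linear forms, which are rational over
`K` if the generators are (Fourier–Motzkin elimination). -/
theorem exists_forms_of_cone (K : Subfield F) (S : Finset (Fin n → F))
    (hS : ∀ s ∈ S, ∀ i, s i ∈ K) :
    ∃ T : Finset (Module.Dual F (Fin n → F)), (∀ l ∈ T, IsRationalForm K l) ∧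
      ∀ w, (∃ c : (Fin n → F) → F, (∀ s, 0 ≤ c s) ∧ ∑ s ∈ S, c s • s = w) ↔
        ∀ l ∈ T, 0 ≤ l w := by
  classical
  induction S using Finset.induction_on with
  | empty =>
    refine ⟨Finset.univ.image (fun i => LinearMap.proj i) ∪
      Finset.univ.image (fun i => -LinearMap.proj i), fun l hl x hx => ?_, fun w => ?_⟩
    · rcases Finset.mem_union.1 hl with h | h
      · obtain ⟨i, -, rfl⟩ := Finset.mem_image.1 h
        exact hx i
      · obtain ⟨i, -, rfl⟩ := Finset.mem_image.1 h
        exact K.neg_mem (hx i)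
    · constructor
      · rintro ⟨c, -, rfl⟩
        simp
      · intro h
        refine ⟨0, fun s => le_rfl, ?_⟩
        rw [Finset.sum_empty]
        funext i
        refine le_antisymm ?_ ?_
        · exact h (LinearMap.proj i) (Finset.mem_union_left _
            (Finset.mem_image_of_mem _ (Finset.mem_univ i)))
        · have := h (-LinearMap.proj i) (Finset.mem_union_right _
            (Finset.mem_image_of_mem _ (Finset.mem_univ i)))
          simpa using this
  | insert s S hs ih =>
    obtain ⟨T, hTK, hT⟩ := ih fun x hx => hS x (Finset.mem_insert_of_mem hx)
    refine ⟨(T.filter fun l => 0 ≤ l s) ∪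
      ((T ×ˢ T).filter fun q => 0 < q.1 s ∧ q.2 s < 0).image
        fun q => q.1 s • q.2 - q.2 s • q.1, fun l hl x hx => ?_, fun w => ?_⟩
    · have hsK := hS s (Finset.mem_insert_self _ _)
      rcases Finset.mem_union.1 hl with h | h
      · exact hTK l (Finset.mem_filter.1 h).1 x hx
      · obtain ⟨q, hq, rfl⟩ := Finset.mem_image.1 h
        obtain ⟨hq, -⟩ := Finset.mem_filter.1 hq
        obtain ⟨h1, h2⟩ := Finset.mem_product.1 hq
        exact K.sub_mem (K.mul_mem (hTK _ h1 s hsK) (hTK _ h2 x hx))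
          (K.mul_mem (hTK _ h2 s hsK) (hTK _ h1 x hx))
    · have key : (∃ c : (Fin n → F) → F, (∀ s, 0 ≤ c s) ∧ ∑ x ∈ insert s S, c x • x = w) ↔
          ∃ t : F, 0 ≤ t ∧ ∀ l ∈ T, 0 ≤ l (w - t • s) := by
        constructor
        · rintro ⟨c, hc, rfl⟩
          refine ⟨c s, hc s, (hT _).1 ⟨c, hc, ?_⟩⟩
          rw [Finset.sum_insert hs, add_sub_cancel_left]
        · rintro ⟨t, ht, h⟩
          obtain ⟨c, hc, hw⟩ := (hT _).2 h
          refine ⟨Function.update c s t, fun x => ?_, ?_⟩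
          · by_cases hx : x = s
            · subst hx
              simpa using ht
            · simpa [hx] using hc x
          · rw [Finset.sum_insert hs, Function.update_self,
              Finset.sum_congr rfl fun x hx => by
                rw [Function.update_of_ne (ne_of_mem_of_not_mem hx hs)], hw]
            abel
      rw [key, exists_sub_smul_nonneg_iff]
      constructor
      · rintro ⟨h1, h2⟩ l hl
        rcases Finset.mem_union.1 hl with h | h
        · obtain ⟨h, h'⟩ := Finset.mem_filter.1 h
          exact h1 l h h'
        · obtain ⟨q, hq, rfl⟩ := Finset.mem_image.1 h
          obtain ⟨hq, hq'⟩ := Finset.mem_filter.1 hq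
          obtain ⟨h3, h4⟩ := Finset.mem_product.1 hq
          exact h2 _ h3 _ h4 hq'.1 hq'.2
      · intro h
        refine ⟨fun l hl hs => h l (Finset.mem_union_left _ (Finset.mem_filter.2 ⟨hl, hs⟩)),
          fun l hl m hm h1 h2 => ?_⟩
        exact h (l s • m - m s • l) (Finset.mem_union_right _ (Finset.mem_image.2
          ⟨(l, m), Finset.mem_filter.2 ⟨Finset.mem_product.2 ⟨hl, hm⟩, h1, h2⟩, rfl⟩))

end Cone

/-! ### Polytopes and their vertices -/

section Polytope

variable {F : Type*} [Field F] {n : ℕ}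

/-- The lift `(x₁, …, x_n, 1)` of a point of the affine chart. -/
def homog (x : Fin n → F) : Fin (n + 1) → F :=
  Fin.snoc (α := fun _ => F) x 1

@[simp]
theorem homog_last (x : Fin n → F) : homog x (Fin.last n) = 1 := by
  simp [homog]

@[simp]
theorem homog_castSucc (x : Fin n → F) (i : Fin n) : homog x i.castSucc = x i := by
  simp [homog]

theorem homog_ne_zero (x : Fin n → F) : homog x ≠ 0 := fun h => by
  have := congrFun h (Fin.last n)
  simp at this

theorem homog_injective : Function.Injective (homog : (Fin n → F) → Fin (n + 1) → F) :=
  fun x y h => funext fun i => by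
    simpa using congrFun h i.castSucc

theorem affineChart_eq (x : Fin n → F) :
    affineChart x = Projectivization.mk F (homog x) (homog_ne_zero x) := rfl

theorem sum_smul_homog {ι : Type*} (s : Finset ι) (c : ι → F) (z : ι → Fin n → F)
    (hc : ∑ i ∈ s, c i = 1) : ∑ i ∈ s, c i • homog (z i) = homog (∑ i ∈ s, c i • z i) := by
  funext j
  refine Fin.lastCases ?_ (fun j => ?_) j
  · simp [Finset.sum_apply, hc]
  · simp [Finset.sum_apply]

theorem smul_homog_add (a b : F) (x y : Fin n → F) (h : a + b = 1) :
    a • homog x + b • homog y = homog (a • x + b • y) := by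
  funext j
  refine Fin.lastCases ?_ (fun j => ?_) j
  · simp [h]
  · simp

/-- Every vector of nonzero height is a multiple of the lift of a point. -/
theorem exists_eq_smul_homog {w : Fin (n + 1) → F} (hw : w (Fin.last n) ≠ 0) :
    ∃ x : Fin n → F, w = w (Fin.last n) • homog x := by
  refine ⟨fun i => w i.castSucc / w (Fin.last n), ?_⟩
  funext j
  refine Fin.lastCases ?_ (fun j => ?_) j
  · simp
  · simp [mul_div_cancel₀ _ hw]

/-- The affine function given by a linear form on the lifts has a linear part. -/
theorem exists_linear_part (l : Module.Dual F (Fin (n + 1) → F)) :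
    ∃ (m : (Fin n → F) →ₗ[F] F) (c : F), ∀ x, l (homog x) = m x + c := by
  refine ⟨∑ i : Fin n, l (fun j => if i.castSucc = j then 1 else 0) • LinearMap.proj i,
    l (fun j => if Fin.last n = j then 1 else 0), fun x => ?_⟩
  rw [LinearMap.pi_apply_eq_sum_univ l (homog x), Fin.sum_univ_castSucc]
  simp [LinearMap.sum_apply, mul_comm]

variable [LinearOrder F] [IsStrictOrderedRing F]

/-- The convex hull of a finite set of points, rational over `K`, is cut out by finitely many
forms that are rational over `K`; the cone that these forms define lies in the half-space of
positive height. -/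
theorem exists_forms_of_convexHull (K : Subfield F) (S : Finset (Fin n → F))
    (hS : ∀ s ∈ S, ∀ i, s i ∈ K) :
    ∃ T : Finset (Module.Dual F (Fin (n + 1) → F)),
      (∀ l ∈ T, l ≠ 0 ∧ IsRationalForm K l) ∧
      (∀ x, x ∈ convexHull F (S : Set (Fin n → F)) ↔ ∀ l ∈ T, 0 ≤ l (homog x)) ∧
      ∀ w : Fin (n + 1) → F, (∀ l ∈ T, 0 ≤ l w) → w ≠ 0 → 0 < w (Fin.last n) := by
  classical
  obtain ⟨T, hTK, hT⟩ := exists_forms_of_cone K (S.image homog) (by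
    intro s hs i
    obtain ⟨x, hx, rfl⟩ := Finset.mem_image.1 hs
    refine Fin.lastCases ?_ (fun j => ?_) i
    · simp
    · simpa using hS x hx j)
  have hT' : ∀ w, (∃ c : (Fin (n + 1) → F) → F, (∀ s, 0 ≤ c s) ∧
      ∑ s ∈ S, c (homog s) • homog s = w) ↔ ∀ l ∈ T, 0 ≤ l w := by
    intro w
    rw [← hT w]
    simp only [Finset.sum_image fun a _ b _ h => homog_injective h]
  have hz : ∀ w, (∀ l ∈ T.filter (· ≠ 0), 0 ≤ l w) ↔ ∀ l ∈ T, 0 ≤ l w := by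
    intro w
    refine ⟨fun h l hl => ?_, fun h l hl => h l (Finset.mem_filter.1 hl).1⟩
    by_cases h0 : l = 0
    · simp [h0]
    · exact h l (Finset.mem_filter.2 ⟨hl, h0⟩)
  refine ⟨T.filter (· ≠ 0), fun l hl => ⟨(Finset.mem_filter.1 hl).2,
    hTK l (Finset.mem_filter.1 hl).1⟩, fun x => ?_, fun w hw h0 => ?_⟩
  · rw [hz, ← hT', Finset.mem_convexHull']
    constructor
    · rintro ⟨c, hc, hc1, rfl⟩
      refine ⟨fun w => if h : ∃ s ∈ S, homog s = w then c h.choose else 0, fun w => ?_, ?_⟩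
      · dsimp only
        split_ifs with h
        · exact hc _ h.choose_spec.1
        · exact le_rfl
      · rw [← sum_smul_homog S c (fun s => s) hc1]
        refine Finset.sum_congr rfl fun s hs => ?_
        have h : ∃ s' ∈ S, homog s' = homog s := ⟨s, hs, rfl⟩
        dsimp only
        rw [dif_pos h, homog_injective h.choose_spec.2]
    · rintro ⟨c, hc, h⟩
      have h1 : ∑ s ∈ S, c (homog s) = 1 := by
        have := congrFun h (Fin.last n)
        simpa [Finset.sum_apply] using this
      refine ⟨fun s => c (homog s), fun s _ => hc _, h1, homog_injective ?_⟩
      rw [← h, sum_smul_homog S (fun s => c (homog s)) (fun s => s) h1]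
  · obtain ⟨c, hc, rfl⟩ := (hT' w).2 ((hz w).1 hw)
    have h1 : (∑ s ∈ S, c (homog s) • homog s) (Fin.last n) = ∑ s ∈ S, c (homog s) := by
      simp [Finset.sum_apply]
    rw [h1]
    refine lt_of_le_of_ne (Finset.sum_nonneg fun s _ => hc _) fun h => h0 ?_
    refine Finset.sum_eq_zero fun s hs => ?_
    rw [(Finset.sum_eq_zero_iff_of_nonneg fun s _ => hc _).1 h.symm s hs, zero_smul]

/-- A face of the convex hull of `S` is the convex hull of the points of `S` in it. -/
theorem face_convexHull_eq (S : Finset (Fin n → F)) {σ : Set (Fin n → F)}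
    (hσ : IsFace (convexHull F (S : Set (Fin n → F))) σ) :
    σ = convexHull F (σ ∩ S) := by
  classical
  rcases hσ.2 with h | ⟨l, c, -, hl, h⟩
  · rw [h]
    exact (convexHull_min (Set.inter_subset_left) (convex_convexHull F _)).antisymm'
      (convexHull_mono fun s hs => ⟨subset_convexHull F _ hs, hs⟩)
  · apply Set.Subset.antisymm
    · intro x hx
      rw [h] at hx
      obtain ⟨hx, hxc⟩ := hx
      obtain ⟨w, hw, hw1, rfl⟩ := Finset.mem_convexHull'.1 hx
      have hsum : ∑ s ∈ S, w s * (c - l s) = 0 := by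
        simp only [mul_sub, Finset.sum_sub_distrib, ← Finset.sum_mul, hw1, one_mul]
        rw [← hxc, map_sum]
        simp
      have hz : ∀ s ∈ S, w s * (c - l s) = 0 :=
        (Finset.sum_eq_zero_iff_of_nonneg fun s hs => mul_nonneg (hw s hs)
          (sub_nonneg.2 (hl s (subset_convexHull F _ hs)))).1 hsum
      have hS : ∀ s ∈ S, w s ≠ 0 → s ∈ σ ∩ S := fun s hs h0 => by
        refine ⟨?_, hs⟩
        rw [h]
        exact ⟨subset_convexHull F _ hs,
          (sub_eq_zero.1 ((mul_eq_zero.1 (hz s hs)).resolve_left h0)).symm⟩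
      rw [← Finset.sum_filter_ne_zero] at hw1
      rw [← Finset.sum_subset (Finset.filter_subset (fun s => w s ≠ 0) S)
        (fun s hs hs' => by
          have : w s = 0 := by
            by_contra h0
            exact hs' (Finset.mem_filter.2 ⟨hs, h0⟩)
          rw [this, zero_smul])]
      refine (convex_convexHull F _).sum_mem (fun s hs => hw s (Finset.mem_filter.1 hs).1) hw1
        fun s hs => subset_convexHull F _ ?_
      exact hS s (Finset.mem_filter.1 hs).1 (Finset.mem_filter.1 hs).2
    · refine convexHull_min Set.inter_subset_left ?_
      rw [h]
      exact (convex_convexHull F _).inter (convex_hyperplane l.isLinear c)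

/-- A polytope is the convex hull of its vertices, and these are among any generating points. -/
theorem exists_vertices (S : Set (Fin n → F)) (hS : S.Finite) :
    vertices (convexHull F S) ⊆ S ∧
      convexHull F (vertices (convexHull F S)) = convexHull F S := by
  classical
  obtain ⟨A, hA⟩ := (hS.finite_subsets.subset (fun B hB => hB.1 :
    {B : Set (Fin n → F) | B ⊆ S ∧ convexHull F B = convexHull F S} ⊆ {B | B ⊆ S})).exists_minimal
      ⟨S, subset_rfl, rfl⟩
  obtain ⟨⟨hAS, hconv⟩, hmin⟩ := hA
  have hAfin : A.Finite := hS.subset hAS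
  suffices h : vertices (convexHull F S) = A by
    rw [h]
    exact ⟨hAS, hconv⟩
  rw [← hconv]
  apply Set.Subset.antisymm
  · intro x hx
    have h1 := face_convexHull_eq hAfin.toFinset (σ := {x}) (by
      rw [Set.Finite.coe_toFinset]
      exact hx)
    by_contra h
    rw [Set.Finite.coe_toFinset, Set.singleton_inter_eq_empty.2 h, convexHull_empty] at h1
    exact Set.singleton_ne_empty x h1
  · intro s hs
    have hns : s ∉ convexHull F (A \ {s}) := by
      intro h
      have hsub : A ≤ A \ {s} := by
        refine hmin ⟨Set.sdiff_subset.trans hAS, ?_⟩ Set.sdiff_subset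
        rw [← hconv]
        refine (convexHull_mono Set.sdiff_subset).antisymm
          (convexHull_min (fun x hx => ?_) (convex_convexHull F _))
        by_cases hxs : x = s
        · rwa [hxs]
        · exact subset_convexHull F _ ⟨hx, hxs⟩
      exact (hsub hs).2 rfl
    obtain ⟨T, -, hT, -⟩ := exists_forms_of_convexHull ⊤ (hAfin.subset
      (Set.sdiff_subset (t := {s}))).toFinset fun _ _ _ => Subfield.mem_top _
    rw [Set.Finite.coe_toFinset] at hT
    have : ∃ l ∈ T, l (homog s) < 0 := by
      by_contra! h
      exact hns ((hT s).2 h)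
    obtain ⟨l, hl, hls⟩ := this
    obtain ⟨m, c, hm⟩ := exists_linear_part l
    have hA' : ∀ x ∈ A \ {s}, 0 ≤ l (homog x) := fun x hx =>
      (hT x).1 (subset_convexHull F _ hx) l hl
    refine ⟨Set.singleton_nonempty s, ?_⟩
    by_cases hm0 : m = 0
    · left
      have hAs : A = {s} := by
        refine Set.Subset.antisymm (fun x hx => ?_) (Set.singleton_subset_iff.2 hs)
        by_contra hxs
        have := hA' x ⟨hx, hxs⟩
        rw [hm, hm0, LinearMap.zero_apply] at this
        rw [hm, hm0, LinearMap.zero_apply] at hls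
        exact absurd this (not_le.2 hls)
      rw [hAs, convexHull_singleton]
    · right
      refine ⟨-m, -(m s), neg_ne_zero.2 hm0, ?_⟩
      have hlt : ∀ x ∈ A \ {s}, m s < m x := fun x hx => by
        have h1 := hA' x hx
        rw [hm] at h1 hls
        linarith
      have hle : ∀ x ∈ A, m s ≤ m x := fun x hx => by
        by_cases hxs : x = s
        · rw [hxs]
        · exact (hlt x ⟨hx, hxs⟩).le
      have hle' : ∀ x ∈ convexHull F A, m s ≤ m x := fun x hx =>
        convexHull_min (t := {x | m s ≤ m x}) hle (convex_halfSpace_ge m.isLinear (m s)) hx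
      refine ⟨fun x hx => by simpa using hle' x hx, ?_⟩
      refine Set.Subset.antisymm (Set.singleton_subset_iff.2
        ⟨subset_convexHull F _ hs, by simp⟩) fun x hx => ?_
      obtain ⟨hx, hxs⟩ := hx
      obtain ⟨w, hw, hw1, rfl⟩ := (Finset.mem_convexHull' (s := hAfin.toFinset)).1
        (by simpa using hx)
      have hsum : ∑ a ∈ hAfin.toFinset, w a * (m a - m s) = 0 := by
        simp only [mul_sub, Finset.sum_sub_distrib, ← Finset.sum_mul, hw1, one_mul]
        simp only [LinearMap.neg_apply, neg_inj] at hxs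
        rw [← hxs, map_sum]
        simp
      have hz := (Finset.sum_eq_zero_iff_of_nonneg fun a ha => mul_nonneg (hw a ha)
          (sub_nonneg.2 (hle a (hAfin.mem_toFinset.1 ha)))).1 hsum
      have hz' : ∀ a ∈ hAfin.toFinset, a ≠ s → w a = 0 := fun a ha has =>
        (mul_eq_zero.1 (hz a ha)).resolve_right
          (sub_ne_zero.2 (hlt a ⟨hAfin.mem_toFinset.1 ha, has⟩).ne')
      have hsA := hAfin.mem_toFinset.2 hs
      rw [Finset.sum_eq_single_of_mem s hsA hz'] at hw1
      rw [Finset.sum_eq_single_of_mem s hsA fun a ha has => by rw [hz' a ha has, zero_smul], hw1,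
        one_smul]
      rfl

end Polytope

/-! ### Facet systems -/

section FacetSystem

variable {F : Type*} [Field F]

theorem abv_eq_one_of_mem {v : AbsoluteValue F ℝ} {K : Subfield F} (hK : ∀ x ∈ K, v x ≤ 1)
    {x : F} (hx : x ∈ K) (h0 : x ≠ 0) : v x = 1 := by
  refine le_antisymm (hK x hx) ?_
  have h := hK x⁻¹ (K.inv_mem hx)
  rw [map_inv₀] at h
  exact (inv_le_one₀ (v.pos h0)).1 h

theorem exists_pos_forall_add_mul_pos [LinearOrder F] [IsStrictOrderedRing F] {ι : Type*}
    (A : Finset ι) (q p : ι → F)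
    (hp : ∀ a ∈ A, 0 < p a) : ∃ N : F, 0 < N ∧ ∀ a ∈ A, 0 < q a + N * p a := by
  have hnn : ∀ a ∈ A, 0 ≤ |q a| / p a := fun a ha => div_nonneg (abs_nonneg _) (hp a ha).le
  refine ⟨1 + ∑ a ∈ A, |q a| / p a, by linarith [Finset.sum_nonneg hnn], fun a ha => ?_⟩
  have h1 : |q a| / p a < 1 + ∑ a ∈ A, |q a| / p a := by
    linarith [Finset.single_le_sum hnn ha]
  have h2 := (div_lt_iff₀ (hp a ha)).1 h1
  linarith [neg_abs_le (q a)]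

variable [LinearOrder F] [TopologicalSpace F] {n : ℕ}

/-- A finite set `L` of linear forms that cuts out the full-dimensional polytope `P`, in the way
in which the facets of an integral polytope do: the values of the forms at the barycenters of
faces have absolute value `0` or `1`, and the barycenter of a face is in its relative interior
with respect to `L`. This is all that the argument uses about `P`. -/
structure IsFacetSystem (v : AbsoluteValue F ℝ) (P : Set (Fin n → F))
    (L : Finset (Module.Dual F (Fin (n + 1) → F))) : Prop where
  mem_iff : ∀ x, x ∈ P ↔ ∀ l ∈ L, 0 ≤ l (homog x)
  mem_interior_iff : ∀ x, x ∈ interior P ↔ ∀ l ∈ L, 0 < l (homog x)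
  interior_nonempty : (interior P).Nonempty
  height_pos : ∀ w : Fin (n + 1) → F, (∀ l ∈ L, 0 ≤ l w) → w ≠ 0 → 0 < w (Fin.last n)
  barycenter_mem : ∀ σ, IsFace P σ → barycenter σ ∈ σ
  eq_zero_of_barycenter : ∀ σ, IsFace P σ → ∀ l ∈ L, l (homog (barycenter σ)) = 0 →
    ∀ x ∈ σ, l (homog x) = 0
  abv_barycenter : ∀ σ, IsFace P σ → ∀ l ∈ L, l (homog (barycenter σ)) ≠ 0 →
    v (l (homog (barycenter σ))) = 1

variable [IsStrictOrderedRing F] [OrderTopology F]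

/-- A point at which a nonzero linear form vanishes is not in the interior of a set on which the
form is nonnegative. -/
theorem pos_of_mem_interior {P : Set (Fin n → F)} {l : Module.Dual F (Fin (n + 1) → F)}
    (hl : l ≠ 0) (hP : ∀ x ∈ P, 0 ≤ l (homog x)) {x : Fin n → F} (hx : x ∈ interior P) :
    0 < l (homog x) := by
  refine lt_of_le_of_ne (hP x (interior_subset hx)) fun h0 => hl ?_
  have key : ∀ u : Fin n → F, 0 ≤ l (homog (x + u) - homog x) := by
    intro u
    have hc : ContinuousAt (fun e : F => x + e • u) 0 := by fun_prop
    have hmem : ∀ᶠ e in nhdsWithin (0 : F) (Set.Ioi 0), x + e • u ∈ P := by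
      refine (hc.eventually ?_).filter_mono nhdsWithin_le_nhds
      simpa using mem_interior_iff_mem_nhds.1 hx
    obtain ⟨e, he, he0⟩ := (hmem.and self_mem_nhdsWithin).exists
    have h1 := hP _ he
    have h2 : homog (x + e • u) = homog x + e • (homog (x + u) - homog x) := by
      funext j
      refine Fin.lastCases ?_ (fun j => ?_) j <;> simp
    rw [h2, map_add, ← h0, zero_add, map_smul, smul_eq_mul] at h1
    exact nonneg_of_mul_nonneg_right h1 he0
  have key0 : ∀ u : Fin n → F, l (homog (x + u) - homog x) = 0 := by
    intro u
    refine le_antisymm ?_ (key u)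
    have h1 := key (-u)
    have h2 : homog (x + -u) - homog x = -(homog (x + u) - homog x) := by
      funext j
      refine Fin.lastCases ?_ (fun j => ?_) j <;> simp
    rw [h2, map_neg] at h1
    linarith
  have hz : ∀ y, l (homog y) = 0 := fun y => by
    have h1 := key0 (y - x)
    rwa [add_sub_cancel, map_sub, ← h0, sub_zero] at h1
  refine LinearMap.ext fun w => ?_
  obtain ⟨a, b, y, y', rfl⟩ : ∃ (a b : F) (y y' : Fin n → F), w = a • homog y + b • homog y' := by
    by_cases hw : w (Fin.last n) = 0
    · obtain ⟨y, hy⟩ := exists_eq_smul_homog (w := w + homog 0) (by simp [hw])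
      refine ⟨1, -1, y, 0, ?_⟩
      have : (w + homog 0 : Fin (n + 1) → F) (Fin.last n) = 1 := by simp [hw]
      rw [this] at hy
      rw [← hy]
      simp
    · obtain ⟨y, hy⟩ := exists_eq_smul_homog hw
      exact ⟨w (Fin.last n), 0, y, y, by simpa using hy⟩
  simp [hz]

theorem continuous_form_homog (l : Module.Dual F (Fin (n + 1) → F)) :
    Continuous fun x : Fin n → F => l (homog x) := by
  obtain ⟨m, c, h⟩ := exists_linear_part l
  simp only [h]
  exact (LinearMap.continuous_on_pi m).add continuous_const

/-- An integral polytope of nonempty interior has a facet system. -/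
theorem IsIntegralPolytope.exists_isFacetSystem (v : AbsoluteValue F ℝ) {K : Subfield F}
    (hK : ∀ x ∈ K, v x ≤ 1) {P : Set (Fin n → F)} (hP : IsIntegralPolytope K P)
    (hint : (interior P).Nonempty) : ∃ L, IsFacetSystem v P L := by
  classical
  obtain ⟨S, hSfin, hSK, rfl⟩ := hP
  lift S to Finset (Fin n → F) using hSfin
  obtain ⟨L, hL, hmem, hpos⟩ := exists_forms_of_convexHull K S hSK
  -- the barycenter of a face is the mean of a finite set of rational points
  have hface : ∀ σ, IsFace (convexHull F (S : Set (Fin n → F))) σ → ∃ A : Finset (Fin n → F),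
      A.Nonempty ∧ A ⊆ S ∧ convexHull F (A : Set (Fin n → F)) = σ ∧
      barycenter σ = ∑ x ∈ A, (A.card : F)⁻¹ • x := by
    intro σ hσ
    have h1 := face_convexHull_eq S hσ
    obtain ⟨h2, h3⟩ := exists_vertices (σ ∩ S) (S.finite_toSet.subset Set.inter_subset_right)
    rw [← h1] at h2 h3
    have hfin : (vertices σ).Finite := S.finite_toSet.subset (h2.trans Set.inter_subset_right)
    refine ⟨hfin.toFinset, ?_, ?_, ?_, ?_⟩
    · rw [Set.Finite.toFinset_nonempty, Set.nonempty_iff_ne_empty]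
      intro h
      rw [h, convexHull_empty] at h3
      exact hσ.1.ne_empty h3.symm
    · intro x hx
      exact (h2 (hfin.mem_toFinset.1 hx)).2
    · rw [hfin.coe_toFinset, h3]
    · rw [barycenter, Set.ncard_eq_toFinset_card _ hfin, finsum_mem_eq_finite_toFinset_sum _ hfin,
        Finset.smul_sum]
  have hform : ∀ σ, IsFace (convexHull F (S : Set (Fin n → F))) σ → ∃ A : Finset (Fin n → F),
      A.Nonempty ∧ A ⊆ S ∧ convexHull F (A : Set (Fin n → F)) = σ ∧
      homog (barycenter σ) = ∑ x ∈ A, (A.card : F)⁻¹ • homog x := by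
    intro σ hσ
    obtain ⟨A, hA, hAS, hAσ, hb⟩ := hface σ hσ
    refine ⟨A, hA, hAS, hAσ, ?_⟩
    rw [hb, sum_smul_homog A (fun _ => (A.card : F)⁻¹) (fun x => x)]
    rw [Finset.sum_const, nsmul_eq_mul, mul_inv_cancel₀ (Nat.cast_ne_zero.2 hA.card_pos.ne')]
  refine ⟨L, hmem, fun x => ⟨fun hx l hl => ?_, fun h => ?_⟩, hint, hpos, fun σ hσ => ?_,
    fun σ hσ l hl h0 => ?_, fun σ hσ l hl h0 => ?_⟩
  · exact pos_of_mem_interior (hL l hl).1 (fun y hy => (hmem y).1 hy l hl) hx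
  · have hopen : IsOpen (⋂ l ∈ L, {x : Fin n → F | 0 < l (homog x)}) :=
      isOpen_biInter_finset fun l _ => isOpen_lt continuous_const (continuous_form_homog l)
    refine interior_maximal (fun y hy => (hmem y).2 fun l hl => ?_) hopen (Set.mem_iInter₂.2 h)
    exact (Set.mem_iInter₂.1 hy l hl).le
  · obtain ⟨A, hA, hAS, hAσ, hb⟩ := hface σ hσ
    rw [hb, ← hAσ]
    refine (convex_convexHull F _).sum_mem (fun _ _ => by positivity) ?_
      fun x hx => subset_convexHull F _ hx
    rw [Finset.sum_const, nsmul_eq_mul, mul_inv_cancel₀ (Nat.cast_ne_zero.2 hA.card_pos.ne')]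
  · obtain ⟨A, hA, hAS, hAσ, hb⟩ := hform σ hσ
    have hc : (0 : F) < (A.card : F)⁻¹ := by
      have := hA.card_pos
      positivity
    rw [hb, map_sum] at h0
    simp only [map_smul, smul_eq_mul] at h0
    have hAP : ∀ x ∈ A, 0 ≤ l (homog x) := fun x hx =>
      (hmem x).1 (subset_convexHull F _ (hAS hx)) l hl
    have hA0 : ∀ x ∈ A, l (homog x) = 0 := fun x hx =>
      (mul_eq_zero.1 ((Finset.sum_eq_zero_iff_of_nonneg fun x hx =>
        mul_nonneg hc.le (hAP x hx)).1 h0 x hx)).resolve_left hc.ne'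
    intro x hx
    rw [← hAσ] at hx
    obtain ⟨w, -, hw1, rfl⟩ := Finset.mem_convexHull'.1 hx
    rw [← sum_smul_homog A w (fun x => x) hw1, map_sum]
    refine Finset.sum_eq_zero fun x hx => ?_
    rw [map_smul, hA0 x hx, smul_zero]
  · obtain ⟨A, hA, hAS, hAσ, hb⟩ := hform σ hσ
    refine abv_eq_one_of_mem hK ((hL l hl).2 _ fun i => ?_) h0
    rw [hb, Finset.sum_apply]
    refine K.sum_mem fun x hx => K.mul_mem (K.inv_mem (natCast_mem K _)) ?_
    refine Fin.lastCases ?_ (fun j => ?_) i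
    · simp
    · simpa using hSK x (hAS hx) j

end FacetSystem

/-! ### Faces in terms of a facet system -/

section Faces

variable {F : Type*} [Field F] {n : ℕ}

open Classical in
/-- The forms in `L` that vanish on the face `σ`. -/
noncomputable def zeroForms (L : Finset (Module.Dual F (Fin (n + 1) → F))) (σ : Set (Fin n → F)) :
    Finset (Module.Dual F (Fin (n + 1) → F)) :=
  L.filter fun l => ∀ x ∈ σ, l (homog x) = 0

theorem mem_zeroForms {L : Finset (Module.Dual F (Fin (n + 1) → F))} {σ : Set (Fin n → F)}
    {l : Module.Dual F (Fin (n + 1) → F)} :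
    l ∈ zeroForms L σ ↔ l ∈ L ∧ ∀ x ∈ σ, l (homog x) = 0 := by
  classical
  simp [zeroForms]

variable [LinearOrder F]

theorem IsFace.subset {P σ : Set (Fin n → F)} (h : IsFace P σ) : σ ⊆ P := by
  rcases h.2 with h | ⟨l, c, -, -, h⟩
  · exact h.subset
  · rw [h]
    exact Set.sep_subset _ _

variable [TopologicalSpace F] {v : AbsoluteValue F ℝ} {P : Set (Fin n → F)}
  {L : Finset (Module.Dual F (Fin (n + 1) → F))}

namespace IsFacetSystem

theorem isFace_self (h : IsFacetSystem v P L) : IsFace P P :=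
  ⟨h.interior_nonempty.mono interior_subset, Or.inl rfl⟩

theorem mem_zeroForms_iff (h : IsFacetSystem v P L) {σ : Set (Fin n → F)} (hσ : IsFace P σ)
    {l : Module.Dual F (Fin (n + 1) → F)} (hl : l ∈ L) :
    l ∈ zeroForms L σ ↔ l (homog (barycenter σ)) = 0 :=
  ⟨fun hz => (mem_zeroForms.1 hz).2 _ (h.barycenter_mem σ hσ),
    fun h0 => mem_zeroForms.2 ⟨hl, h.eq_zero_of_barycenter σ hσ l hl h0⟩⟩

theorem nonneg_barycenter (h : IsFacetSystem v P L) {σ : Set (Fin n → F)} (hσ : IsFace P σ)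
    {l : Module.Dual F (Fin (n + 1) → F)} (hl : l ∈ L) : 0 ≤ l (homog (barycenter σ)) :=
  (h.mem_iff _).1 (hσ.subset (h.barycenter_mem σ hσ)) l hl

theorem pos_barycenter (h : IsFacetSystem v P L) {σ : Set (Fin n → F)} (hσ : IsFace P σ)
    {l : Module.Dual F (Fin (n + 1) → F)} (hl : l ∈ L) (hz : l ∉ zeroForms L σ) :
    0 < l (homog (barycenter σ)) :=
  lt_of_le_of_ne (h.nonneg_barycenter hσ hl) fun h0 => hz ((h.mem_zeroForms_iff hσ hl).2 h0.symm)

theorem zeroForms_self (h : IsFacetSystem v P L) : zeroForms L P = ∅ := by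
  refine Finset.eq_empty_of_forall_notMem fun l hl => ?_
  obtain ⟨x, hx⟩ := h.interior_nonempty
  obtain ⟨hl, hz⟩ := mem_zeroForms.1 hl
  exact ((h.mem_interior_iff x).1 hx l hl).ne' (hz x (interior_subset hx))

theorem pos_barycenter_self (h : IsFacetSystem v P L)
    {l : Module.Dual F (Fin (n + 1) → F)} (hl : l ∈ L) : 0 < l (homog (barycenter P)) :=
  h.pos_barycenter h.isFace_self hl (by simp [h.zeroForms_self])

theorem self_mem_of_maximal (h : IsFacetSystem v P L) {f : Set (Set (Fin n → F))}
    (hf : Maximal (· ∈ flags P) f) : P ∈ f := by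
  have hins : insert P f ∈ flags P := by
    refine ⟨Set.insert_nonempty _ _, hf.1.2.1.insert P, ?_, ?_⟩
    · rintro σ (rfl | hσ)
      · exact h.isFace_self
      · exact hf.1.2.2.1 σ hσ
    · exact hf.1.2.2.2.insert fun σ hσ _ => Or.inr (hf.1.2.2.1 σ hσ).subset
  exact hf.2 hins (Set.subset_insert _ _) (Set.mem_insert _ _)

variable [IsStrictOrderedRing F]

/-- A face is cut out of `P` by the forms that vanish on it. -/
theorem mem_face_iff (h : IsFacetSystem v P L) {σ : Set (Fin n → F)} (hσ : IsFace P σ)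
    {x : Fin n → F} : x ∈ σ ↔ x ∈ P ∧ ∀ l ∈ zeroForms L σ, l (homog x) = 0 := by
  classical
  refine ⟨fun hx => ⟨hσ.subset hx, fun l hl => (mem_zeroForms.1 hl).2 x hx⟩, fun ⟨hx, hz⟩ => ?_⟩
  have hb := h.barycenter_mem σ hσ
  rcases hσ.2 with hP | ⟨m, c, -, hm, hmσ⟩
  · rwa [hP]
  set b := barycenter σ with hbdef
  -- a point beyond `b` on the ray from `x` still lies in `P`, so `m` is maximal at `x` as well
  obtain ⟨N, hN, hN'⟩ := exists_pos_forall_add_mul_pos (L \ zeroForms L σ)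
    (fun l => l (homog b) - l (homog x)) (fun l => l (homog b))
    fun l hl => h.pos_barycenter hσ (Finset.mem_sdiff.1 hl).1 (Finset.mem_sdiff.1 hl).2
  have hy : (1 + N⁻¹) • b + (-N⁻¹) • x ∈ P := by
    refine (h.mem_iff _).2 fun l hl => ?_
    rw [← smul_homog_add _ _ _ _ (by ring), map_add, map_smul, map_smul, smul_eq_mul, smul_eq_mul]
    by_cases hlz : l ∈ zeroForms L σ
    · rw [hz l hlz, (h.mem_zeroForms_iff hσ hl).1 hlz]
      simp
    · have h1 := hN' l (Finset.mem_sdiff.2 ⟨hl, hlz⟩)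
      have h2 : (1 + N⁻¹) * l (homog b) + -N⁻¹ * l (homog x) =
          N⁻¹ * (l (homog b) - l (homog x) + N * l (homog b)) := by
        field_simp
        ring
      rw [h2]
      positivity
  have h1 := hm _ hy
  have hbσ : m b = c := by
    rw [hmσ] at hb
    exact hb.2
  rw [hmσ]
  refine ⟨hx, le_antisymm (hm x hx) ?_⟩
  rw [map_add, map_smul, map_smul, hbσ, smul_eq_mul, smul_eq_mul] at h1
  have h2 : N⁻¹ * c ≤ N⁻¹ * m x := by linarith
  exact le_of_mul_le_mul_left h2 (inv_pos.2 hN)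

theorem subset_iff (h : IsFacetSystem v P L) {σ τ : Set (Fin n → F)} (hσ : IsFace P σ)
    (hτ : IsFace P τ) : τ ⊆ σ ↔ zeroForms L σ ⊆ zeroForms L τ := by
  refine ⟨fun hs l hl => ?_, fun hs x hx => ?_⟩
  · exact mem_zeroForms.2 ⟨(mem_zeroForms.1 hl).1, fun x hx => (mem_zeroForms.1 hl).2 x (hs hx)⟩
  · exact (h.mem_face_iff hσ).2 ⟨hτ.subset hx, fun l hl => (mem_zeroForms.1 (hs hl)).2 x hx⟩

theorem face_ext (h : IsFacetSystem v P L) {σ τ : Set (Fin n → F)} (hσ : IsFace P σ)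
    (hτ : IsFace P τ) (he : zeroForms L σ = zeroForms L τ) : σ = τ :=
  ((h.subset_iff hτ hσ).2 he.symm.subset).antisymm ((h.subset_iff hσ hτ).2 he.subset)

theorem finite_faces (h : IsFacetSystem v P L) : {σ | IsFace P σ}.Finite := by
  refine Set.Finite.of_injOn (f := zeroForms L) (t := (L.powerset : Set _)) ?_ ?_
    (Finset.finite_toSet _)
  · intro σ _
    rw [Finset.mem_coe, Finset.mem_powerset]
    exact fun l hl => (mem_zeroForms.1 hl).1
  · exact fun σ hσ τ hτ he => h.face_ext hσ hτ he

theorem exists_form_of_ssubset (h : IsFacetSystem v P L) {σ τ : Set (Fin n → F)}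
    (hσ : IsFace P σ) (hτ : IsFace P τ) (hs : τ ⊂ σ) :
    ∃ l ∈ L, l ∈ zeroForms L τ ∧ l ∉ zeroForms L σ := by
  have : ¬ zeroForms L τ ⊆ zeroForms L σ := fun hc => hs.2 ((h.subset_iff hτ hσ).2 hc)
  obtain ⟨l, hl, hl'⟩ := Finset.not_subset.1 this
  exact ⟨l, (mem_zeroForms.1 hl).1, hl, hl'⟩

/-- No face lies in all facets: the cone over `P` contains no line. -/
theorem exists_form_notMem (h : IsFacetSystem v P L) {σ : Set (Fin n → F)}
    (hσ : IsFace P σ) : ∃ l ∈ L, l ∉ zeroForms L σ := by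
  by_contra! hc
  have := h.height_pos (-homog (barycenter σ))
    (fun l hl => by rw [map_neg, (h.mem_zeroForms_iff hσ hl).1 (hc l hl), neg_zero])
    (neg_ne_zero.2 (homog_ne_zero _))
  simp only [Pi.neg_apply, homog_last] at this
  linarith

theorem isFace_of_forms (h : IsFacetSystem v P L)
    (J : Finset (Module.Dual F (Fin (n + 1) → F))) (hJ : J ⊆ L)
    (hne : {x ∈ P | ∀ l ∈ J, l (homog x) = 0}.Nonempty) :
    IsFace P {x ∈ P | ∀ l ∈ J, l (homog x) = 0} := by
  refine ⟨hne, ?_⟩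
  obtain ⟨m, c, hm⟩ := exists_linear_part (∑ l ∈ J, l)
  have hnn : ∀ x ∈ P, ∀ l ∈ J, 0 ≤ l (homog x) := fun x hx l hl => (h.mem_iff x).1 hx l (hJ hl)
  have hiff : ∀ x ∈ P, (∀ l ∈ J, l (homog x) = 0) ↔ m x + c = 0 := fun x hx => by
    rw [← hm, LinearMap.sum_apply, Finset.sum_eq_zero_iff_of_nonneg (hnn x hx)]
  by_cases hm0 : m = 0
  · left
    obtain ⟨y, hy, hy'⟩ := hne
    have hc := (hiff y hy).1 hy'
    refine Set.Subset.antisymm (Set.sep_subset _ _) fun x hx => ⟨hx, (hiff x hx).2 ?_⟩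
    simpa [hm0] using hc
  · right
    refine ⟨-m, c, neg_ne_zero.2 hm0, fun x hx => ?_, ?_⟩
    · have : 0 ≤ m x + c := by
        rw [← hm, LinearMap.sum_apply]
        exact Finset.sum_nonneg (hnn x hx)
      rw [LinearMap.neg_apply]
      linarith
    · ext x
      refine and_congr_right fun hx => ?_
      rw [hiff x hx, LinearMap.neg_apply]
      constructor <;> intro h <;> linarith

theorem isFace_inter (h : IsFacetSystem v P L) {σ : Set (Fin n → F)} (hσ : IsFace P σ)
    {l : Module.Dual F (Fin (n + 1) → F)} (hl : l ∈ L)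
    (hne : {x ∈ σ | l (homog x) = 0}.Nonempty) : IsFace P {x ∈ σ | l (homog x) = 0} := by
  classical
  have he : {x ∈ σ | l (homog x) = 0} =
      {x ∈ P | ∀ m ∈ insert l (zeroForms L σ), m (homog x) = 0} := by
    ext x
    simp only [Set.mem_ofPred_eq, h.mem_face_iff hσ, Finset.forall_mem_insert]
    tauto
  rw [he] at hne ⊢
  exact h.isFace_of_forms _ (Finset.insert_subset hl fun m hm => (mem_zeroForms.1 hm).1) hne

theorem exists_smul_homog_of_cone (h : IsFacetSystem v P L) {w : Fin (n + 1) → F}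
    (hw : ∀ l ∈ L, 0 ≤ l w) (h0 : w ≠ 0) : ∃ c : F, 0 < c ∧ ∃ x ∈ P, w = c • homog x := by
  have hc := h.height_pos w hw h0
  obtain ⟨x, hx⟩ := exists_eq_smul_homog hc.ne'
  refine ⟨_, hc, x, (h.mem_iff x).2 fun l hl => ?_, hx⟩
  have := hw l hl
  rw [hx, map_smul, smul_eq_mul] at this
  exact nonneg_of_mul_nonneg_right this hc

/-- The vector `w` of the cone over `σ` is pushed away from the barycenter of `σ` until it meets
a proper face. -/
theorem exists_sub_barycenter (h : IsFacetSystem v P L) {σ : Set (Fin n → F)} (hσ : IsFace P σ)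
    {w : Fin (n + 1) → F} (hw : ∀ l ∈ L, 0 ≤ l w) (hwσ : ∀ l ∈ zeroForms L σ, l w = 0) :
    ∃ (t : F) (y : Fin (n + 1) → F), 0 ≤ t ∧ w = t • homog (barycenter σ) + y ∧
      (∀ l ∈ L, 0 ≤ l y) ∧
      (y = 0 ∨ ∃ τ, IsFace P τ ∧ τ ⊂ σ ∧ ∀ l ∈ zeroForms L τ, l y = 0) := by
  classical
  have hpos : ∀ l ∈ L \ zeroForms L σ, 0 < l (homog (barycenter σ)) := fun l hl =>
    h.pos_barycenter hσ (Finset.mem_sdiff.1 hl).1 (Finset.mem_sdiff.1 hl).2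
  obtain ⟨l₀, hl₀, hmin⟩ := Finset.exists_min_image (L \ zeroForms L σ)
    (fun l => l w / l (homog (barycenter σ))) (by
      obtain ⟨l, hl, hl'⟩ := h.exists_form_notMem hσ
      exact ⟨l, Finset.mem_sdiff.2 ⟨hl, hl'⟩⟩)
  obtain ⟨hl₀L, hl₀σ⟩ := Finset.mem_sdiff.1 hl₀
  set t := l₀ w / l₀ (homog (barycenter σ)) with ht
  have hyl : ∀ l ∈ L, 0 ≤ l (w - t • homog (barycenter σ)) := fun l hl => by
    rw [map_sub, map_smul, smul_eq_mul, sub_nonneg]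
    by_cases hlσ : l ∈ zeroForms L σ
    · rw [hwσ l hlσ, (h.mem_zeroForms_iff hσ hl).1 hlσ, mul_zero]
    · have hl' := Finset.mem_sdiff.2 ⟨hl, hlσ⟩
      exact (le_div_iff₀ (hpos l hl')).1 (hmin l hl')
  refine ⟨t, w - t • homog (barycenter σ), div_nonneg (hw _ hl₀L) (hpos _ hl₀).le, by abel,
    hyl, or_iff_not_imp_left.2 fun hy0 => ?_⟩
  obtain ⟨c, hc, x, hx, hyx⟩ := h.exists_smul_homog_of_cone hyl hy0
  have hzero : ∀ l : Module.Dual F (Fin (n + 1) → F), l (w - t • homog (barycenter σ)) = 0 → l (homog x) = 0 := fun l hl => by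
    rw [hyx, map_smul, smul_eq_mul] at hl
    exact (mul_eq_zero.1 hl).resolve_left hc.ne'
  have hxσ : x ∈ σ := (h.mem_face_iff hσ).2 ⟨hx, fun l hl => hzero l (by
    rw [map_sub, map_smul, hwσ l hl, (h.mem_zeroForms_iff hσ (mem_zeroForms.1 hl).1).1 hl]
    simp)⟩
  have hx0 : l₀ (homog x) = 0 := hzero l₀ (by
    rw [map_sub, map_smul, smul_eq_mul, ht, div_mul_cancel₀ _ (hpos _ hl₀).ne', sub_self])
  refine ⟨_, h.isFace_inter hσ hl₀L ⟨x, hxσ, hx0⟩, ⟨Set.sep_subset _ _, fun hs => ?_⟩,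
    fun l hl => ?_⟩
  · exact (hpos _ hl₀).ne' (hs (h.barycenter_mem σ hσ)).2
  · rw [hyx, map_smul, (mem_zeroForms.1 hl).2 x ⟨hxσ, hx0⟩, smul_zero]

/-! ### Dimensions of faces and maximal flags -/

theorem faceDim_lt (h : IsFacetSystem v P L) {σ τ : Set (Fin n → F)} (hσ : IsFace P σ)
    (hτ : IsFace P τ) (hs : τ ⊂ σ) : faceDim τ < faceDim σ := by
  refine Submodule.finrank_lt_finrank_of_lt (lt_of_le_of_ne (vectorSpan_mono F hs.1) fun he => ?_)
  obtain ⟨l, hl, hlτ, hlσ⟩ := h.exists_form_of_ssubset hσ hτ hs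
  obtain ⟨m, c, hm⟩ := exists_linear_part l
  have h1 : vectorSpan F τ ≤ LinearMap.ker m := by
    rw [vectorSpan_def, Submodule.span_le]
    rintro _ ⟨x, hx, y, hy, rfl⟩
    have hx' := (mem_zeroForms.1 hlτ).2 x hx
    have hy' := (mem_zeroForms.1 hlτ).2 y hy
    rw [hm] at hx' hy'
    simp only [vsub_eq_sub, SetLike.mem_coe, LinearMap.mem_ker, map_sub]
    linear_combination hx' - hy'
  have h2 : barycenter σ - barycenter τ ∈ vectorSpan F σ :=
    vsub_mem_vectorSpan F (h.barycenter_mem σ hσ) (hs.1 (h.barycenter_mem τ hτ))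
  rw [← he] at h2
  have h3 := LinearMap.mem_ker.1 (h1 h2)
  have h4 := (mem_zeroForms.1 hlτ).2 _ (h.barycenter_mem τ hτ)
  refine hlσ ((h.mem_zeroForms_iff hσ hl).2 ?_)
  rw [hm] at h4 ⊢
  rw [map_sub] at h3
  linear_combination h3 + h4

theorem faceDim_le (h : IsFacetSystem v P L) {σ τ : Set (Fin n → F)} (hσ : IsFace P σ)
    (hτ : IsFace P τ) (hs : τ ⊆ σ) : faceDim τ ≤ faceDim σ := by
  rcases hs.eq_or_ssubset with rfl | hs
  · exact le_rfl
  · exact (h.faceDim_lt hσ hτ hs).le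

theorem faceDim_self (h : IsFacetSystem v P L) : faceDim P = n := by
  have : vectorSpan F P = ⊤ := by
    refine eq_top_iff.2 fun u _ => ?_
    have hb := h.barycenter_mem P h.isFace_self
    obtain ⟨N, hN, hN'⟩ := exists_pos_forall_add_mul_pos L
      (fun l => l (homog (barycenter P + u) - homog (barycenter P)))
      (fun l => l (homog (barycenter P))) fun l hl => h.pos_barycenter_self hl
    have hy : barycenter P + N⁻¹ • u ∈ P := by
      refine (h.mem_iff _).2 fun l hl => ?_
      have h1 : homog (barycenter P + N⁻¹ • u) = N⁻¹ •
          ((homog (barycenter P + u) - homog (barycenter P)) + N • homog (barycenter P)) := by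
        funext j
        refine Fin.lastCases ?_ (fun j => ?_) j
        · simp [hN.ne']
        · simp only [homog_castSucc, Pi.add_apply, Pi.smul_apply, smul_eq_mul, Pi.sub_apply]
          field_simp
          ring
      have h2 := hN' l hl
      rw [h1, map_smul, map_add, map_smul, smul_eq_mul, smul_eq_mul]
      positivity
    have h3 := vsub_mem_vectorSpan F hy hb
    rw [vsub_eq_sub, add_sub_cancel_left] at h3
    simpa [hN.ne'] using (vectorSpan F P).smul_mem N h3
  rw [faceDim, this, finrank_top, Module.finrank_fin_fun]

theorem faceDim_le_self (h : IsFacetSystem v P L) {σ : Set (Fin n → F)} (hσ : IsFace P σ) :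
    faceDim σ ≤ n :=
  (h.faceDim_le h.isFace_self hσ hσ.subset).trans h.faceDim_self.le

theorem faceDim_eq_zero (h : IsFacetSystem v P L) {σ : Set (Fin n → F)} (hσ : IsFace P σ)
    (hmin : ∀ τ, IsFace P τ → ¬ τ ⊂ σ) : faceDim σ = 0 := by
  have hs : σ ⊆ {barycenter σ} := by
    intro x hx
    obtain ⟨t, y, -, hty, -, hy⟩ := h.exists_sub_barycenter hσ (w := homog x)
      (fun l hl => (h.mem_iff x).1 (hσ.subset hx) l hl)
      (fun l hl => (mem_zeroForms.1 hl).2 x hx)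
    rcases hy with rfl | ⟨τ, hτ, hτσ, -⟩
    · have h1 := congrFun hty (Fin.last n)
      simp only [homog_last, add_zero, Pi.smul_apply, smul_eq_mul, mul_one] at h1
      rw [← h1, one_smul, add_zero] at hty
      exact homog_injective hty
    · exact absurd hτσ (hmin τ hτ)
  have h1 : vectorSpan F σ = ⊥ := le_bot_iff.1 ((vectorSpan_mono F hs).trans_eq
    (vectorSpan_singleton F _))
  rw [faceDim, h1, finrank_bot]

/-- Consecutive faces have consecutive dimensions. -/
theorem faceDim_le_succ (h : IsFacetSystem v P L) {σ τ : Set (Fin n → F)} (hσ : IsFace P σ)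
    (hτ : IsFace P τ) (hs : τ ⊂ σ) (hcov : ∀ ρ, IsFace P ρ → τ ⊆ ρ → ρ ⊂ σ → ρ = τ) :
    faceDim σ ≤ faceDim τ + 1 := by
  classical
  suffices hle : vectorSpan F σ ≤ vectorSpan F τ ⊔
      Submodule.span F {barycenter σ - barycenter τ} by
    have h1 := Submodule.finrank_mono hle
    have h2 := Submodule.finrank_add_le_finrank_add_finrank (vectorSpan F τ)
      (Submodule.span F {barycenter σ - barycenter τ})
    have h3 := finrank_span_le_card (R := F) {barycenter σ - barycenter τ}
    rw [Set.toFinset_singleton, Finset.card_singleton] at h3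
    unfold faceDim
    omega
  have hbσ := h.barycenter_mem σ hσ
  have hbτ := h.barycenter_mem τ hτ
  rw [vectorSpan_eq_span_vsub_set_right F (hs.1 hbτ), Submodule.span_le]
  rintro _ ⟨x, hx, rfl⟩
  -- the vector `x - t b_σ + N b_τ` (of lifts) lies over a proper face of `σ` that contains `τ`
  have hpos : ∀ l ∈ zeroForms L τ \ zeroForms L σ, 0 < l (homog (barycenter σ)) := fun l hl =>
    h.pos_barycenter hσ (mem_zeroForms.1 (Finset.mem_sdiff.1 hl).1).1 (Finset.mem_sdiff.1 hl).2
  obtain ⟨l₀, hl₀, hmin⟩ := Finset.exists_min_image (zeroForms L τ \ zeroForms L σ)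
    (fun l => l (homog x) / l (homog (barycenter σ))) (by
      obtain ⟨l, hl, hlτ, hlσ⟩ := h.exists_form_of_ssubset hσ hτ hs
      exact ⟨l, Finset.mem_sdiff.2 ⟨hlτ, hlσ⟩⟩)
  obtain ⟨hl₀τ, hl₀σ⟩ := Finset.mem_sdiff.1 hl₀
  have hl₀L := (mem_zeroForms.1 hl₀τ).1
  set t := l₀ (homog x) / l₀ (homog (barycenter σ)) with ht
  obtain ⟨N, hN, hN'⟩ := exists_pos_forall_add_mul_pos (L \ zeroForms L τ)
    (fun l => l (homog x - t • homog (barycenter σ))) (fun l => l (homog (barycenter τ)))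
    fun l hl => h.pos_barycenter hτ (Finset.mem_sdiff.1 hl).1 (Finset.mem_sdiff.1 hl).2
  set y := homog x - t • homog (barycenter σ) + N • homog (barycenter τ) with hy
  have hzσ : ∀ l ∈ zeroForms L σ, l y = 0 := fun l hl => by
    rw [hy, map_add, map_sub, map_smul, map_smul, (mem_zeroForms.1 hl).2 x hx,
      (mem_zeroForms.1 hl).2 _ hbσ, (mem_zeroForms.1 hl).2 _ (hs.1 hbτ)]
    simp
  have hyL : ∀ l ∈ L, 0 ≤ l y := fun l hl => by
    by_cases hlτ : l ∈ zeroForms L τ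
    · by_cases hlσ : l ∈ zeroForms L σ
      · exact (hzσ l hlσ).ge
      · have hl' := Finset.mem_sdiff.2 ⟨hlτ, hlσ⟩
        rw [hy, map_add, map_sub, map_smul, map_smul, (mem_zeroForms.1 hlτ).2 _ hbτ,
          smul_zero, add_zero, smul_eq_mul, sub_nonneg]
        exact (le_div_iff₀ (hpos l hl')).1 (hmin l hl')
    · have h1 := hN' l (Finset.mem_sdiff.2 ⟨hl, hlτ⟩)
      rw [hy, map_add, map_smul, smul_eq_mul]
      exact h1.le
  obtain ⟨z, hz, c, hyz⟩ : ∃ z ∈ τ, ∃ c : F, y = c • homog z := by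
    by_cases hy0 : y = 0
    · exact ⟨_, hbτ, 0, by rw [hy0, zero_smul]⟩
    · obtain ⟨c, hc, z, hz, hyz⟩ := h.exists_smul_homog_of_cone hyL hy0
      refine ⟨z, ?_, c, hyz⟩
      have hzero : ∀ l : Module.Dual F (Fin (n + 1) → F), l y = 0 → l (homog z) = 0 := fun l hl => by
        rw [hyz, map_smul, smul_eq_mul] at hl
        exact (mul_eq_zero.1 hl).resolve_left hc.ne'
      have hzσ' : z ∈ σ := (h.mem_face_iff hσ).2 ⟨hz, fun l hl => hzero l (hzσ l hl)⟩
      have hz0 : l₀ (homog z) = 0 := hzero l₀ (by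
        rw [hy, map_add, map_sub, map_smul, map_smul, (mem_zeroForms.1 hl₀τ).2 _ hbτ,
          smul_zero, add_zero, smul_eq_mul, ht, div_mul_cancel₀ _ (hpos _ hl₀).ne', sub_self])
      have hρ := hcov _ (h.isFace_inter hσ hl₀L ⟨z, hzσ', hz0⟩)
        (fun u hu => ⟨hs.1 hu, (mem_zeroForms.1 hl₀τ).2 u hu⟩)
        ⟨Set.sep_subset _ _, fun hc => (hpos _ hl₀).ne' (hc hbσ).2⟩
      rw [← hρ]
      exact ⟨hzσ', hz0⟩
  have he : homog x = t • homog (barycenter σ) - N • homog (barycenter τ) + c • homog z := by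
    rw [← hyz, hy]
    abel
  have h1 : 1 = t - N + c := by
    have := congrFun he (Fin.last n)
    simpa using this
  have h2 : x -ᵥ barycenter τ = c • (z - barycenter τ) + t • (barycenter σ - barycenter τ) := by
    funext i
    have := congrFun he i.castSucc
    simp only [homog_castSucc, Pi.add_apply, Pi.sub_apply, Pi.smul_apply, smul_eq_mul] at this
    simp only [vsub_eq_sub, Pi.sub_apply, Pi.add_apply, Pi.smul_apply, smul_eq_mul]
    linear_combination this - barycenter τ i * h1
  dsimp only
  rw [SetLike.mem_coe, h2]
  exact Submodule.add_mem_sup (Submodule.smul_mem _ _ (vsub_mem_vectorSpan F hz hbτ))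
    (Submodule.smul_mem _ _ (Submodule.mem_span_singleton_self _))

theorem faceDim_injOn (h : IsFacetSystem v P L) {f : Set (Set (Fin n → F))}
    (hf : f ∈ flags P) : Set.InjOn faceDim f := by
  intro σ hσ τ hτ he
  by_contra hne
  rcases hf.2.2.2 hσ hτ hne with hs | hs
  · exact (h.faceDim_lt (hf.2.2.1 τ hτ) (hf.2.2.1 σ hσ) (hs.ssubset_of_ne hne)).ne he
  · exact (h.faceDim_lt (hf.2.2.1 σ hσ) (hf.2.2.1 τ hτ) (hs.ssubset_of_ne (Ne.symm hne))).ne' he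

theorem subset_of_faceDim_le (h : IsFacetSystem v P L) {f : Set (Set (Fin n → F))}
    (hf : f ∈ flags P) {σ τ : Set (Fin n → F)} (hσ : σ ∈ f) (hτ : τ ∈ f)
    (hd : faceDim σ ≤ faceDim τ) : σ ⊆ τ := by
  by_cases hne : σ = τ
  · rw [hne]
  · rcases hf.2.2.2 hσ hτ hne with hs | hs
    · exact hs
    · exact absurd (h.faceDim_lt (hf.2.2.1 σ hσ) (hf.2.2.1 τ hτ)
        (hs.ssubset_of_ne (Ne.symm hne))) (not_lt.2 hd)

/-- A maximal flag contains a face of every dimension. -/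
theorem exists_faceDim_eq (h : IsFacetSystem v P L) {f : Set (Set (Fin n → F))}
    (hf : Maximal (· ∈ flags P) f) {k : ℕ} (hk : k ≤ n) : ∃ σ ∈ f, faceDim σ = k := by
  classical
  by_contra! hc
  obtain ⟨-, hfin, hface, hchain⟩ := hf.1
  have hins : ∀ ρ, IsFace P ρ → (∀ σ ∈ f, ρ ⊆ σ ∨ σ ⊆ ρ) → ρ ∈ f := fun ρ hρ hcomp => by
    have : insert ρ f ∈ flags P := by
      refine ⟨Set.insert_nonempty _ _, hfin.insert ρ, ?_, hchain.insert fun σ hσ _ => hcomp σ hσ⟩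
      rintro σ (rfl | hσ)
      · exact hρ
      · exact hface σ hσ
    exact hf.2 this (Set.subset_insert _ _) (Set.mem_insert _ _)
  have hP := h.self_mem_of_maximal hf
  -- the smallest element of the flag of dimension larger than `k`
  obtain ⟨σ, hσ, hσmin⟩ := Finset.exists_min_image (hfin.toFinset.filter fun σ => k < faceDim σ)
    faceDim ⟨P, by
      have := hc P hP
      rw [h.faceDim_self] at this
      simp only [Finset.mem_filter, Set.Finite.mem_toFinset, h.faceDim_self]
      exact ⟨hP, by omega⟩⟩
  simp only [Finset.mem_filter, Set.Finite.mem_toFinset] at hσ hσmin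
  obtain ⟨hσf, hkσ⟩ := hσ
  have hup : ∀ ρ ∈ f, k < faceDim ρ → σ ⊆ ρ := fun ρ hρ hk =>
    h.subset_of_faceDim_le hf.1 hσf hρ (hσmin ρ ⟨hρ, hk⟩)
  by_cases hlow : ∃ τ ∈ f, faceDim τ < k
  · obtain ⟨τ, hτ, hτmax⟩ := Finset.exists_max_image
      (hfin.toFinset.filter fun σ => faceDim σ < k) faceDim (by
        obtain ⟨τ, hτ, hk⟩ := hlow
        exact ⟨τ, by simp [hτ, hk]⟩)
    simp only [Finset.mem_filter, Set.Finite.mem_toFinset] at hτ hτmax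
    obtain ⟨hτf, hτk⟩ := hτ
    have hs : τ ⊂ σ := (h.subset_of_faceDim_le hf.1 hτf hσf (by omega)).ssubset_of_ne (by
      rintro rfl
      omega)
    have := h.faceDim_le_succ (hface σ hσf) (hface τ hτf) hs fun ρ hρ h1 h2 => by
      have hρf : ρ ∈ f := hins ρ hρ fun π hπ => by
        rcases lt_or_gt_of_ne (hc π hπ) with hlt | hgt
        · exact Or.inr ((h.subset_of_faceDim_le hf.1 hπ hτf (hτmax π ⟨hπ, hlt⟩)).trans h1)
        · exact Or.inl (h2.1.trans (hup π hπ hgt))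
      rcases lt_or_gt_of_ne (hc ρ hρf) with hlt | hgt
      · exact (h.subset_of_faceDim_le hf.1 hρf hτf (hτmax ρ ⟨hρf, hlt⟩)).antisymm h1
      · exact absurd (hup ρ hρf hgt) h2.2
    have := hσmin σ ⟨hσf, hkσ⟩
    omega
  · push Not at hlow
    have hall : ∀ ρ ∈ f, k < faceDim ρ := fun ρ hρ => lt_of_le_of_ne (hlow ρ hρ) (hc ρ hρ).symm
    have := h.faceDim_eq_zero (hface σ hσf) fun τ hτ hs => by
      have hτf : τ ∈ f := hins τ hτ fun π hπ => Or.inl (hs.1.trans (hup π hπ (hall π hπ)))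
      exact hs.2 (hup τ hτf (hall τ hτf))
    omega

/-- The faces of a maximal flag, numbered by their dimensions `0, …, n`. -/
theorem exists_enumeration (h : IsFacetSystem v P L) {f : Set (Set (Fin n → F))}
    (hf : Maximal (· ∈ flags P) f) : ∃ s : ℕ → Set (Fin n → F),
      (∀ i ≤ n, s i ∈ f ∧ faceDim (s i) = i) ∧ ∀ σ ∈ f, s (faceDim σ) = σ := by
  choose s hs using fun i : {i // i ≤ n} => h.exists_faceDim_eq hf i.2
  refine ⟨fun i => if hi : i ≤ n then s ⟨i, hi⟩ else ∅, fun i hi => ?_, fun σ hσ => ?_⟩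
  · simp only [dif_pos hi]
    exact hs ⟨i, hi⟩
  · have hd := h.faceDim_le_self (hf.1.2.2.1 σ hσ)
    simp only [dif_pos hd]
    exact h.faceDim_injOn hf.1 (hs ⟨_, hd⟩).1 hσ (hs ⟨_, hd⟩).2

theorem finite_flags (h : IsFacetSystem v P L) : (flags P).Finite :=
  h.finite_faces.finite_subsets.subset fun _ hf σ hσ => hf.2.2.1 σ hσ

theorem exists_maximal_flag (h : IsFacetSystem v P L) {f : Set (Set (Fin n → F))}
    (hf : f ∈ flags P) : ∃ f', f ⊆ f' ∧ Maximal (· ∈ flags P) f' :=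
  h.finite_flags.exists_le_maximal hf

end IsFacetSystem

end Faces

/-! ### Barycentric coordinates -/

section Barycentric

variable {F : Type*} [Field F] {n : ℕ}

/-- The partial sum `∑_{dim σ ≥ k} t_σ`. For `t` supported on a maximal flag these are the
coordinates of the vector `∑_σ t_σ b_σ` in the basis of the successive differences of the
barycenters. -/
noncomputable def tailSum (k : ℕ) : (Set (Fin n → F) →₀ F) →ₗ[F] F :=
  Finsupp.linearCombination F fun σ => if k ≤ faceDim σ then 1 else 0

theorem tailSum_apply (k : ℕ) (t : Set (Fin n → F) →₀ F) :
    tailSum k t = ∑ σ ∈ t.support, t σ * if k ≤ faceDim σ then 1 else 0 := by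
  rw [tailSum, Finsupp.linearCombination_apply, Finsupp.sum]
  simp

@[simp]
theorem tailSum_single (k : ℕ) (σ : Set (Fin n → F)) (c : F) :
    tailSum k (Finsupp.single σ c) = c * if k ≤ faceDim σ then 1 else 0 := by
  simp [tailSum]

theorem tailSum_eq_succ {t : Set (Fin n → F) →₀ F} {k : ℕ}
    (hk : ∀ σ ∈ t.support, faceDim σ ≠ k) : tailSum k t = tailSum (k + 1) t := by
  rw [tailSum_apply, tailSum_apply]
  refine Finset.sum_congr rfl fun σ hσ => ?_
  have := hk σ hσ
  congr 1
  split_ifs <;> first | rfl | omega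

variable [LinearOrder F]

/-- The vector `∑_σ t_σ b_σ`, where `b_σ` is the lift of the barycenter of `σ`. -/
noncomputable def baryVec : (Set (Fin n → F) →₀ F) →ₗ[F] (Fin (n + 1) → F) :=
  Finsupp.linearCombination F fun σ => homog (barycenter σ)

theorem apply_baryVec (l : Module.Dual F (Fin (n + 1) → F)) (t : Set (Fin n → F) →₀ F) :
    l (baryVec t) = ∑ σ ∈ t.support, t σ * l (homog (barycenter σ)) := by
  rw [baryVec, Finsupp.linearCombination_apply, map_finsuppSum, Finsupp.sum]
  simp

@[simp]
theorem baryVec_single (σ : Set (Fin n → F)) (c : F) :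
    baryVec (Finsupp.single σ c) = c • homog (barycenter σ) := by
  simp [baryVec]

theorem baryVec_eq_add_erase (t : Set (Fin n → F) →₀ F) (σ : Set (Fin n → F)) :
    baryVec t = t σ • homog (barycenter σ) + baryVec (t.erase σ) := by
  conv_lhs => rw [← Finsupp.single_add_erase σ t]
  rw [map_add, baryVec_single]

/-- Barycentric coordinates on the cone over `P`: nonnegative coefficients, the support of which
is a chain of faces. -/
structure IsBarycentric (P : Set (Fin n → F)) (t : Set (Fin n → F) →₀ F) : Prop where
  nonneg : ∀ σ, 0 ≤ t σ
  isFace : ∀ σ ∈ t.support, IsFace P σ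
  chain : IsChain (· ⊆ ·) (t.support : Set (Set (Fin n → F)))

theorem isBarycentric_of_flag {P : Set (Fin n → F)} {f : Set (Set (Fin n → F))}
    (hf : f ∈ flags P) {t : Set (Fin n → F) →₀ F} (h0 : ∀ σ, 0 ≤ t σ)
    (ht : (t.support : Set (Set (Fin n → F))) ⊆ f) : IsBarycentric P t :=
  ⟨h0, fun σ hσ => hf.2.2.1 σ (ht hσ), hf.2.2.2.mono ht⟩

theorem IsBarycentric.erase {P : Set (Fin n → F)} {t : Set (Fin n → F) →₀ F}
    (ht : IsBarycentric P t) (σ : Set (Fin n → F)) : IsBarycentric P (t.erase σ) := by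
  classical
  have hs : (t.erase σ).support ⊆ t.support := by
    rw [Finsupp.support_erase]
    exact Finset.erase_subset _ _
  refine ⟨fun τ => ?_, fun τ hτ => ht.isFace τ (hs hτ), ht.chain.mono hs⟩
  rw [Finsupp.erase_apply]
  split_ifs
  · exact le_rfl
  · exact ht.nonneg τ

variable [IsStrictOrderedRing F] {P : Set (Fin n → F)}

theorem IsBarycentric.smul {t : Set (Fin n → F) →₀ F}
    (ht : IsBarycentric P t) {c : F} (hc : 0 ≤ c) : IsBarycentric P (c • t) :=
  ⟨fun σ => mul_nonneg hc (ht.nonneg σ), fun σ hσ => ht.isFace σ (Finsupp.support_smul hσ),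
    ht.chain.mono Finsupp.support_smul⟩

theorem tailSum_antitone {t : Set (Fin n → F) →₀ F} (h0 : ∀ σ, 0 ≤ t σ) :
    Antitone fun k => tailSum k t := by
  intro k k' hk
  simp only [tailSum_apply]
  refine Finset.sum_le_sum fun σ _ => mul_le_mul_of_nonneg_left ?_ (h0 σ)
  split_ifs
  · exact le_rfl
  · omega
  · exact zero_le_one
  · exact le_rfl

variable [TopologicalSpace F] {v : AbsoluteValue F ℝ}
  {L : Finset (Module.Dual F (Fin (n + 1) → F))}

namespace IsFacetSystem

theorem isBarycentric_nonneg (h : IsFacetSystem v P L) {t : Set (Fin n → F) →₀ F}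
    (ht : IsBarycentric P t) {l : Module.Dual F (Fin (n + 1) → F)} (hl : l ∈ L) :
    ∀ σ ∈ t.support, 0 ≤ t σ * l (homog (barycenter σ)) := fun σ hσ =>
  mul_nonneg (ht.nonneg σ) (h.nonneg_barycenter (ht.isFace σ hσ) hl)

theorem exists_top (h : IsFacetSystem v P L) {t : Set (Fin n → F) →₀ F}
    (ht : IsBarycentric P t) (h0 : t ≠ 0) : ∃ σ ∈ t.support, ∀ ρ ∈ t.support, ρ ⊆ σ := by
  obtain ⟨σ, hσ, hmax⟩ := Finset.exists_max_image t.support faceDim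
    (Finsupp.support_nonempty_iff.2 h0)
  refine ⟨σ, hσ, fun ρ hρ => ?_⟩
  have hf : (t.support : Set (Set (Fin n → F))) ∈ flags P :=
    ⟨⟨σ, hσ⟩, Finset.finite_toSet _, ht.isFace, ht.chain⟩
  exact h.subset_of_faceDim_le hf hρ hσ (hmax ρ hρ)

/-- The forms that vanish at a point are the forms that vanish on the largest face in the support
of its barycentric coordinates. -/
theorem apply_baryVec_eq_zero_iff (h : IsFacetSystem v P L) {t : Set (Fin n → F) →₀ F}
    (ht : IsBarycentric P t) {σ : Set (Fin n → F)} (hσ : σ ∈ t.support)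
    (htop : ∀ ρ ∈ t.support, ρ ⊆ σ) {l : Module.Dual F (Fin (n + 1) → F)} (hl : l ∈ L) :
    l (baryVec t) = 0 ↔ l ∈ zeroForms L σ := by
  rw [apply_baryVec, Finset.sum_eq_zero_iff_of_nonneg (h.isBarycentric_nonneg ht hl)]
  constructor
  · intro h0
    rw [h.mem_zeroForms_iff (ht.isFace σ hσ) hl]
    exact (mul_eq_zero.1 (h0 σ hσ)).resolve_left (Finsupp.mem_support_iff.1 hσ)
  · intro h0 ρ hρ
    rw [(mem_zeroForms.1 h0).2 _ (htop ρ hρ (h.barycenter_mem ρ (ht.isFace ρ hρ))), mul_zero]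

theorem eq_zero_of_baryVec_eq_zero (h : IsFacetSystem v P L) {t : Set (Fin n → F) →₀ F}
    (ht : IsBarycentric P t) (h0 : baryVec t = 0) : t = 0 := by
  by_contra hne
  obtain ⟨σ, hσ, htop⟩ := h.exists_top ht hne
  obtain ⟨l, hl, hlσ⟩ := h.exists_form_notMem (ht.isFace σ hσ)
  exact hlσ ((h.apply_baryVec_eq_zero_iff ht hσ htop hl).1 (by rw [h0, map_zero]))

/-- The coefficient at the largest face `σ` of the support is as large as possible: a form that
vanishes on the smaller faces but not on `σ` computes it. -/
theorem coeff_top_le (h : IsFacetSystem v P L) {t t' : Set (Fin n → F) →₀ F}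
    (ht : IsBarycentric P t) (ht' : IsBarycentric P t') {σ : Set (Fin n → F)}
    (hσ : σ ∈ t.support) (hσ' : σ ∈ t'.support) (htop : ∀ ρ ∈ t.support, ρ ⊆ σ)
    (he : baryVec t = baryVec t') : t' σ ≤ t σ := by
  classical
  have hσf := ht.isFace σ hσ
  -- a form that vanishes on the rest of `t` but not on `σ`
  obtain ⟨l, hl, hl0, hlσ⟩ : ∃ l ∈ L, l (baryVec (t.erase σ)) = 0 ∧ l ∉ zeroForms L σ := by
    by_cases h0 : t.erase σ = 0
    · obtain ⟨l, hl, hlσ⟩ := h.exists_form_notMem hσf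
      exact ⟨l, hl, by rw [h0, map_zero, map_zero], hlσ⟩
    · obtain ⟨ρ, hρ, hρtop⟩ := h.exists_top (ht.erase σ) h0
      have hρ' := hρ
      rw [Finsupp.support_erase, Finset.mem_erase] at hρ'
      obtain ⟨l, hl, hlρ, hlσ⟩ := h.exists_form_of_ssubset hσf ((ht.erase σ).isFace ρ hρ)
        ((htop ρ hρ'.2).ssubset_of_ne hρ'.1)
      exact ⟨l, hl, (h.apply_baryVec_eq_zero_iff (ht.erase σ) hρ hρtop hl).2 hlρ, hlσ⟩
  have hpos := h.pos_barycenter hσf hl hlσ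
  have h1 : l (baryVec t) = t σ * l (homog (barycenter σ)) := by
    rw [baryVec_eq_add_erase t σ, map_add, hl0, add_zero, map_smul, smul_eq_mul]
  have h2 : t' σ * l (homog (barycenter σ)) ≤ l (baryVec t') := by
    rw [apply_baryVec]
    exact Finset.single_le_sum (h.isBarycentric_nonneg ht' hl) hσ'
  rw [← he, h1] at h2
  exact le_of_mul_le_mul_right h2 hpos

/-- Barycentric coordinates are unique. -/
theorem baryVec_inj (h : IsFacetSystem v P L) {t t' : Set (Fin n → F) →₀ F}
    (ht : IsBarycentric P t) (ht' : IsBarycentric P t') (he : baryVec t = baryVec t') :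
    t = t' := by
  classical
  induction hk : t.support.card using Nat.strong_induction_on generalizing t t' with
  | _ k ih =>
    by_cases h0 : t = 0
    · rw [h0, map_zero] at he
      rw [h0, h.eq_zero_of_baryVec_eq_zero ht' he.symm]
    by_cases h0' : t' = 0
    · rw [h0', map_zero] at he
      rw [h0', h.eq_zero_of_baryVec_eq_zero ht he]
    obtain ⟨σ, hσ, htop⟩ := h.exists_top ht h0
    obtain ⟨σ', hσ', htop'⟩ := h.exists_top ht' h0'
    obtain rfl : σ = σ' := by
      refine h.face_ext (ht.isFace σ hσ) (ht'.isFace σ' hσ') ?_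
      ext l
      refine ⟨fun hl => ?_, fun hl => ?_⟩ <;> have hlL := (mem_zeroForms.1 hl).1
      · rwa [← h.apply_baryVec_eq_zero_iff ht' hσ' htop' hlL, ← he,
          h.apply_baryVec_eq_zero_iff ht hσ htop hlL]
      · rwa [← h.apply_baryVec_eq_zero_iff ht hσ htop hlL, he,
          h.apply_baryVec_eq_zero_iff ht' hσ' htop' hlL]
    have hc : t σ = t' σ := le_antisymm (h.coeff_top_le ht' ht hσ' hσ htop' he.symm)
      (h.coeff_top_le ht ht' hσ hσ' htop he)
    rw [baryVec_eq_add_erase t σ, baryVec_eq_add_erase t' σ, hc, add_right_inj] at he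
    have := ih _ (by
      rw [← hk, Finsupp.support_erase]
      exact Finset.card_erase_lt_of_mem hσ) (ht.erase σ) (ht'.erase σ) he rfl
    rw [← Finsupp.single_add_erase σ t, ← Finsupp.single_add_erase σ t', hc, this]

theorem exists_barycentric_of_face (h : IsFacetSystem v P L) {σ : Set (Fin n → F)}
    (hσ : IsFace P σ) {w : Fin (n + 1) → F} (hw : ∀ l ∈ L, 0 ≤ l w)
    (hwσ : ∀ l ∈ zeroForms L σ, l w = 0) :
    ∃ t, IsBarycentric P t ∧ (∀ ρ ∈ t.support, ρ ⊆ σ) ∧ baryVec t = w := by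
  classical
  induction hk : faceDim σ using Nat.strong_induction_on generalizing σ w with
  | _ k ih =>
    obtain ⟨c, y, hc, hwy, hy, hy'⟩ := h.exists_sub_barycenter hσ hw hwσ
    obtain ⟨t, ht, hts, hty⟩ : ∃ t, IsBarycentric P t ∧ (∀ ρ ∈ t.support, ρ ⊂ σ) ∧
        baryVec t = y := by
      rcases hy' with rfl | ⟨τ, hτ, hτσ, hτy⟩
      · exact ⟨0, ⟨fun _ => le_rfl, by simp, by simp⟩, by simp, map_zero _⟩
      · obtain ⟨t, ht, hts, hty⟩ := ih _ (hk ▸ h.faceDim_lt hσ hτ hτσ) hτ hy hτy rfl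
        exact ⟨t, ht, fun ρ hρ => (hts ρ hρ).trans_ssubset hτσ, hty⟩
    have hsupp : ∀ ρ ∈ (Finsupp.single σ c + t).support, ρ = σ ∨ ρ ∈ t.support := fun ρ hρ => by
      rcases Finset.mem_union.1 (Finsupp.support_add hρ) with h1 | h1
      · exact Or.inl (Finset.mem_singleton.1 (Finsupp.support_single_subset h1))
      · exact Or.inr h1
    refine ⟨Finsupp.single σ c + t, ⟨fun ρ => ?_, fun ρ hρ => ?_, ?_⟩, fun ρ hρ => ?_, ?_⟩
    · rw [Finsupp.add_apply]
      refine add_nonneg ?_ (ht.nonneg ρ)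
      rw [Finsupp.single_apply]
      split_ifs
      · exact hc
      · exact le_rfl
    · rcases hsupp ρ hρ with rfl | h1
      · exact hσ
      · exact ht.isFace ρ h1
    · refine (ht.chain.insert (a := σ) fun ρ hρ _ => Or.inr (hts ρ hρ).1).mono ?_
      exact fun ρ hρ => hsupp ρ hρ
    · rcases hsupp ρ hρ with rfl | h1
      · exact subset_rfl
      · exact (hts ρ h1).1
    · rw [map_add, baryVec_single, hty, hwy]

/-- The barycentric subdivision covers the cone over `P`. -/
theorem exists_barycentric (h : IsFacetSystem v P L) {w : Fin (n + 1) → F}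
    (hw : ∀ l ∈ L, 0 ≤ l w) : ∃ t, IsBarycentric P t ∧ baryVec t = w := by
  obtain ⟨t, ht, -, h1⟩ := h.exists_barycentric_of_face h.isFace_self hw
    (by simp [h.zeroForms_self])
  exact ⟨t, ht, h1⟩

/-- Interior points are those with a positive coefficient at the barycenter of `P`. -/
theorem forall_pos_iff (h : IsFacetSystem v P L) {t : Set (Fin n → F) →₀ F}
    (ht : IsBarycentric P t) : (∀ l ∈ L, 0 < l (baryVec t)) ↔ 0 < t P := by
  constructor
  · intro hl
    have h0 : t ≠ 0 := by
      rintro rfl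
      obtain ⟨l, hlL, -⟩ := h.exists_form_notMem h.isFace_self
      simpa using hl l hlL
    obtain ⟨σ, hσ, htop⟩ := h.exists_top ht h0
    by_cases hσP : σ = P
    · subst hσP
      exact lt_of_le_of_ne (ht.nonneg _) (Finsupp.mem_support_iff.1 hσ).symm
    · obtain ⟨l, hlL, hlσ, -⟩ := h.exists_form_of_ssubset h.isFace_self (ht.isFace σ hσ)
        ((ht.isFace σ hσ).subset.ssubset_of_ne hσP)
      exact absurd ((h.apply_baryVec_eq_zero_iff ht hσ htop hlL).2 hlσ) (hl l hlL).ne'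
  · intro hP l hl
    rw [apply_baryVec]
    refine lt_of_lt_of_le (mul_pos hP (h.pos_barycenter_self hl))
      (Finset.single_le_sum (h.isBarycentric_nonneg ht hl) ?_)
    exact Finsupp.mem_support_iff.2 hP.ne'

theorem tailSum_pos (h : IsFacetSystem v P L) {t : Set (Fin n → F) →₀ F}
    (h0 : ∀ σ, 0 ≤ t σ) (hP : 0 < t P) {k : ℕ} (hk : k ≤ n) : 0 < tailSum k t := by
  rw [tailSum_apply]
  refine lt_of_lt_of_le ?_ (Finset.single_le_sum (f := fun σ => t σ * if k ≤ faceDim σ then 1 else 0)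
    (fun σ _ => mul_nonneg (h0 σ) (by split_ifs <;> simp))
    (Finsupp.mem_support_iff.2 hP.ne'))
  rw [h.faceDim_self, if_pos hk, mul_one]
  exact hP

/-! ### Coordinates along a maximal flag -/

/-- A form of the facet system vanishes at the barycenters of the faces of a maximal flag up to
some dimension, and at no later one. -/
theorem form_along_flag (h : IsFacetSystem v P L) {f : Set (Set (Fin n → F))}
    (hf : Maximal (· ∈ flags P) f) {l : Module.Dual F (Fin (n + 1) → F)} (hl : l ∈ L) :
    ∃ k ≤ n, ∀ σ ∈ f, l (homog (barycenter σ)) ≠ 0 ↔ k ≤ faceDim σ := by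
  classical
  obtain ⟨σ, hσ, hmin⟩ := Finset.exists_min_image
    (hf.1.2.1.toFinset.filter fun σ => l (homog (barycenter σ)) ≠ 0) faceDim
    ⟨P, by
      simp only [Finset.mem_filter, Set.Finite.mem_toFinset]
      exact ⟨h.self_mem_of_maximal hf, (h.pos_barycenter_self hl).ne'⟩⟩
  simp only [Finset.mem_filter, Set.Finite.mem_toFinset] at hσ hmin
  have hface := hf.1.2.2.1
  refine ⟨faceDim σ, h.faceDim_le_self (hface σ hσ.1), fun ρ hρ =>
    ⟨fun h0 => hmin ρ ⟨hρ, h0⟩, fun hd h0 => hσ.2 ?_⟩⟩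
  have hs := h.subset_of_faceDim_le hf.1 hσ.1 hρ hd
  rw [← h.mem_zeroForms_iff (hface ρ hρ) hl] at h0
  exact (mem_zeroForms.1 h0).2 _ (hs (h.barycenter_mem σ (hface σ hσ.1)))

/-- Every dimension is the first one at which some form of the facet system does not vanish. -/
theorem exists_form_along_flag (h : IsFacetSystem v P L) {f : Set (Set (Fin n → F))}
    (hf : Maximal (· ∈ flags P) f) {k : ℕ} (hk : k ≤ n) :
    ∃ l ∈ L, ∀ σ ∈ f, l (homog (barycenter σ)) ≠ 0 ↔ k ≤ faceDim σ := by
  have hface := hf.1.2.2.1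
  obtain ⟨σ, hσ, hσk⟩ := h.exists_faceDim_eq hf hk
  have hup : ∀ l ∈ L, l ∉ zeroForms L σ → ∀ ρ ∈ f, k ≤ faceDim ρ →
      l (homog (barycenter ρ)) ≠ 0 := fun l hl hlσ ρ hρ hd h0 => by
    rw [← h.mem_zeroForms_iff (hface ρ hρ) hl] at h0
    exact hlσ ((h.subset_iff (hface ρ hρ) (hface σ hσ)).1
      (h.subset_of_faceDim_le hf.1 hσ hρ (hσk.trans_le hd)) h0)
  rcases Nat.eq_zero_or_pos k with rfl | hk0
  · obtain ⟨l, hl, hlσ⟩ := h.exists_form_notMem (hface σ hσ)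
    exact ⟨l, hl, fun ρ hρ => ⟨fun _ => Nat.zero_le _, hup l hl hlσ ρ hρ⟩⟩
  · obtain ⟨τ, hτ, hτk⟩ := h.exists_faceDim_eq hf (k := k - 1) (by omega)
    have hs : τ ⊂ σ := (h.subset_of_faceDim_le hf.1 hτ hσ (by omega)).ssubset_of_ne (by
      rintro rfl
      omega)
    obtain ⟨l, hl, hlτ, hlσ⟩ := h.exists_form_of_ssubset (hface σ hσ) (hface τ hτ) hs
    refine ⟨l, hl, fun ρ hρ => ⟨fun h0 => ?_, hup l hl hlσ ρ hρ⟩⟩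
    by_contra hd
    refine h0 ?_
    rw [← h.mem_zeroForms_iff (hface ρ hρ) hl]
    exact (h.subset_iff (hface τ hτ) (hface ρ hρ)).1
      (h.subset_of_faceDim_le hf.1 hρ hτ (by omega)) hlτ

/-- The differences of the lifts of consecutive barycenters of a maximal flag form a basis, and
the coordinates in this basis are the partial sums of the barycentric coordinates. -/
theorem exists_flagBasis (h : IsFacetSystem v P L) {f : Set (Set (Fin n → F))}
    (hf : Maximal (· ∈ flags P) f) :
    ∃ e : Module.Basis (Fin (n + 1)) F (Fin (n + 1) → F),
      ∀ t : Set (Fin n → F) →₀ F, (t.support : Set (Set (Fin n → F))) ⊆ f →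
        ∀ i, e.repr (baryVec t) i = tailSum i t := by
  classical
  obtain ⟨s, hs, hsf⟩ := h.exists_enumeration hf
  let B : ℕ → Fin (n + 1) → F := fun i => Nat.casesOn i 0 fun j => homog (barycenter (s j))
  let e : Fin (n + 1) → Fin (n + 1) → F := fun i => B (i + 1) - B i
  have hform : ∀ k : Fin (n + 1), ∃ l : Module.Dual F (Fin (n + 1) → F),
      (∀ i ≤ (k : ℕ), l (B i) = 0) ∧ l (B (k + 1)) ≠ 0 := fun k => by
    obtain ⟨l, -, hl⟩ := h.exists_form_along_flag hf (k := k) (by omega)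
    refine ⟨l, fun i hi => ?_, ?_⟩
    · cases i with
      | zero => exact map_zero l
      | succ j =>
        by_contra h0
        have := (hl (s j) (hs j (by omega)).1).1 h0
        rw [(hs j (by omega)).2] at this
        omega
    · refine (hl (s k) (hs k (by omega)).1).2 ?_
      rw [(hs k (by omega)).2]
  have hli : LinearIndependent F e := by
    rw [Fintype.linearIndependent_iff]
    intro g hg
    by_contra! hne
    obtain ⟨k, hk, hmax⟩ := Finset.exists_max_image (Finset.univ.filter fun i => g i ≠ 0)
      (fun i => (i : ℕ)) (by
        obtain ⟨i, hi⟩ := hne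
        exact ⟨i, by simp [hi]⟩)
    simp only [Finset.mem_filter, Finset.mem_univ, true_and] at hk hmax
    obtain ⟨l, hl, hlk⟩ := hform k
    have h1 := congrArg l hg
    rw [map_zero, map_sum, Finset.sum_eq_single k] at h1
    · simp only [e, map_smul, map_sub, hl k le_rfl, sub_zero, smul_eq_mul, mul_eq_zero] at h1
      exact h1.elim hk hlk
    · intro i _ hik
      rcases lt_or_gt_of_ne (fun hc => hik (Fin.ext hc)) with hlt | hgt
      · simp only [e, map_smul, map_sub]
        rw [hl _ (Nat.succ_le_of_lt hlt), hl _ (le_of_lt hlt)]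
        simp
      · have : g i = 0 := by
          by_contra h0
          exact absurd (hmax i h0) (not_le.2 hgt)
        rw [this, zero_smul, map_zero]
    · simp
  let b : Module.Basis (Fin (n + 1)) F (Fin (n + 1) → F) :=
    basisOfLinearIndependentOfCardEqFinrank hli (by simp)
  have hb : ∀ i, b i = e i := fun i => by simp [b]
  refine ⟨b, fun t ht i => ?_⟩
  have hsum : baryVec t = ∑ i : Fin (n + 1), tailSum i t • b i := by
    have hone : ∀ σ ∈ f, homog (barycenter σ) =
        ∑ i : Fin (n + 1), (if (i : ℕ) ≤ faceDim σ then (1 : F) else 0) • b i := fun σ hσ => by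
      have hd := h.faceDim_le_self (hf.1.2.2.1 σ hσ)
      simp only [hb, e]
      rw [Fin.sum_univ_eq_sum_range
        (fun i => (if i ≤ faceDim σ then (1 : F) else 0) • (B (i + 1) - B i)) (n + 1)]
      simp only [ite_smul, one_smul, zero_smul]
      rw [← Finset.sum_filter, show (Finset.range (n + 1)).filter (fun i => i ≤ faceDim σ) =
        Finset.range (faceDim σ + 1) by ext i; simp; omega, Finset.sum_range_sub]
      simp [B, hsf σ hσ]
    rw [baryVec, Finsupp.linearCombination_apply, Finsupp.sum]
    simp only [tailSum_apply, Finset.sum_smul]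
    rw [Finset.sum_comm]
    refine Finset.sum_congr rfl fun σ hσ => ?_
    rw [hone σ (ht hσ), Finset.smul_sum]
    simp only [smul_smul]
  rw [hsum, b.repr_sum_self]

/-- Every decreasing sequence of nonnegative numbers is the sequence of partial sums of barycentric
coordinates along a given maximal flag. -/
theorem exists_tailSum_eq (h : IsFacetSystem v P L) {f : Set (Set (Fin n → F))}
    (hf : Maximal (· ∈ flags P) f) (x : Fin (n + 1) → F) (hx : Antitone x) (h0 : ∀ i, 0 ≤ x i) :
    ∃ t : Set (Fin n → F) →₀ F, (∀ σ, 0 ≤ t σ) ∧ (t.support : Set (Set (Fin n → F))) ⊆ f ∧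
      t P = x (Fin.last n) ∧ (∀ i : Fin (n + 1), tailSum i t = x i) ∧
      ∀ σ ∈ t.support, ∀ i j : Fin (n + 1), (i : ℕ) = faceDim σ → (j : ℕ) = i + 1 →
        x i ≠ x j := by
  classical
  obtain ⟨s, hs, hsf⟩ := h.exists_enumeration hf
  let X : ℕ → F := fun i => if hi : i < n + 1 then x ⟨i, hi⟩ else 0
  have hX : ∀ i : Fin (n + 1), X i = x i := fun i => dif_pos i.2
  have hXn : X (n + 1) = 0 := dif_neg (lt_irrefl _)
  have hXanti : ∀ i < n + 1, X (i + 1) ≤ X i := fun i hi => by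
    by_cases hi' : i + 1 < n + 1
    · simp only [X, dif_pos hi, dif_pos hi']
      exact hx (Fin.mk_le_mk.2 (Nat.le_succ i))
    · simp only [X, dif_pos hi, dif_neg hi']
      exact h0 _
  let t : Set (Fin n → F) →₀ F :=
    ∑ i ∈ Finset.range (n + 1), Finsupp.single (s i) (X i - X (i + 1))
  have htσ : ∀ i < n + 1, t (s i) = X i - X (i + 1) := fun i hi => by
    simp only [t, Finsupp.finsetSum_apply]
    rw [Finset.sum_eq_single_of_mem i (Finset.mem_range.2 hi), Finsupp.single_eq_same]
    intro j hj hji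
    refine Finsupp.single_eq_of_ne fun hc => hji ?_
    have := congrArg faceDim hc
    rw [(hs i (by omega)).2, (hs j (by have := Finset.mem_range.1 hj; omega)).2] at this
    exact this.symm
  have htsupp : ∀ σ, (∀ i < n + 1, s i ≠ σ) → t σ = 0 := fun σ hσ => by
    simp only [t, Finsupp.finsetSum_apply]
    exact Finset.sum_eq_zero fun i hi =>
      Finsupp.single_eq_of_ne (Ne.symm (hσ i (Finset.mem_range.1 hi)))
  have hsP : s n = P := by
    have := hsf P (h.self_mem_of_maximal hf)
    rwa [h.faceDim_self] at this
  refine ⟨t, fun σ => ?_, fun σ hσ => ?_, ?_, fun k => ?_, fun σ hσ i j hi hj he => ?_⟩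
  · by_cases hσ : ∃ i < n + 1, s i = σ
    · obtain ⟨i, hi, rfl⟩ := hσ
      rw [htσ i hi]
      exact sub_nonneg.2 (hXanti i hi)
    · push Not at hσ
      rw [htsupp σ hσ]
  · by_contra hσf
    refine Finsupp.mem_support_iff.1 hσ (htsupp σ fun i hi hc => hσf ?_)
    rw [← hc]
    exact (hs i (by omega)).1
  · rw [← hsP, htσ n (by omega), hXn, sub_zero]
    exact hX (Fin.last n)
  · have hind : ∀ m ≤ n + 1, ∑ i ∈ Finset.range m,
        (X i - X (i + 1)) * (if (k : ℕ) ≤ faceDim (s i) then 1 else 0) =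
        if (k : ℕ) ≤ m then X k - X m else 0 := by
      intro m hm
      induction m with
      | zero =>
        by_cases hk : (k : ℕ) ≤ 0
        · simp [Nat.le_zero.1 hk]
        · simp [hk]
      | succ m ih =>
        rw [Finset.sum_range_succ, ih (by omega), (hs m (by omega)).2]
        rcases lt_trichotomy (k : ℕ) (m + 1) with hlt | heq | hgt
        · rw [if_pos (by omega), if_pos (by omega), if_pos hlt.le]
          ring
        · rw [if_neg (by omega), if_neg (by omega), if_pos heq.le, heq]
          ring
        · rw [if_neg (by omega), if_neg (by omega), if_neg (by omega)]
          ring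
    simp only [t, map_sum, tailSum_single]
    rw [hind (n + 1) le_rfl, if_pos k.2.le, hXn, sub_zero, hX]
  · have hσi : s i = σ := by
      by_contra hc
      refine Finsupp.mem_support_iff.1 hσ (htsupp σ fun m hm hmσ => hc ?_)
      rw [hi, ← hmσ, (hs m (by omega)).2]
    refine Finsupp.mem_support_iff.1 hσ ?_
    rw [← hσi, htσ i i.2, ← hj, hX, hX, he, sub_self]

end IsFacetSystem

end Barycentric

/-! ### The Hilbert distance in terms of a facet system -/

section Distance

variable {F : Type*} [Field F]

/-- The partial sums of `t` over the dimensions `0, …, n`: for `t` supported on a maximal flag,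
the coordinates of `∑_σ t_σ b_σ` in the basis of this flag. -/
noncomputable def flagCoord {n : ℕ} (t : Set (Fin n → F) →₀ F) : Fin (n + 1) → F :=
  fun i => tailSum i t

theorem hexDist_logClass (v : AbsoluteValue F ℝ) {d : ℕ} (x y : Fin d → F) :
    hexDist (logClass v x) (logClass v y) = ⨆ p : Fin d × Fin d,
      |(Real.log (v (x p.1)) - Real.log (v (y p.1))) -
        (Real.log (v (x p.2)) - Real.log (v (y p.2)))| := rfl

theorem crossRatio_mk {n : ℕ} (φ ψ : ℙ F (Module.Dual F (Fin (n + 1) → F))) {w w' : Fin (n + 1) → F}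
    (hw : w ≠ 0) (hw' : w' ≠ 0) :
    crossRatio φ (Projectivization.mk F w hw) (Projectivization.mk F w' hw') ψ =
      ψ.rep w / ψ.rep w' * (φ.rep w' / φ.rep w) := by
  obtain ⟨a, ha⟩ := Projectivization.exists_smul_eq_mk_rep F w hw
  obtain ⟨b, hb⟩ := Projectivization.exists_smul_eq_mk_rep F w' hw'
  have ha0 := a.ne_zero
  have hb0 := b.ne_zero
  rw [crossRatio, ← ha, ← hb]
  simp only [Units.smul_def, map_smul, smul_eq_mul]
  field_simp

variable [LinearOrder F] [IsStrictOrderedRing F]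

/-- In a non-Archimedean ordered field, the absolute value of a sum of nonnegative elements is
the maximum of the absolute values; so only the absolute values of nonnegative factors matter. -/
theorem abv_sum_mul_eq {v : AbsoluteValue F ℝ} (hv : IsNonarchimedean v)
    (hord : ∀ x y : F, 0 ≤ x → x ≤ y → v x ≤ v y) {ι : Type*} (s : Finset ι) (a c b : ι → F)
    (ha : ∀ i ∈ s, 0 ≤ a i) (hc : ∀ i ∈ s, 0 ≤ c i) (hb : ∀ i ∈ s, 0 ≤ b i)
    (hcb : ∀ i ∈ s, v (c i) = v (b i)) :
    v (∑ i ∈ s, a i * c i) = v (∑ i ∈ s, a i * b i) := by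
  classical
  have hadd : ∀ x y : F, 0 ≤ x → 0 ≤ y → v (x + y) = max (v x) (v y) := fun x y hx hy =>
    le_antisymm (hv x y) (max_le (hord _ _ hx (by linarith)) (hord _ _ hy (by linarith)))
  induction s using Finset.induction_on with
  | empty => simp
  | insert i s hi ih =>
    simp only [Finset.forall_mem_insert] at ha hc hb hcb
    rw [Finset.sum_insert hi, Finset.sum_insert hi,
      hadd _ _ (mul_nonneg ha.1 hc.1)
        (Finset.sum_nonneg fun j hj => mul_nonneg (ha.2 j hj) (hc.2 j hj)),
      hadd _ _ (mul_nonneg ha.1 hb.1)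
        (Finset.sum_nonneg fun j hj => mul_nonneg (ha.2 j hj) (hb.2 j hj)),
      ih ha.2 hc.2 hb.2 hcb.2, map_mul, map_mul, hcb.1]

/-- The quotient of the values of a form without zeros in the open cone is at most the largest
quotient of the values of a form of the facet system. -/
theorem div_le_div_of_forall_ne_zero {n : ℕ} {L : Finset (Module.Dual F (Fin (n + 1) → F))}
    {φ : Module.Dual F (Fin (n + 1) → F)}
    (hφ : ∀ w : Fin (n + 1) → F, (∀ l ∈ L, 0 < l w) → φ w ≠ 0) {w w' : Fin (n + 1) → F}
    (hw : ∀ l ∈ L, 0 < l w) (hw' : ∀ l ∈ L, 0 < l w') {l₁ : Module.Dual F (Fin (n + 1) → F)}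
    (hl₁ : l₁ ∈ L) (hmax : ∀ l ∈ L, l w * l₁ w' ≤ l₁ w * l w') :
    0 < φ w / φ w' ∧ φ w / φ w' ≤ l₁ w / l₁ w' := by
  wlog hpos : 0 < φ w' generalizing φ
  · have := this (φ := -φ) (fun u hu => by simpa using hφ u hu)
      (by
        rw [LinearMap.neg_apply, neg_pos]
        exact lt_of_le_of_ne (not_lt.1 hpos) (hφ w' hw'))
    simpa using this
  have hcone : ∀ u : Fin (n + 1) → F, (∀ l ∈ L, 0 ≤ l u) → 0 ≤ φ u := by
    intro u hu
    by_contra! hneg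
    have he : 0 < -φ u / φ w' := div_pos (neg_pos.2 hneg) hpos
    refine hφ (u + (-φ u / φ w') • w') (fun l hl => ?_) ?_
    · rw [map_add, map_smul, smul_eq_mul]
      exact add_pos_of_nonneg_of_pos (hu l hl) (mul_pos he (hw' l hl))
    · rw [map_add, map_smul, smul_eq_mul, div_mul_cancel₀ _ hpos.ne', add_neg_cancel]
  have hw0 : 0 < φ w := lt_of_le_of_ne (hcone w fun l hl => (hw l hl).le) (hφ w hw).symm
  refine ⟨div_pos hw0 hpos, ?_⟩
  have h1 := hcone ((l₁ w / l₁ w') • w' - w) fun l hl => by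
    rw [map_sub, map_smul, smul_eq_mul, sub_nonneg, div_mul_eq_mul_div, le_div_iff₀ (hw' l₁ hl₁)]
    exact hmax l hl
  rw [map_sub, map_smul, smul_eq_mul, sub_nonneg] at h1
  rwa [div_le_iff₀ hpos]

variable [TopologicalSpace F] {n : ℕ} {v : AbsoluteValue F ℝ} {P : Set (Fin n → F)}
  {L : Finset (Module.Dual F (Fin (n + 1) → F))}

namespace IsFacetSystem

theorem ne_zero_of_pos (h : IsFacetSystem v P L) {w : Fin (n + 1) → F} (hw : ∀ l ∈ L, 0 < l w) :
    w ≠ 0 := by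
  rintro rfl
  obtain ⟨l, hl, -⟩ := h.exists_form_notMem h.isFace_self
  simpa using hw l hl

theorem exists_interior_of_pos (h : IsFacetSystem v P L) {w : Fin (n + 1) → F}
    (hw : ∀ l ∈ L, 0 < l w) : ∃ c : F, 0 < c ∧ ∃ x ∈ interior P, w = c • homog x := by
  obtain ⟨c, hc, x, -, hx⟩ := h.exists_smul_homog_of_cone (fun l hl => (hw l hl).le)
    (h.ne_zero_of_pos hw)
  refine ⟨c, hc, x, (h.mem_interior_iff x).2 fun l hl => ?_, hx⟩
  have := hw l hl
  rw [hx, map_smul, smul_eq_mul] at this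
  exact pos_of_mul_pos_right this hc.le

theorem mem_openPart_of_pos (h : IsFacetSystem v P L) {w : Fin (n + 1) → F}
    (hw : ∀ l ∈ L, 0 < l w) : Projectivization.mk F w (h.ne_zero_of_pos hw) ∈ openPart P := by
  obtain ⟨c, hc, x, hx, hwx⟩ := h.exists_interior_of_pos hw
  refine ⟨x, hx, ?_⟩
  rw [affineChart_eq, Projectivization.mk_eq_mk_iff']
  exact ⟨c⁻¹, by rw [hwx, smul_smul, inv_mul_cancel₀ hc.ne', one_smul]⟩

theorem mem_dualSet_iff (h : IsFacetSystem v P L) (φ : ℙ F (Module.Dual F (Fin (n + 1) → F))) :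
    φ ∈ dualSet (openPart P) ↔
      ∀ w : Fin (n + 1) → F, (∀ l ∈ L, 0 < l w) → φ.rep w ≠ 0 := by
  constructor
  · intro hφ w hw
    obtain ⟨a, ha⟩ := Projectivization.exists_smul_eq_mk_rep F w (h.ne_zero_of_pos hw)
    have := hφ _ (h.mem_openPart_of_pos hw)
    rw [← ha] at this
    intro h0
    refine this ?_
    rw [Units.smul_def, map_smul, h0, smul_zero]
  · rintro hφ _ ⟨x, hx, rfl⟩
    obtain ⟨a, ha⟩ := Projectivization.exists_smul_eq_mk_rep F (homog x) (homog_ne_zero x)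
    rw [affineChart_eq, ← ha, Units.smul_def, map_smul]
    exact smul_ne_zero a.ne_zero (hφ _ ((h.mem_interior_iff x).1 hx))

theorem mk_form_mem_dualSet (h : IsFacetSystem v P L) {l : Module.Dual F (Fin (n + 1) → F)}
    (hl : l ∈ L) (hl0 : l ≠ 0) : Projectivization.mk F l hl0 ∈ dualSet (openPart P) := by
  rw [h.mem_dualSet_iff]
  intro w hw
  obtain ⟨a, ha⟩ := Projectivization.exists_smul_eq_mk_rep F l hl0
  rw [← ha, Units.smul_def, LinearMap.smul_apply]
  exact smul_ne_zero a.ne_zero (hw l hl).ne'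

/-- The Hilbert distance is computed by the two forms of the facet system that maximize the
quotients of the values at the two points. -/
theorem edist_eq_of_max (h : IsFacetSystem v P L)
    (hord : ∀ x y : F, 0 ≤ x → x ≤ y → v x ≤ v y) {w w' : Fin (n + 1) → F}
    (hw : ∀ l ∈ L, 0 < l w) (hw' : ∀ l ∈ L, 0 < l w')
    {l₁ l₂ : Module.Dual F (Fin (n + 1) → F)} (hl₁ : l₁ ∈ L) (hl₂ : l₂ ∈ L)
    (hmax₁ : ∀ l ∈ L, l w * l₁ w' ≤ l₁ w * l w') (hmax₂ : ∀ l ∈ L, l w' * l₂ w ≤ l₂ w' * l w)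
    {p q : HilbertDomain v (openPart P) (dualSet_openPart_nonempty P)}
    (hp : Projectivization.mk F w (h.ne_zero_of_pos hw) = p.pt)
    (hq : Projectivization.mk F w' (h.ne_zero_of_pos hw') = q.pt) :
    edist p q = ENNReal.ofReal ((Real.log (v (l₁ w)) - Real.log (v (l₁ w'))) -
      (Real.log (v (l₂ w)) - Real.log (v (l₂ w')))) := by
  have hlog : ∀ φ ψ : Module.Dual F (Fin (n + 1) → F), φ w ≠ 0 → φ w' ≠ 0 → ψ w ≠ 0 → ψ w' ≠ 0 →
      Real.log (v (ψ w / ψ w' * (φ w' / φ w))) =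
        (Real.log (v (ψ w)) - Real.log (v (ψ w'))) -
          (Real.log (v (φ w)) - Real.log (v (φ w'))) := by
    intro φ ψ h1 h2 h3 h4
    rw [map_mul, map_div₀, map_div₀, Real.log_mul, Real.log_div, Real.log_div]
    · ring
    all_goals simp [h1, h2, h3, h4]
  have hform0 : ∀ l ∈ L, l ≠ 0 := by
    rintro l hl rfl
    simpa using hw _ hl
  suffices hd : hilbertDist v (openPart P) p.pt q.pt =
      (((Real.log (v (l₁ w)) - Real.log (v (l₁ w'))) -
        (Real.log (v (l₂ w)) - Real.log (v (l₂ w'))) : ℝ) : EReal) by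
    change (hilbertDist v (openPart P) p.pt q.pt).toENNReal = _
    rw [hd, EReal.real_coe_toENNReal]
  rw [hilbertDist_eq v (dualSet_openPart_nonempty P), ← hp, ← hq]
  apply le_antisymm
  · refine iSup_le fun φ => iSup_le fun ψ => EReal.coe_le_coe_iff.2 ?_
    have hφ := (h.mem_dualSet_iff _).1 φ.2
    have hψ := (h.mem_dualSet_iff _).1 ψ.2
    rw [crossRatio_mk, ← hlog _ _ (hw l₂ hl₂).ne' (hw' l₂ hl₂).ne' (hw l₁ hl₁).ne' (hw' l₁ hl₁).ne']
    obtain ⟨h1, h2⟩ := div_le_div_of_forall_ne_zero hψ hw hw' hl₁ hmax₁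
    obtain ⟨h3, h4⟩ := div_le_div_of_forall_ne_zero hφ hw' hw hl₂ hmax₂
    refine Real.log_le_log (v.pos (mul_pos h1 h3).ne') (hord _ _ (mul_pos h1 h3).le ?_)
    exact mul_le_mul h2 h4 h3.le (h1.le.trans h2)
  · refine le_iSup_of_le ⟨_, h.mk_form_mem_dualSet hl₂ (hform0 l₂ hl₂)⟩
      (le_iSup_of_le ⟨_, h.mk_form_mem_dualSet hl₁ (hform0 l₁ hl₁)⟩ (EReal.coe_le_coe_iff.2 ?_))
    obtain ⟨a, ha⟩ := Projectivization.exists_smul_eq_mk_rep F l₁ (hform0 l₁ hl₁)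
    obtain ⟨b, hb⟩ := Projectivization.exists_smul_eq_mk_rep F l₂ (hform0 l₂ hl₂)
    have ha0 := a.ne_zero
    have hb0 := b.ne_zero
    rw [crossRatio_mk, ← hlog _ _ (hw l₂ hl₂).ne' (hw' l₂ hl₂).ne' (hw l₁ hl₁).ne'
      (hw' l₁ hl₁).ne', ← ha, ← hb]
    simp only [Units.smul_def, LinearMap.smul_apply, smul_eq_mul]
    rw [mul_div_mul_left _ _ ha0, mul_div_mul_left _ _ hb0]

theorem exists_max_form (h : IsFacetSystem v P L) {w w' : Fin (n + 1) → F}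
    (hw' : ∀ l ∈ L, 0 < l w') :
    ∃ l₁ ∈ L, ∀ l ∈ L, l w * l₁ w' ≤ l₁ w * l w' := by
  obtain ⟨l₁, hl₁, hmax⟩ := Finset.exists_max_image L (fun l => l w / l w') (by
    obtain ⟨l, hl, -⟩ := h.exists_form_notMem h.isFace_self
    exact ⟨l, hl⟩)
  exact ⟨l₁, hl₁, fun l hl => (div_le_div_iff₀ (hw' l hl) (hw' l₁ hl₁)).1 (hmax l hl)⟩

theorem edist_ne_top (h : IsFacetSystem v P L) (hord : ∀ x y : F, 0 ≤ x → x ≤ y → v x ≤ v y)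
    (p q : HilbertDomain v (openPart P) (dualSet_openPart_nonempty P)) : edist p q ≠ ⊤ := by
  obtain ⟨x, hx, hxp⟩ := p.mem
  obtain ⟨y, hy, hyq⟩ := q.mem
  rw [h.mem_interior_iff] at hx hy
  obtain ⟨l₁, hl₁, hmax₁⟩ := h.exists_max_form (w := homog x) hy
  obtain ⟨l₂, hl₂, hmax₂⟩ := h.exists_max_form (w := homog y) hx
  rw [h.edist_eq_of_max hord hx hy hl₁ hl₂ hmax₁ hmax₂ hxp hyq]
  exact ENNReal.ofReal_ne_top

/-- The Hilbert distance is additive along a segment: its restriction to the segment from `w` to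
`w'` is the variation of a function. -/
theorem exists_edist_segment_eq (h : IsFacetSystem v P L)
    (hord : ∀ x y : F, 0 ≤ x → x ≤ y → v x ≤ v y) {w w' : Fin (n + 1) → F}
    (hw : ∀ l ∈ L, 0 < l w) (hw' : ∀ l ∈ L, 0 < l w') :
    ∃ g : F → ℝ, (∀ s s', 0 ≤ s → s ≤ s' → s' ≤ 1 → g s' ≤ g s) ∧
      ∀ s s', 0 ≤ s → s ≤ s' → s' ≤ 1 →
      ∀ (z z' : Fin (n + 1) → F) (hz : ∀ l ∈ L, 0 < l z) (hz' : ∀ l ∈ L, 0 < l z'),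
        z = (1 - s) • w + s • w' → z' = (1 - s') • w + s' • w' →
        ∀ p q : HilbertDomain v (openPart P) (dualSet_openPart_nonempty P),
          Projectivization.mk F z (h.ne_zero_of_pos hz) = p.pt →
          Projectivization.mk F z' (h.ne_zero_of_pos hz') = q.pt →
          edist p q = ENNReal.ofReal (g s - g s') := by
  obtain ⟨l₁, hl₁, hmax₁⟩ := h.exists_max_form (w := w) hw'
  obtain ⟨l₂, hl₂, hmax₂⟩ := h.exists_max_form (w := w') hw
  have hpos : ∀ l ∈ L, ∀ s : F, 0 ≤ s → s ≤ 1 → 0 < l ((1 - s) • w + s • w') := by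
    intro l hl s h0 h1
    rw [map_add, map_smul, map_smul, smul_eq_mul, smul_eq_mul]
    rcases h0.eq_or_lt with rfl | h0
    · simpa using hw l hl
    · exact add_pos_of_nonneg_of_pos (mul_nonneg (sub_nonneg.2 h1) (hw l hl).le)
        (mul_pos h0 (hw' l hl))
  -- the forms that are extremal for the end points are extremal for all pairs of points between
  have hseg₁ : ∀ s s' : F, s ≤ s' → ∀ l ∈ L, l ((1 - s) • w + s • w') *
      l₁ ((1 - s') • w + s' • w') ≤ l₁ ((1 - s) • w + s • w') * l ((1 - s') • w + s' • w') := by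
    intro s s' hs l hl
    simp only [map_add, map_smul, smul_eq_mul]
    have := mul_nonneg (sub_nonneg.2 hs) (sub_nonneg.2 (hmax₁ l hl))
    linear_combination this
  have hseg₂ : ∀ s s' : F, s ≤ s' → ∀ l ∈ L, l ((1 - s') • w + s' • w') *
      l₂ ((1 - s) • w + s • w') ≤ l₂ ((1 - s') • w + s' • w') * l ((1 - s) • w + s • w') := by
    intro s s' hs l hl
    simp only [map_add, map_smul, smul_eq_mul]
    have := mul_nonneg (sub_nonneg.2 hs) (sub_nonneg.2 (hmax₂ l hl))
    linear_combination this
  refine ⟨fun s => Real.log (v (l₁ ((1 - s) • w + s • w'))) -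
    Real.log (v (l₂ ((1 - s) • w + s • w'))), ?_, ?_⟩
  · intro s s' h0 hs h1
    have a1 := hpos l₁ hl₁ s h0 (hs.trans h1)
    have a2 := hpos l₂ hl₂ s h0 (hs.trans h1)
    have b1 := hpos l₁ hl₁ s' (h0.trans hs) h1
    have b2 := hpos l₂ hl₂ s' (h0.trans hs) h1
    dsimp only
    have := Real.log_le_log (v.pos (mul_pos a2 b1).ne')
      (hord _ _ (mul_pos a2 b1).le (hseg₁ s s' hs l₂ hl₂))
    rw [map_mul, map_mul, Real.log_mul (v.ne_zero a2.ne') (v.ne_zero b1.ne'),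
      Real.log_mul (v.ne_zero a1.ne') (v.ne_zero b2.ne')] at this
    linarith
  · rintro s s' h0 hs h1 z z' hz hz' rfl rfl p q hp hq
    rw [h.edist_eq_of_max hord hz hz' hl₁ hl₂ (hseg₁ s s' hs) (hseg₂ s s' hs) hp hq]
    congr 1
    ring

/-- Two points with coordinates along the same maximal flag: the Hilbert distance is the distance
of the logarithms of the coordinates in the model flat. -/
theorem edist_eq_hexDist (h : IsFacetSystem v P L) (hv : IsNonarchimedean v)
    (hord : ∀ x y : F, 0 ≤ x → x ≤ y → v x ≤ v y) {f : Set (Set (Fin n → F))}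
    (hf : Maximal (· ∈ flags P) f) {t t' : Set (Fin n → F) →₀ F}
    (ht : IsBarycentric P t) (ht' : IsBarycentric P t')
    (htf : (t.support : Set (Set (Fin n → F))) ⊆ f)
    (htf' : (t'.support : Set (Set (Fin n → F))) ⊆ f) (htP : 0 < t P) (htP' : 0 < t' P)
    {p q : HilbertDomain v (openPart P) (dualSet_openPart_nonempty P)}
    (hp : Projectivization.mk F _ (h.ne_zero_of_pos ((h.forall_pos_iff ht).2 htP)) = p.pt)
    (hq : Projectivization.mk F _ (h.ne_zero_of_pos ((h.forall_pos_iff ht').2 htP')) = q.pt) :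
    edist p q = ENNReal.ofReal
      (hexDist (logClass v (flagCoord t)) (logClass v (flagCoord t'))) := by
  have hw := (h.forall_pos_iff ht).2 htP
  have hw' := (h.forall_pos_iff ht').2 htP'
  obtain ⟨l₁, hl₁, hmax₁⟩ := h.exists_max_form (w := baryVec t) hw'
  obtain ⟨l₂, hl₂, hmax₂⟩ := h.exists_max_form (w := baryVec t') hw
  rw [h.edist_eq_of_max hord hw hw' hl₁ hl₂ hmax₁ hmax₂ hp hq, hexDist_logClass]
  congr 1
  have hval : ∀ u : Set (Fin n → F) →₀ F, IsBarycentric P u →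
      (u.support : Set (Set (Fin n → F))) ⊆ f → ∀ l ∈ L, ∀ k : ℕ,
      (∀ σ ∈ f, l (homog (barycenter σ)) ≠ 0 ↔ k ≤ faceDim σ) →
        v (l (baryVec u)) = v (tailSum k u) := by
    intro u hu huf l hl k hk
    rw [apply_baryVec, tailSum_apply]
    refine abv_sum_mul_eq hv hord _ _ _ _ (fun σ _ => hu.nonneg σ)
      (fun σ hσ => h.nonneg_barycenter (hu.isFace σ hσ) hl)
      (fun σ _ => by split_ifs <;> simp) fun σ hσ => ?_
    by_cases h0 : l (homog (barycenter σ)) = 0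
    · rw [if_neg fun hc => (hk σ (huf hσ)).2 hc h0, h0]
    · rw [if_pos ((hk σ (huf hσ)).1 h0), h.abv_barycenter σ (hu.isFace σ hσ) l hl h0, map_one]
  let r : Module.Dual F (Fin (n + 1) → F) → ℝ := fun l =>
    Real.log (v (l (baryVec t))) - Real.log (v (l (baryVec t')))
  let ρ : Fin (n + 1) → ℝ := fun k =>
    Real.log (v (flagCoord t k)) - Real.log (v (flagCoord t' k))
  have hr : ∀ l ∈ L, ∃ k, r l = ρ k := fun l hl => by
    obtain ⟨k, hk, hkf⟩ := h.form_along_flag hf hl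
    refine ⟨⟨k, Nat.lt_succ_of_le hk⟩, ?_⟩
    simp only [r, ρ, flagCoord, hval t ht htf l hl k hkf, hval t' ht' htf' l hl k hkf]
  have hρ : ∀ k, ∃ l ∈ L, r l = ρ k := fun k => by
    obtain ⟨l, hl, hkf⟩ := h.exists_form_along_flag hf (Nat.le_of_lt_succ k.2)
    refine ⟨l, hl, ?_⟩
    simp only [r, ρ, flagCoord, hval t ht htf l hl k hkf, hval t' ht' htf' l hl k hkf]
  have hlogle : ∀ a b c d : F, 0 < a → 0 < b → 0 < c → 0 < d → a * b ≤ c * d →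
      Real.log (v a) + Real.log (v b) ≤ Real.log (v c) + Real.log (v d) := by
    intro a b c d ha hb hc hd hle
    rw [← Real.log_mul (v.ne_zero ha.ne') (v.ne_zero hb.ne'),
      ← Real.log_mul (v.ne_zero hc.ne') (v.ne_zero hd.ne'), ← map_mul, ← map_mul]
    exact Real.log_le_log (v.pos (mul_pos ha hb).ne') (hord _ _ (mul_pos ha hb).le hle)
  have hr₁ : ∀ l ∈ L, r l ≤ r l₁ := fun l hl => by
    have := hlogle _ _ _ _ (hw l hl) (hw' l₁ hl₁) (hw l₁ hl₁) (hw' l hl) (hmax₁ l hl)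
    simp only [r]
    linarith
  have hr₂ : ∀ l ∈ L, r l₂ ≤ r l := fun l hl => by
    have := hlogle _ _ _ _ (hw' l hl) (hw l₂ hl₂) (hw' l₂ hl₂) (hw l hl) (hmax₂ l hl)
    simp only [r]
    linarith
  change r l₁ - r l₂ = ⨆ p : Fin (n + 1) × Fin (n + 1), |ρ p.1 - ρ p.2|
  apply le_antisymm
  · obtain ⟨i, hi⟩ := hr l₁ hl₁
    obtain ⟨j, hj⟩ := hr l₂ hl₂
    rw [hi, hj]
    exact (le_abs_self _).trans (le_ciSup (f := fun p : Fin (n + 1) × Fin (n + 1) =>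
      |ρ p.1 - ρ p.2|) (Set.finite_range _).bddAbove (i, j))
  · refine ciSup_le fun p => ?_
    obtain ⟨l, hl, hli⟩ := hρ p.1
    obtain ⟨m, hm, hmj⟩ := hρ p.2
    rw [← hli, ← hmj]
    exact abs_sub_le_of_le_of_le (hr₂ l hl) (hr₁ l hl) (hr₂ m hm) (hr₁ m hm)

end IsFacetSystem

end Distance

/-! ### Points in flag coordinates -/

section FlagRep

variable {F : Type*} [Field F] [LinearOrder F] [TopologicalSpace F] {n : ℕ}
  {v : AbsoluteValue F ℝ} {P : Set (Fin n → F)}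

/-- The coefficients `t` are barycentric coordinates of the point `p` of the interior of `P` (up
to scaling), supported on the flag `f`. -/
structure IsFlagRep (f : Set (Set (Fin n → F))) (t : Set (Fin n → F) →₀ F)
    (p : HilbertDomain v (openPart P) (dualSet_openPart_nonempty P)) : Prop where
  nonneg : ∀ σ, 0 ≤ t σ
  support_subset : (t.support : Set (Set (Fin n → F))) ⊆ f
  pos : 0 < t P
  pt_eq : ∃ hw : baryVec t ≠ 0, Projectivization.mk F (baryVec t) hw = p.pt

theorem IsFlagRep.mono {f f' : Set (Set (Fin n → F))} {t : Set (Fin n → F) →₀ F}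
    {p : HilbertDomain v (openPart P) (dualSet_openPart_nonempty P)} (h : IsFlagRep f t p)
    (hf : f ⊆ f') : IsFlagRep f' t p :=
  ⟨h.nonneg, h.support_subset.trans hf, h.pos, h.pt_eq⟩

end FlagRep

section FlagCoordinates

variable {F : Type*} [Field F]

theorem ModelFlat.mk_eq_mk_iff {Λ : AddSubgroup ℝ} {d : ℕ} {α β : Fin d → Λ} :
    ModelFlat.mk α = ModelFlat.mk β ↔ ∃ c : Λ, ∀ i, β i = α i + c := by
  refine QuotientAddGroup.eq.trans ⟨?_, ?_⟩
  · rintro ⟨c, hc⟩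
    refine ⟨c, fun i => ?_⟩
    rw [← congrFun hc i]
    simp
  · rintro ⟨c, hc⟩
    refine ⟨c, ?_⟩
    funext i
    simp [hc i]

theorem eq_of_hexDist_nonpos {Λ : AddSubgroup ℝ} {d : ℕ} {a b : ModelFlat Λ d}
    (h : hexDist a b ≤ 0) : a = b := by
  obtain ⟨α, rfl⟩ := QuotientAddGroup.mk_surjective a
  obtain ⟨β, rfl⟩ := QuotientAddGroup.mk_surjective b
  have h1 : ∀ i j, (β i : ℝ) - α i = β j - α j := fun i j => by
    have h2 : |((α - β) i : ℝ) - ((α - β) j : ℝ)| ≤ 0 :=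
      (le_ciSup (f := fun p : Fin d × Fin d => |((α - β) p.1 : ℝ) - ((α - β) p.2 : ℝ)|)
        (Set.finite_range _).bddAbove (i, j)).trans h
    have h3 := abs_nonpos_iff.1 h2
    simp only [Pi.sub_apply, AddSubgroup.coe_sub] at h3
    linarith
  refine ModelFlat.mk_eq_mk_iff.2 ?_
  rcases isEmpty_or_nonempty (Fin d) with hd | ⟨⟨i₀⟩⟩
  · exact ⟨0, fun i => hd.elim i⟩
  · refine ⟨β i₀ - α i₀, fun i => Subtype.ext ?_⟩
    have := h1 i i₀
    simp only [AddSubgroup.coe_add, AddSubgroup.coe_sub]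
    linarith

theorem logClass_const_mul (v : AbsoluteValue F ℝ) {d : ℕ} {c : F} (hc : c ≠ 0) {x : Fin d → F}
    (hx : ∀ i, x i ≠ 0) : logClass v (fun i => c * x i) = logClass v x := by
  refine (ModelFlat.mk_eq_mk_iff.2 ⟨⟨Real.log (v c), log_mem_valueGroup v c⟩, fun i => ?_⟩).symm
  apply Subtype.ext
  simp only [AddSubgroup.coe_add]
  rw [map_mul, Real.log_mul (v.ne_zero hc) (v.ne_zero (hx i)), add_comm]

theorem flagCoord_smul {n : ℕ} (c : F) (t : Set (Fin n → F) →₀ F) :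
    flagCoord (c • t) = fun i => c * flagCoord t i := by
  funext i
  simp [flagCoord]

variable [LinearOrder F] [IsStrictOrderedRing F]

/-- A decreasing sequence in the value group is the sequence of logarithms of a decreasing
sequence of positive elements, which can be taken constant where the given sequence is. -/
theorem exists_log_eq (v : AbsoluteValue F ℝ) (hord : ∀ x y : F, 0 ≤ x → x ≤ y → v x ≤ v y)
    {d : ℕ} (α : Fin d → valueGroup v) (hα : Antitone α) :
    ∃ x : Fin d → F, Antitone x ∧ (∀ i, 0 < x i) ∧ (∀ i, Real.log (v (x i)) = α i) ∧
      ∀ i j, α i = α j → x i = x j := by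
  have hsec : ∀ c : valueGroup v, ∃ x : F, 0 < x ∧ Real.log (v x) = c := by
    rintro ⟨c, x, hx, rfl⟩
    rcases lt_or_gt_of_ne hx with h | h
    · exact ⟨-x, neg_pos.2 h, by rw [v.map_neg]⟩
    · exact ⟨x, h, rfl⟩
  choose g hg hgv using hsec
  refine ⟨fun i => g (α i), fun i j hij => ?_, fun i => hg _, fun i => hgv _,
    fun i j h => congrArg g h⟩
  by_contra! hlt
  have h1 := Real.log_le_log (v.pos (hg (α i)).ne') (hord _ _ (hg (α i)).le hlt.le)
  rw [hgv, hgv] at h1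
  have h2 : α i = α j := le_antisymm h1 (hα hij)
  rw [h2] at hlt
  exact lt_irrefl _ hlt

variable {n : ℕ}

theorem mem_barycentricSimplex_iff {f : Set (Set (Fin n → F))} {x : Fin n → F} :
    x ∈ barycentricSimplex f ↔ ∃ t : Set (Fin n → F) →₀ F, (∀ σ, 0 ≤ t σ) ∧
      (t.support : Set (Set (Fin n → F))) ⊆ f ∧ baryVec t = homog x := by
  classical
  constructor
  · intro hx
    obtain ⟨ι, _, c, z, hc, hc1, hz, rfl⟩ := mem_convexHull_iff_exists_fintype.1 hx
    choose σ hσ hσz using hz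
    refine ⟨∑ i, Finsupp.single (σ i) (c i), fun τ => ?_, fun τ hτ => ?_, ?_⟩
    · rw [Finsupp.finsetSum_apply]
      refine Finset.sum_nonneg fun i _ => ?_
      rw [Finsupp.single_apply]
      split_ifs
      · exact hc i
      · exact le_rfl
    · have h0 := Finsupp.mem_support_iff.1 hτ
      rw [Finsupp.finsetSum_apply] at h0
      obtain ⟨i, -, hi⟩ := Finset.exists_ne_zero_of_sum_ne_zero h0
      by_contra hτf
      refine hi (Finsupp.single_eq_of_ne ?_)
      rintro rfl
      exact hτf (hσ i)
    · simp only [map_sum, baryVec_single, hσz]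
      exact sum_smul_homog _ _ _ hc1
  · rintro ⟨t, h0, htf, ht⟩
    rw [baryVec, Finsupp.linearCombination_apply, Finsupp.sum] at ht
    have h1 : ∑ σ ∈ t.support, t σ = 1 := by
      have := congrFun ht (Fin.last n)
      simpa [Finset.sum_apply] using this
    rw [sum_smul_homog _ _ _ h1] at ht
    rw [← homog_injective ht]
    exact (convex_convexHull F _).sum_mem (fun σ _ => h0 σ) h1
      fun σ hσ => subset_convexHull F _ ⟨σ, htf hσ, rfl⟩

theorem flagCoord_antitone {t : Set (Fin n → F) →₀ F} (h0 : ∀ σ, 0 ≤ t σ) :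
    Antitone (flagCoord t) := fun _ _ hij => tailSum_antitone h0 (Fin.val_le_of_le hij)

variable [TopologicalSpace F] {v : AbsoluteValue F ℝ} {P : Set (Fin n → F)}
  {L : Finset (Module.Dual F (Fin (n + 1) → F))}

namespace IsFacetSystem

theorem flagCoord_pos (h : IsFacetSystem v P L) {t : Set (Fin n → F) →₀ F} (h0 : ∀ σ, 0 ≤ t σ)
    (hP : 0 < t P) (i : Fin (n + 1)) : 0 < flagCoord t i :=
  h.tailSum_pos h0 hP (Nat.le_of_lt_succ i.2)

theorem logClass_mem_weylFace (h : IsFacetSystem v P L)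
    (hord : ∀ x y : F, 0 ≤ x → x ≤ y → v x ≤ v y) {f : Set (Set (Fin n → F))}
    {t : Set (Fin n → F) →₀ F} (h0 : ∀ σ, 0 ≤ t σ)
    (htf : (t.support : Set (Set (Fin n → F))) ⊆ f) (hP : 0 < t P) :
    logClass v (flagCoord t) ∈ weylFace (valueGroup v) (n + 1) (flagType P f) := by
  refine ⟨⟨_, rfl, fun i j hij hj => Subtype.ext ?_⟩, ⟨_, rfl, fun i j hij => ?_⟩⟩
  · have : flagCoord t i = flagCoord t j := by
      rw [flagCoord, flagCoord, hij]
      refine tailSum_eq_succ fun σ hσ hd => hj ⟨σ, htf hσ, ?_, by omega⟩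
      rintro rfl
      rw [h.faceDim_self] at hd
      omega
    simp only [this]
  · exact Subtype.coe_le_coe.1 (Real.log_le_log (v.pos (h.flagCoord_pos h0 hP j).ne')
      (hord _ _ (h.flagCoord_pos h0 hP j).le (flagCoord_antitone h0 hij)))

/-- The cell of a maximal flag is the full Weyl chamber, as `D(f) = {1, …, n}`. -/
theorem weylFace_eq_weylChamber (h : IsFacetSystem v P L) {f : Set (Set (Fin n → F))}
    (hf : Maximal (· ∈ flags P) f) (Λ : AddSubgroup ℝ) :
    weylFace Λ (n + 1) (flagType P f) = weylChamber Λ (n + 1) := by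
  refine Set.inter_eq_right.2 ?_
  rintro a ⟨α, hα, -⟩
  refine ⟨α, hα, fun i j hij hj => absurd ?_ hj⟩
  obtain ⟨σ, hσ, hd⟩ := h.exists_faceDim_eq hf (k := i) (by omega)
  refine ⟨σ, hσ, ?_, by omega⟩
  rintro rfl
  rw [h.faceDim_self] at hd
  omega

theorem exists_flagRep (h : IsFacetSystem v P L)
    (p : HilbertDomain v (openPart P) (dualSet_openPart_nonempty P)) :
    ∃ f ∈ starFlags P, ∃ t, IsFlagRep f t p := by
  obtain ⟨x, hx, hxp⟩ := p.mem
  rw [h.mem_interior_iff] at hx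
  obtain ⟨t, ht, htx⟩ := h.exists_barycentric fun l hl => (hx l hl).le
  have hP : 0 < t P := (h.forall_pos_iff ht).1 (by rwa [htx])
  have hPs : P ∈ t.support := Finsupp.mem_support_iff.2 hP.ne'
  refine ⟨t.support, ⟨⟨⟨P, hPs⟩, Finset.finite_toSet _, ht.isFace, ht.chain⟩, hPs⟩, t,
    ht.nonneg, subset_rfl, hP, ?_⟩
  rw [htx]
  exact ⟨homog_ne_zero x, hxp⟩

/-- Barycentric coordinates of the same point have the same support and are proportional. -/
theorem flagRep_unique (h : IsFacetSystem v P L) {f f' : Set (Set (Fin n → F))}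
    (hf : f ∈ flags P) (hf' : f' ∈ flags P) {t t' : Set (Fin n → F) →₀ F}
    {p : HilbertDomain v (openPart P) (dualSet_openPart_nonempty P)}
    (ht : IsFlagRep f t p) (ht' : IsFlagRep f' t' p) : ∃ c : F, 0 < c ∧ t = c • t' := by
  have hb := isBarycentric_of_flag hf ht.nonneg ht.support_subset
  have hb' := isBarycentric_of_flag hf' ht'.nonneg ht'.support_subset
  obtain ⟨hw, he⟩ := ht.pt_eq
  obtain ⟨hw', he'⟩ := ht'.pt_eq
  obtain ⟨c, hc⟩ := (Projectivization.mk_eq_mk_iff' F _ _ hw hw').1 (he.trans he'.symm)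
  obtain ⟨l, hl, -⟩ := h.exists_form_notMem h.isFace_self
  have hpos : 0 < c := by
    have h1 := (h.forall_pos_iff hb).2 ht.pos l hl
    have h2 := (h.forall_pos_iff hb').2 ht'.pos l hl
    rw [← hc, map_smul, smul_eq_mul] at h1
    exact pos_of_mul_pos_left h1 h2.le
  exact ⟨c, hpos, h.baryVec_inj hb (hb'.smul hpos.le) (by rw [map_smul, hc])⟩

/-- Every point of a cell is the class of the logarithms of the coordinates of a point of `Ω`. -/
theorem exists_flagRep_of_mem_weylFace (h : IsFacetSystem v P L)
    (hord : ∀ x y : F, 0 ≤ x → x ≤ y → v x ≤ v y) {f : Set (Set (Fin n → F))}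
    (hf : f ∈ starFlags P) {a : ModelFlat (valueGroup v) (n + 1)}
    (ha : a ∈ weylFace (valueGroup v) (n + 1) (flagType P f)) :
    ∃ (p : HilbertDomain v (openPart P) (dualSet_openPart_nonempty P)) (t : _),
      IsFlagRep f t p ∧ logClass v (flagCoord t) = a := by
  obtain ⟨⟨β, hβ, hβD⟩, ⟨α, hα, hanti⟩⟩ := ha
  obtain ⟨c, hc⟩ := ModelFlat.mk_eq_mk_iff.1 (hα.trans hβ.symm)
  have hαD : ∀ i j : Fin (n + 1), (j : ℕ) = i + 1 → (j : ℕ) ∉ flagType P f → α i = α j :=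
    fun i j hij hj => by
      have := hβD i j hij hj
      rwa [hc, hc, add_left_inj] at this
  obtain ⟨x, hx, hpos, hlog, hconst⟩ := exists_log_eq v hord α hanti
  obtain ⟨f', hff', hf'⟩ := h.exists_maximal_flag hf.1
  obtain ⟨t, h0, htf', htP, htx, hts⟩ := h.exists_tailSum_eq hf' x hx fun i => (hpos i).le
  have hP : 0 < t P := htP ▸ hpos _
  have hw := (h.forall_pos_iff (isBarycentric_of_flag hf'.1 h0 htf')).2 hP
  refine ⟨⟨_, h.mem_openPart_of_pos hw⟩, t, ⟨h0, fun σ hσ => ?_, hP, h.ne_zero_of_pos hw, rfl⟩, ?_⟩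
  · by_contra hσf
    have hσf' := htf' hσ
    have hPf' := hff' hf.2
    have hlt : faceDim σ < n := by
      refine lt_of_le_of_ne (h.faceDim_le_self (hf'.1.2.2.1 σ hσf')) fun hd => hσf ?_
      rw [h.faceDim_injOn hf'.1 hσf' hPf' (hd.trans h.faceDim_self.symm)]
      exact hf.2
    refine hts σ hσ ⟨faceDim σ, by omega⟩ ⟨faceDim σ + 1, by omega⟩ rfl rfl
      (hconst _ _ (hαD _ _ rfl ?_))
    rintro ⟨ρ, hρ, -, hd⟩
    refine hσf ?_
    rw [h.faceDim_injOn hf'.1 hσf' (hff' hρ) (Nat.succ_injective hd)]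
    exact hρ
  · rw [← hα]
    refine congrArg ModelFlat.mk (funext fun i => Subtype.ext ?_)
    simp only [flagCoord, htx, hlog]

/-- The distance formula for an arbitrary flag, by extension to a maximal one. -/
theorem edist_eq_of_flagRep (h : IsFacetSystem v P L) (hv : IsNonarchimedean v)
    (hord : ∀ x y : F, 0 ≤ x → x ≤ y → v x ≤ v y) {f : Set (Set (Fin n → F))}
    (hf : f ∈ flags P) {t t' : Set (Fin n → F) →₀ F}
    {p q : HilbertDomain v (openPart P) (dualSet_openPart_nonempty P)}
    (hp : IsFlagRep f t p) (hq : IsFlagRep f t' q) :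
    edist p q = ENNReal.ofReal
      (hexDist (logClass v (flagCoord t)) (logClass v (flagCoord t'))) := by
  obtain ⟨f', hff', hf'⟩ := h.exists_maximal_flag hf
  obtain ⟨hw, hpe⟩ := hp.pt_eq
  obtain ⟨hw', hqe⟩ := hq.pt_eq
  exact h.edist_eq_hexDist hv hord hf' (isBarycentric_of_flag hf hp.nonneg hp.support_subset)
    (isBarycentric_of_flag hf hq.nonneg hq.support_subset) (hp.support_subset.trans hff')
    (hq.support_subset.trans hff') hp.pos hq.pos hpe hqe

/-- The part of `Ω` in the barycentric simplex of a flag. -/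
theorem mem_image_barycentricSimplex_iff (h : IsFacetSystem v P L) {f : Set (Set (Fin n → F))}
    (hf : f ∈ flags P) {z : ℙ F (Fin (n + 1) → F)} :
    z ∈ affineChart '' (interior P ∩ barycentricSimplex f) ↔
      ∃ t : Set (Fin n → F) →₀ F, (∀ σ, 0 ≤ t σ) ∧
        (t.support : Set (Set (Fin n → F))) ⊆ f ∧ 0 < t P ∧
        ∃ hw : baryVec t ≠ 0, Projectivization.mk F (baryVec t) hw = z := by
  constructor
  · rintro ⟨x, ⟨hx, hxf⟩, rfl⟩
    obtain ⟨t, h0, htf, htx⟩ := mem_barycentricSimplex_iff.1 hxf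
    refine ⟨t, h0, htf, (h.forall_pos_iff (isBarycentric_of_flag hf h0 htf)).1 ?_, ?_⟩
    · rw [htx]
      exact (h.mem_interior_iff x).1 hx
    · rw [htx]
      exact ⟨homog_ne_zero x, rfl⟩
  · rintro ⟨t, h0, htf, hP, hw, rfl⟩
    have hpos := (h.forall_pos_iff (isBarycentric_of_flag hf h0 htf)).2 hP
    obtain ⟨c, hc, x, hx, htx⟩ := h.exists_interior_of_pos hpos
    refine ⟨x, ⟨hx, mem_barycentricSimplex_iff.2 ⟨c⁻¹ • t, fun σ => ?_, ?_, ?_⟩⟩, ?_⟩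
    · exact mul_nonneg (inv_pos.2 hc).le (h0 σ)
    · exact fun σ hσ => htf (Finsupp.support_smul hσ)
    · rw [map_smul, htx, smul_smul, inv_mul_cancel₀ hc.ne', one_smul]
    · rw [affineChart_eq, Projectivization.mk_eq_mk_iff']
      exact ⟨c⁻¹, by rw [htx, smul_smul, inv_mul_cancel₀ hc.ne', one_smul]⟩

/-- In the basis of a maximal flag, the cone over its barycentric simplex consists of the vectors
with decreasing nonnegative coordinates. -/
theorem exists_flagBasis_cone (h : IsFacetSystem v P L) {f : Set (Set (Fin n → F))}
    (hf : Maximal (· ∈ flags P) f) :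
    ∃ e : Module.Basis (Fin (n + 1)) F (Fin (n + 1) → F),
      (∀ t : Set (Fin n → F) →₀ F, (t.support : Set (Set (Fin n → F))) ⊆ f →
        ⇑(e.repr (baryVec t)) = flagCoord t) ∧
      ∀ w, Antitone (e.repr w) → (∀ i, 0 ≤ e.repr w i) →
        ∃ t : Set (Fin n → F) →₀ F, (∀ σ, 0 ≤ t σ) ∧
          (t.support : Set (Set (Fin n → F))) ⊆ f ∧ t P = e.repr w (Fin.last n) ∧
          baryVec t = w := by
  obtain ⟨e, he⟩ := h.exists_flagBasis hf
  refine ⟨e, fun t ht => funext fun i => he t ht i, fun w hw h0 => ?_⟩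
  obtain ⟨t, ht, htf, htP, htx, -⟩ := h.exists_tailSum_eq hf _ hw h0
  refine ⟨t, ht, htf, htP, e.repr.injective (Finsupp.ext fun i => ?_)⟩
  rw [he t htf, htx]

/-- The cone over the barycentric simplex of a maximal flag is cut out by finitely many forms. -/
theorem exists_forms_of_flag (h : IsFacetSystem v P L) {f : Set (Set (Fin n → F))}
    (hf : Maximal (· ∈ flags P) f) :
    ∃ Q : Finset (Module.Dual F (Fin (n + 1) → F)), ∀ w,
      (∃ t : Set (Fin n → F) →₀ F, (∀ σ, 0 ≤ t σ) ∧
        (t.support : Set (Set (Fin n → F))) ⊆ f ∧ baryVec t = w) ↔ ∀ m ∈ Q, 0 ≤ m w := by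
  classical
  obtain ⟨e, he, hcone⟩ := h.exists_flagBasis_cone hf
  refine ⟨Finset.univ.image e.coord ∪
    (Finset.univ.filter fun q : Fin (n + 1) × Fin (n + 1) => q.1 ≤ q.2).image
      fun q => e.coord q.1 - e.coord q.2, fun w => ⟨?_, fun hQ => ?_⟩⟩
  · rintro ⟨t, h0, htf, rfl⟩ m hm
    rcases Finset.mem_union.1 hm with hm | hm
    · obtain ⟨i, -, rfl⟩ := Finset.mem_image.1 hm
      rw [Module.Basis.coord_apply, he t htf, flagCoord, tailSum_apply]
      exact Finset.sum_nonneg fun σ _ => mul_nonneg (h0 σ) (by split_ifs <;> simp)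
    · obtain ⟨q, hq, rfl⟩ := Finset.mem_image.1 hm
      rw [LinearMap.sub_apply, Module.Basis.coord_apply, Module.Basis.coord_apply, he t htf,
        sub_nonneg]
      exact flagCoord_antitone h0 (Finset.mem_filter.1 hq).2
  · obtain ⟨t, h0, htf, -, htw⟩ := hcone w
      (fun i j hij => sub_nonneg.1 (hQ (e.coord i - e.coord j) (Finset.mem_union_right _
        (Finset.mem_image.2 ⟨(i, j), Finset.mem_filter.2 ⟨Finset.mem_univ _, hij⟩, rfl⟩))))
      (fun i => hQ (e.coord i) (Finset.mem_union_left _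
        (Finset.mem_image_of_mem _ (Finset.mem_univ i))))
    exact ⟨t, h0, htf, htw⟩

end IsFacetSystem

end FlagCoordinates

/-! ### The map to the realization -/

section Realization

variable {F : Type*} [Field F] [LinearOrder F] {n : ℕ}

theorem edist_cellMap_le {P : Set (Fin n → F)} {Λ : AddSubgroup ℝ} (f : starFlags P)
    (a b : weylFace Λ (n + 1) (flagType P f.1)) :
    edist (cellMap f a) (cellMap f b) ≤ ENNReal.ofReal (hexDist a.1 b.1) := by
  refine (glueDist_le (m := 0) (x := fun _ => ⟨f, a⟩) (y := fun _ => ⟨f, b⟩)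
    ⟨rfl, rfl, fun k hk => absurd hk (Nat.not_lt_zero k)⟩).trans_eq ?_
  simp [preDist]

theorem cellMap_eq_of_subset {P : Set (Fin n → F)} {Λ : AddSubgroup ℝ} {f f' : starFlags P}
    (hff' : f.1 ⊆ f'.1) {a : weylFace Λ (n + 1) (flagType P f.1)}
    {a' : weylFace Λ (n + 1) (flagType P f'.1)} (h : a.1 = a'.1) : cellMap f a = cellMap f' a' :=
  Quot.sound ⟨hff', h⟩

/-- A transitive relation between the points of the unit interval that holds on all subintervals
without a break point in the interior holds on the whole interval. -/
theorem rel_of_breakpoints {F : Type*} [LinearOrder F] [Zero F] [One F] (h01 : (0 : F) ≤ 1)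
    (B : Finset F) (R : F → F → Prop)
    (htrans : ∀ a b c, 0 ≤ a → a ≤ b → b ≤ c → c ≤ 1 → R a b → R b c → R a c)
    (hbase : ∀ a b, 0 ≤ a → a ≤ b → b ≤ 1 → (∀ s ∈ B, a < s → ¬ s < b) → R a b) : R 0 1 := by
  suffices h : ∀ a b, 0 ≤ a → a ≤ b → b ≤ 1 → R a b from h 0 1 le_rfl h01 le_rfl
  intro a b ha hab hb
  induction hk : (B.filter fun s => a < s ∧ s < b).card using Nat.strong_induction_on
    generalizing a b with
  | _ k ih =>
    by_cases hs : ∃ s ∈ B, a < s ∧ s < b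
    · obtain ⟨s, hsB, has, hsb⟩ := hs
      have hmem : s ∈ B.filter fun s => a < s ∧ s < b := Finset.mem_filter.2 ⟨hsB, has, hsb⟩
      have hlt : ∀ c d, a ≤ c → d ≤ b → (d = s ∨ c = s) →
          (B.filter fun s => c < s ∧ s < d).card < k := fun c d hc hd hcd => by
        rw [← hk]
        refine Finset.card_lt_card (Finset.ssubset_iff_of_subset ?_ |>.2 ⟨s, hmem, ?_⟩)
        · intro u hu
          obtain ⟨huB, hu1, hu2⟩ := Finset.mem_filter.1 hu
          exact Finset.mem_filter.2 ⟨huB, hc.trans_lt hu1, hu2.trans_le hd⟩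
        · intro hu
          obtain ⟨-, hu1, hu2⟩ := Finset.mem_filter.1 hu
          rcases hcd with rfl | rfl
          · exact lt_irrefl _ hu2
          · exact lt_irrefl _ hu1
      exact htrans a s b ha has.le hsb.le hb
        (ih _ (hlt a s le_rfl hsb.le (Or.inl rfl)) a s ha has.le (hsb.le.trans hb) rfl)
        (ih _ (hlt s b has.le le_rfl (Or.inr rfl)) s b (ha.trans has.le) hsb.le hb rfl)
    · push Not at hs
      exact hbase a b ha hab hb fun s hsB has hsb => absurd hsb (not_lt.2 (hs s hsB has))

variable [IsStrictOrderedRing F] [TopologicalSpace F] {v : AbsoluteValue F ℝ}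
  {P : Set (Fin n → F)} {L : Finset (Module.Dual F (Fin (n + 1) → F))}

namespace IsFacetSystem

/-- The map `Ψ : Ω → K(P, Λ)` that is given on the simplex of every flag by the logarithms of
the coordinates. -/
theorem exists_logMap (h : IsFacetSystem v P L) (hord : ∀ x y : F, 0 ≤ x → x ≤ y → v x ≤ v y) :
    ∃ Ψ : HilbertDomain v (openPart P) (dualSet_openPart_nonempty P) →
        Realization P (valueGroup v),
      ∀ (p : HilbertDomain v (openPart P) (dualSet_openPart_nonempty P)) (f : starFlags P)
        (t : Set (Fin n → F) →₀ F) (ht : IsFlagRep f.1 t p),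
        Ψ p = cellMap f ⟨logClass v (flagCoord t),
          h.logClass_mem_weylFace hord ht.nonneg ht.support_subset ht.pos⟩ := by
  choose f hf t ht using h.exists_flagRep
  refine ⟨fun p => cellMap ⟨f p, hf p⟩ ⟨logClass v (flagCoord (t p)),
    h.logClass_mem_weylFace hord (ht p).nonneg (ht p).support_subset (ht p).pos⟩,
    fun p f' t' ht' => ?_⟩
  obtain ⟨c, hc, he⟩ := h.flagRep_unique (hf p).1 f'.2.1 (ht p) ht'
  have hlog : logClass v (flagCoord (t p)) = logClass v (flagCoord t') := by
    rw [he, flagCoord_smul, logClass_const_mul v hc.ne' fun i =>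
      (h.flagCoord_pos ht'.nonneg ht'.pos i).ne']
  -- both cells contain the cell of the common subflag on which the coordinates are supported
  have hsupp : ((t p).support : Set (Set (Fin n → F))) ⊆ f p ∩ f'.1 := by
    refine Set.subset_inter (ht p).support_subset fun σ hσ => ht'.support_subset ?_
    rw [he] at hσ
    exact Finsupp.support_smul hσ
  have hstar : f p ∩ f'.1 ∈ starFlags P := by
    refine ⟨⟨⟨P, (hf p).2, f'.2.2⟩, (hf p).1.2.1.subset Set.inter_subset_left,
      fun σ hσ => (hf p).1.2.2.1 σ hσ.1, (hf p).1.2.2.2.mono Set.inter_subset_left⟩,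
      (hf p).2, f'.2.2⟩
  have hmem := h.logClass_mem_weylFace hord (ht p).nonneg hsupp (ht p).pos
  exact (cellMap_eq_of_subset (f := ⟨f p ∩ f'.1, hstar⟩) (f' := ⟨f p, hf p⟩) (a := ⟨_, hmem⟩)
    Set.inter_subset_left rfl).symm.trans
      (cellMap_eq_of_subset (f := ⟨f p ∩ f'.1, hstar⟩) (f' := f') (a' := ⟨_, _⟩)
        Set.inter_subset_right hlog)

/-- A `1`-Lipschitz inverse of the map induced by `Ψ`. -/
theorem exists_inverse (h : IsFacetSystem v P L) (hv : IsNonarchimedean v)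
    (hord : ∀ x y : F, 0 ≤ x → x ≤ y → v x ≤ v y) :
    ∃ Φ : Realization P (valueGroup v) →
        HilbertSpace v (openPart P) (dualSet_openPart_nonempty P),
      (∀ a b, edist (Φ a) (Φ b) ≤ edist a b) ∧
      ∀ (p : HilbertDomain v (openPart P) (dualSet_openPart_nonempty P)) (f : starFlags P)
        (t : Set (Fin n → F) →₀ F) (ht : IsFlagRep f.1 t p),
        Φ (cellMap f ⟨logClass v (flagCoord t),
          h.logClass_mem_weylFace hord ht.nonneg ht.support_subset ht.pos⟩) =
            SeparationQuotient.mk p := by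
  choose p t ht hta using fun q : PreRealization P (valueGroup v) =>
    h.exists_flagRep_of_mem_weylFace hord q.1.2 q.2.2
  have heq : ∀ (f : starFlags P) (u u' : Set (Fin n → F) →₀ F)
      (x y : HilbertDomain v (openPart P) (dualSet_openPart_nonempty P)),
      IsFlagRep f.1 u x → IsFlagRep f.1 u' y →
      logClass v (flagCoord u) = logClass v (flagCoord u') →
      SeparationQuotient.mk x = SeparationQuotient.mk y := by
    intro f u u' x y hx hy he
    refine SeparationQuotient.mk_eq_mk.2 (EMetric.inseparable_iff.2 ?_)
    rw [h.edist_eq_of_flagRep hv hord f.2.1 hx hy, he, hexDist_self, ENNReal.ofReal_zero]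
  let Φ : Realization P (valueGroup v) →
      HilbertSpace v (openPart P) (dualSet_openPart_nonempty P) :=
    Quot.lift (fun q => SeparationQuotient.mk (p q)) fun q q' hqq' =>
      heq q'.1 _ _ _ _ ((ht q).mono hqq'.1) (ht q') (by rw [hta, hta, hqq'.2])
  have hΦ : ∀ q q' : PreRealization P (valueGroup v),
      edist (Φ (Realization.mk q)) (Φ (Realization.mk q')) ≤ preDist q q' := by
    rintro ⟨f, a⟩ ⟨f', a'⟩
    by_cases hff' : f = f'
    · subst hff'
      have h1 := h.edist_eq_of_flagRep hv hord f.2.1 (ht ⟨f, a⟩) (ht ⟨f, a'⟩)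
      have ha : logClass v (flagCoord (t ⟨f, a⟩)) = a.1 := hta ⟨f, a⟩
      have ha' : logClass v (flagCoord (t ⟨f, a'⟩)) = a'.1 := hta ⟨f, a'⟩
      rw [ha, ha'] at h1
      simp only [preDist, if_true]
      exact (SeparationQuotient.edist_mk _ _).trans_le h1.le
    · simp [preDist, hff']
  refine ⟨Φ, fun a b => le_iInf fun m => le_iInf fun x => le_iInf fun y => le_iInf fun hc => ?_,
    fun q f u hu => heq f _ _ _ _ (ht ⟨f, _⟩) hu (hta _)⟩
  obtain ⟨hx, hy, hxy⟩ := hc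
  rw [← hx, ← hy]
  have hind : ∀ k ≤ m, edist (Φ (Realization.mk (x 0))) (Φ (Realization.mk (y k))) ≤
      ∑ i ∈ Finset.range (k + 1), preDist (x i) (y i) := by
    intro k hk
    induction k with
    | zero => simpa using hΦ (x 0) (y 0)
    | succ k ih =>
      rw [Finset.sum_range_succ]
      refine (edist_triangle _ (Φ (Realization.mk (y k))) _).trans (add_le_add (ih (by omega)) ?_)
      rw [hxy k (by omega)]
      exact hΦ _ _
  exact hind m le_rfl

/-- `Ψ` does not increase distances and identifies points at distance zero: a segment between two
points crosses finitely many simplices of the barycentric subdivision, and the Hilbert distance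
is additive along it. -/
theorem edist_logMap_le (h : IsFacetSystem v P L) (hv : IsNonarchimedean v)
    (hord : ∀ x y : F, 0 ≤ x → x ≤ y → v x ≤ v y)
    {Ψ : HilbertDomain v (openPart P) (dualSet_openPart_nonempty P) →
      Realization P (valueGroup v)}
    (hΨ : ∀ (p : HilbertDomain v (openPart P) (dualSet_openPart_nonempty P)) (f : starFlags P)
      (t : Set (Fin n → F) →₀ F) (ht : IsFlagRep f.1 t p),
      Ψ p = cellMap f ⟨logClass v (flagCoord t),
        h.logClass_mem_weylFace hord ht.nonneg ht.support_subset ht.pos⟩)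
    (p q : HilbertDomain v (openPart P) (dualSet_openPart_nonempty P)) :
    edist (Ψ p) (Ψ q) ≤ edist p q ∧ (edist p q = 0 → Ψ p = Ψ q) := by
  classical
  obtain ⟨x, hx, hxp⟩ := p.mem
  obtain ⟨y, hy, hyq⟩ := q.mem
  rw [h.mem_interior_iff] at hx hy
  obtain ⟨g, hg, hdist⟩ := h.exists_edist_segment_eq hord hx hy
  let z : F → Fin (n + 1) → F := fun s => (1 - s) • homog x + s • homog y
  have hz : ∀ s, 0 ≤ s → s ≤ 1 → ∀ l ∈ L, 0 < l (z s) := fun s h0 h1 l hl => by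
    simp only [z, map_add, map_smul, smul_eq_mul]
    rcases h0.eq_or_lt with rfl | h0
    · simpa using hx l hl
    · exact add_pos_of_nonneg_of_pos (mul_nonneg (sub_nonneg.2 h1) (hx l hl).le)
        (mul_pos h0 (hy l hl))
  have hpt : ∀ s, ∃ r : HilbertDomain v (openPart P) (dualSet_openPart_nonempty P),
      0 ≤ s → s ≤ 1 → ∃ hs : z s ≠ 0, Projectivization.mk F (z s) hs = r.pt := fun s => by
    by_cases hs : 0 ≤ s ∧ s ≤ 1
    · exact ⟨⟨_, h.mem_openPart_of_pos (hz s hs.1 hs.2)⟩, fun _ _ =>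
        ⟨h.ne_zero_of_pos (hz s hs.1 hs.2), rfl⟩⟩
    · exact ⟨p, fun h0 h1 => absurd ⟨h0, h1⟩ hs⟩
  choose r hr using hpt
  have hrdist : ∀ a b, 0 ≤ a → a ≤ b → b ≤ 1 → edist (r a) (r b) = ENNReal.ofReal (g a - g b) :=
    fun a b ha hab hb => by
      obtain ⟨_, h1⟩ := hr a ha (hab.trans hb)
      obtain ⟨_, h2⟩ := hr b (ha.trans hab) hb
      exact hdist a b ha hab hb _ _ (hz a ha (hab.trans hb)) (hz b (ha.trans hab) hb) rfl rfl
        _ _ h1 h2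
  have hr0 : r 0 = p := by
    obtain ⟨_, h1⟩ := hr 0 le_rfl zero_le_one
    refine HilbertDomain.ext (h1.symm.trans (Eq.trans ?_ hxp))
    rw [affineChart_eq]
    congr 1
    simp [z]
  have hr1 : r 1 = q := by
    obtain ⟨_, h1⟩ := hr 1 zero_le_one le_rfl
    refine HilbertDomain.ext (h1.symm.trans (Eq.trans ?_ hyq))
    rw [affineChart_eq]
    congr 1
    simp [z]
  -- the break points: the parameters at which the segment meets a wall of some maximal flag
  have hQ : ∀ f : Set (Set (Fin n → F)), ∃ Q : Finset (Module.Dual F (Fin (n + 1) → F)),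
      Maximal (· ∈ flags P) f → ∀ w, (∃ t : Set (Fin n → F) →₀ F, (∀ σ, 0 ≤ t σ) ∧
        (t.support : Set (Set (Fin n → F))) ⊆ f ∧ baryVec t = w) ↔ ∀ m ∈ Q, 0 ≤ m w := fun f => by
    by_cases hf : Maximal (· ∈ flags P) f
    · obtain ⟨Q, hQ⟩ := h.exists_forms_of_flag hf
      exact ⟨Q, fun _ => hQ⟩
    · exact ⟨∅, fun hc => absurd hc hf⟩
  choose Q hQ using hQ
  let B : Finset F := h.finite_flags.toFinset.biUnion fun f =>
    (Q f).image fun m => m (homog x) / (m (homog x) - m (homog y))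
  have hmain := rel_of_breakpoints zero_le_one B
    (fun a b => edist (Ψ (r a)) (Ψ (r b)) ≤ ENNReal.ofReal (g a - g b) ∧
      (g a ≤ g b → Ψ (r a) = Ψ (r b))) ?_ ?_
  · have he := hrdist 0 1 le_rfl zero_le_one le_rfl
    rw [hr0, hr1] at hmain he
    refine ⟨hmain.1.trans_eq he.symm, fun h0 => hmain.2 ?_⟩
    rw [he, ENNReal.ofReal_eq_zero] at h0
    linarith
  · rintro a b c ha hab hbc hc ⟨h1, h1'⟩ ⟨h2, h2'⟩
    have hg1 := hg a b ha hab (hbc.trans hc)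
    have hg2 := hg b c (ha.trans hab) hbc hc
    refine ⟨?_, fun hac => (h1' (by linarith)).trans (h2' (by linarith))⟩
    refine (edist_triangle _ (Ψ (r b)) _).trans ((add_le_add h1 h2).trans_eq ?_)
    rw [← ENNReal.ofReal_add (sub_nonneg.2 hg1) (sub_nonneg.2 hg2)]
    congr 1
    ring
  · intro a b ha hab hb hB
    rcases hab.eq_or_lt with rfl | hlt
    · simp
    -- a point in between lies in the simplex of a maximal flag, hence so do the end points
    obtain ⟨m, ham, hmb⟩ := exists_between hlt
    obtain ⟨f, hf, t, ht⟩ := h.exists_flagRep (r m)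
    obtain ⟨_, hrm⟩ := hr m (ha.trans ham.le) (hmb.le.trans hb)
    obtain ⟨f', hff', hf'⟩ := h.exists_maximal_flag hf.1
    have hmQ : ∀ κ ∈ Q f', 0 ≤ κ (z m) := by
      obtain ⟨hw, htm⟩ := ht.pt_eq
      obtain ⟨c, hc⟩ := (Projectivization.mk_eq_mk_iff' F _ _ _ _).1 (hrm.trans htm.symm)
      have hbt := isBarycentric_of_flag hf.1 ht.nonneg ht.support_subset
      obtain ⟨l, hl, -⟩ := h.exists_form_notMem h.isFace_self
      have hcpos : 0 < c := by
        have h1 := hz m (ha.trans ham.le) (hmb.le.trans hb) l hl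
        have h2 := (h.forall_pos_iff hbt).2 ht.pos l hl
        rw [← hc, map_smul, smul_eq_mul] at h1
        exact pos_of_mul_pos_left h1 h2.le
      refine (hQ f' hf' _).1 ⟨c • t, (hbt.smul hcpos.le).nonneg,
        fun σ hσ => hff' (ht.support_subset (Finsupp.support_smul hσ)), ?_⟩
      rw [map_smul, hc]
    have hBκ : ∀ κ ∈ Q f', ∀ s, s = κ (homog x) / (κ (homog x) - κ (homog y)) →
        a < s → ¬ s < b := fun κ hκ s hs => by
      refine hB s (Finset.mem_biUnion.2 ⟨f', h.finite_flags.mem_toFinset.2 hf'.1, ?_⟩)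
      rw [hs]
      exact Finset.mem_image_of_mem _ hκ
    have hκz : ∀ (κ : Module.Dual F (Fin (n + 1) → F)) (s : F),
        κ (z s) = κ (homog x) - s * (κ (homog x) - κ (homog y)) := fun κ s => by
      simp only [z, map_add, map_smul, smul_eq_mul]
      ring
    have haQ : ∀ κ ∈ Q f', 0 ≤ κ (z a) := fun κ hκ => by
      by_contra! hneg
      have h1 := hmQ κ hκ
      rw [hκz] at hneg h1
      have hD : κ (homog x) - κ (homog y) < 0 := by
        by_contra! hD
        have := mul_le_mul_of_nonneg_right ham.le hD
        linarith
      refine hBκ κ hκ _ rfl ?_ (lt_of_le_of_lt ?_ hmb)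
      · rw [lt_div_iff_of_neg hD]
        linarith
      · rw [div_le_iff_of_neg hD]
        linarith
    have hbQ : ∀ κ ∈ Q f', 0 ≤ κ (z b) := fun κ hκ => by
      by_contra! hneg
      have h1 := hmQ κ hκ
      rw [hκz] at hneg h1
      have hD : 0 < κ (homog x) - κ (homog y) := by
        by_contra! hD
        have := mul_le_mul_of_nonpos_right hmb.le hD
        linarith
      refine hBκ κ hκ _ rfl (lt_of_lt_of_le ham ?_) ?_
      · rw [le_div_iff₀ hD]
        linarith
      · rw [div_lt_iff₀ hD]
        linarith
    have hrep : ∀ s, 0 ≤ s → s ≤ 1 → (∀ κ ∈ Q f', 0 ≤ κ (z s)) →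
        ∃ t, IsFlagRep f' t (r s) := fun s h0 h1 hs => by
      obtain ⟨t, ht0, htf, htz⟩ := (hQ f' hf' _).2 hs
      refine ⟨t, ht0, htf, (h.forall_pos_iff (isBarycentric_of_flag hf'.1 ht0 htf)).1 ?_, ?_⟩
      · rw [htz]
        exact hz s h0 h1
      · rw [htz]
        exact hr s h0 h1
    obtain ⟨ta, hta⟩ := hrep a ha (hab.trans hb) haQ
    obtain ⟨tb, htb⟩ := hrep b (ha.trans hab) hb hbQ
    have hstar : f' ∈ starFlags P := ⟨hf'.1, hff' hf.2⟩
    have he := hrdist a b ha hab hb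
    rw [h.edist_eq_of_flagRep hv hord hf'.1 hta htb] at he
    rw [hΨ _ ⟨f', hstar⟩ ta hta, hΨ _ ⟨f', hstar⟩ tb htb, ← he]
    refine ⟨edist_cellMap_le _ _ _, fun hgab => congrArg (cellMap _) (Subtype.ext ?_)⟩
    rw [ENNReal.ofReal_of_nonpos (sub_nonpos.2 hgab), ENNReal.ofReal_eq_zero] at he
    exact eq_of_hexDist_nonpos he

end IsFacetSystem

end Realization

end NAHilbert

theorem theoremC {F : Type*} [Field F] [LinearOrder F] [IsStrictOrderedRing F]
    [TopologicalSpace F] [OrderTopology F]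
    (v : AbsoluteValue F ℝ) (hv : IsNonarchimedean v)
    (hord : ∀ x y : F, 0 ≤ x → x ≤ y → v x ≤ v y)
    (K : Subfield F) (hK : ∀ x ∈ K, v x ≤ 1)
    (n : ℕ) (P : Set (Fin n → F)) (hP : IsIntegralPolytope K P)
    (hint : (interior P).Nonempty) :
    ∃ (Ψ : HilbertDomain v (openPart P) (dualSet_openPart_nonempty P) →
          Realization P (valueGroup v))
      (Ψbar : HilbertSpace v (openPart P) (dualSet_openPart_nonempty P) ≃ᵢ
          Realization P (valueGroup v)),
      -- the isometry is induced by `Ψ`, and all distances are finite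
      (∀ p, Ψbar (SeparationQuotient.mk p) = Ψ p) ∧
      (∀ a b : Realization P (valueGroup v), edist a b ≠ ⊤) ∧
      -- the barycenter goes to the cone point
      (∃ hb : affineChart (barycenter P) ∈ openPart P,
        Ψ ⟨affineChart (barycenter P), hb⟩ =
          conePoint (hint.mono interior_subset) (valueGroup v)) ∧
      -- on the barycentric simplex of each maximal flag
      ∀ f : starFlags P, Maximal (· ∈ flags P) f.1 →
        -- the cell of the flag is a full Weyl chamber, isometrically embedded,
        weylFace (valueGroup v) (n + 1) (flagType P f.1) = weylChamber (valueGroup v) (n + 1) ∧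
        (∀ a b, edist (cellMap (Λ := valueGroup v) f a) (cellMap f b) =
          ENNReal.ofReal (hexDist a.1 b.1)) ∧
        -- the simplex is mapped onto this cell,
        Ψ '' {p | p.pt ∈ affineChart '' (interior P ∩ barycentricSimplex f.1)} =
          Set.range (cellMap f) ∧
        -- and the map is the logarithm of the coordinates in a suitable basis
        ∃ e : Module.Basis (Fin (n + 1)) F (Fin (n + 1) → F),
          affineChart '' (interior P ∩ barycentricSimplex f.1) =
            projImage {w | Antitone (e.repr w) ∧ ∀ i, 0 < e.repr w i} ∧
          ∀ (p : HilbertDomain v (openPart P) (dualSet_openPart_nonempty P))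
            (w : Fin (n + 1) → F) (hw : w ≠ 0),
            Projectivization.mk F w hw = p.pt →
            Antitone (e.repr w) → (∀ i, 0 < e.repr w i) →
            ∃ h : logClass v (e.repr w) ∈ weylFace (valueGroup v) (n + 1) (flagType P f.1),
              Ψ p = cellMap f ⟨logClass v (e.repr w), h⟩ := by
  obtain ⟨L, h⟩ := hP.exists_isFacetSystem v hK hint
  obtain ⟨Ψ, hΨ⟩ := h.exists_logMap hord
  obtain ⟨Φ, hΦle, hΦ⟩ := h.exists_inverse hv hord
  have hΦΨ : ∀ p, Φ (Ψ p) = SeparationQuotient.mk p := fun p => by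
    obtain ⟨f, hf, t, ht⟩ := h.exists_flagRep p
    rw [hΨ p ⟨f, hf⟩ t ht]
    exact hΦ p ⟨f, hf⟩ t ht
  have hiso : ∀ p q, edist (Ψ p) (Ψ q) = edist p q := fun p q => by
    refine le_antisymm (h.edist_logMap_le hv hord hΨ p q).1 ?_
    rw [← SeparationQuotient.edist_mk, ← hΦΨ, ← hΦΨ]
    exact hΦle _ _
  have hcell : ∀ (f : starFlags P) (a : weylFace (valueGroup v) (n + 1) (flagType P f.1)),
      ∃ p t, IsFlagRep f.1 t p ∧ logClass v (flagCoord t) = a.1 ∧ Ψ p = cellMap f a := by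
    intro f a
    obtain ⟨p, t, ht, hta⟩ := h.exists_flagRep_of_mem_weylFace hord f.2 a.2
    refine ⟨p, t, ht, hta, ?_⟩
    rw [hΨ p f t ht]
    exact congrArg (cellMap f) (Subtype.ext hta)
  have hsurj : Function.Surjective Ψ := by
    intro a
    obtain ⟨⟨f, a⟩, rfl⟩ := Quot.exists_rep a
    obtain ⟨p, -, -, -, hp⟩ := hcell f a
    exact ⟨p, hp⟩
  have hlift : ∀ p q, Inseparable p q → Ψ p = Ψ q := fun p q hpq =>
    (h.edist_logMap_le hv hord hΨ p q).2 (EMetric.inseparable_iff.1 hpq)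
  let Ψbar : HilbertSpace v (openPart P) (dualSet_openPart_nonempty P) ≃ᵢ
      Realization P (valueGroup v) :=
    { toFun := SeparationQuotient.lift Ψ hlift
      invFun := Φ
      left_inv := fun a => by
        obtain ⟨p, rfl⟩ := SeparationQuotient.surjective_mk a
        rw [SeparationQuotient.lift_mk, hΦΨ]
      right_inv := fun a => by
        obtain ⟨p, rfl⟩ := hsurj a
        rw [hΦΨ, SeparationQuotient.lift_mk]
      isometry_toFun := fun a b => by
        obtain ⟨p, rfl⟩ := SeparationQuotient.surjective_mk a
        obtain ⟨q, rfl⟩ := SeparationQuotient.surjective_mk b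
        rw [SeparationQuotient.lift_mk, SeparationQuotient.lift_mk, hiso,
          SeparationQuotient.edist_mk] }
  refine ⟨Ψ, Ψbar, fun p => rfl, fun a b => ?_, ?_, fun f hf => ⟨h.weylFace_eq_weylChamber hf _,
    fun a b => ?_, ?_, ?_⟩⟩
  · obtain ⟨p, rfl⟩ := hsurj a
    obtain ⟨q, rfl⟩ := hsurj b
    rw [hiso]
    exact h.edist_ne_top hord p q
  · have hb : affineChart (barycenter P) ∈ openPart P :=
      ⟨_, (h.mem_interior_iff _).2 fun l hl => h.pos_barycenter_self hl, rfl⟩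
    refine ⟨hb, ?_⟩
    have hrep : IsFlagRep (v := v) {P} (Finsupp.single P 1)
        ⟨affineChart (barycenter P), hb⟩ := by
      classical
      refine ⟨fun σ => ?_, fun σ hσ => ?_, by simp, ?_⟩
      · rw [Finsupp.single_apply]
        split_ifs
        · exact zero_le_one
        · exact le_rfl
      · exact Finset.mem_singleton.1 (Finsupp.support_single_subset hσ)
      · rw [baryVec_single, one_smul]
        exact ⟨homog_ne_zero _, rfl⟩
    rw [hΨ _ ⟨{P}, singleton_mem_starFlags (hint.mono interior_subset)⟩ _ hrep]
    refine congrArg (cellMap _) (Subtype.ext ?_)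
    refine congrArg ModelFlat.mk (funext fun i => Subtype.ext ?_)
    have hi : (i : ℕ) ≤ n := Nat.le_of_lt_succ i.2
    simp [flagCoord, h.faceDim_self, hi]
  · obtain ⟨p, t, ht, hta, hp⟩ := hcell f a
    obtain ⟨q, t', ht', hta', hq⟩ := hcell f b
    rw [← hp, ← hq, hiso, h.edist_eq_of_flagRep hv hord f.2.1 ht ht', hta, hta']
  · ext a
    constructor
    · rintro ⟨p, hp, rfl⟩
      obtain ⟨t, h0, htf, htP, hpt⟩ := (h.mem_image_barycentricSimplex_iff f.2.1).1 hp
      exact ⟨_, (hΨ p f t ⟨h0, htf, htP, hpt⟩).symm⟩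
    · rintro ⟨a, rfl⟩
      obtain ⟨p, t, ht, -, hp⟩ := hcell f a
      exact ⟨p, (h.mem_image_barycentricSimplex_iff f.2.1).2
        ⟨t, ht.nonneg, ht.support_subset, ht.pos, ht.pt_eq⟩, hp⟩
  · obtain ⟨e, he, hcone⟩ := h.exists_flagBasis_cone hf
    refine ⟨e, ?_, fun p w hw hwp hanti hpos => ?_⟩
    · ext z
      rw [h.mem_image_barycentricSimplex_iff f.2.1]
      constructor
      · rintro ⟨t, h0, htf, htP, hw, rfl⟩
        refine ⟨baryVec t, ?_, hw, rfl⟩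
        rw [Set.mem_ofPred_eq, he t htf]
        exact ⟨flagCoord_antitone h0, h.flagCoord_pos h0 htP⟩
      · rintro ⟨w, ⟨hanti, hpos⟩, hw, rfl⟩
        obtain ⟨t, h0, htf, htP, rfl⟩ := hcone w hanti fun i => (hpos i).le
        exact ⟨t, h0, htf, htP ▸ hpos _, hw, rfl⟩
    · obtain ⟨t, h0, htf, htP, rfl⟩ := hcone w hanti fun i => (hpos i).le
      have hrep : IsFlagRep f.1 t p := ⟨h0, htf, htP ▸ hpos _, hw, hwp⟩
      have hcoord := he t htf
      have hmem := h.logClass_mem_weylFace hord h0 htf hrep.pos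
      rw [← hcoord] at hmem
      refine ⟨hmem, ?_⟩
      rw [hΨ p f t hrep]
      exact congrArg (cellMap f) (Subtype.ext (congrArg (logClass v) hcoord.symm))
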